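/- **Setting.** $n\ge 1$ agents minimise $f(x)=\frac1n\sum_{i=1}^n f_i(x)$ over $x\in\mathbb R^p$ ($p\ge1$), where $f_i(x)=\mathbb E_{\xi\sim\mathcal D_i}[F_i(x,\xi)]$ and the probability distributions $\mathcal D_i$ and the functions $F_i$ may differ arbitrarily between agents. Write $f^*=\inf f$, $f_i^*=\inf f_i$. Assume: 1. each $f_i$ is bounded below: $f_i^*>-\infty$; 2. the communication graph, with weighted adjacency matrix $A=[A_{ij}]$, $A_{ij}\ge 0$, is undirected ($A_{ij}=A_{ji}$) and connected; $L=\mathrm{diag}(A\mathbf 1)-A$ is its Laplacian; $\rho$ is an upper bound of the spectral radius of $L$ and $\rho_2\in(0,\rho]$ is a lower bound of its smallest positive eigenvalue; 3. the (possibly random) compressor $\mathcal C:\mathbb R^p\to\mathbb R^p$ satisfies $\mathbb E_{\mathcal C}\|\mathcal C(x)/r-x\|^2\le(1-\delta)\|x\|^2$ for all $x$, where $\delta\in(0,1]$, $r>0$; 4. for almost every $\xi$, $F_i(\cdot,\xi)$ is differentiable with $\ell$-Lipschitz gradient, $\ell>0$; 5. $\mathbb E_{\xi\sim\mathcal D_i}\|\nabla_xF_i(x,\xi)-\nabla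 f_i(x)\|^2\le\eta_1^2\|\nabla f_i(x)\|^2+\sigma_1^2$ for all $i,x$, where $\eta_1,\sigma_1\ge0$. No similarity between the agents' data or costs is assumed. **Algorithm (HEDZOC).** Start from deterministic $x_{i,0}\in\mathbb R^p$ and $v_{i,0}=y_{i,0}=z_{i,0}=0$. For $k=0,1,\dots$ and every $i$, draw $\xi_{i,k}\sim\mathcal D_i$ and $\zeta_{i,k}$ uniformly on the unit sphere of $\mathbb R^p$, and set $$q_{i,k}=\mathcal C(x_{i,k}-y_{i,k}),\qquad g^z_{i,k}=\frac{p\,\big(F_i(x_{i,k}+\mu_{i,k}\zeta_{i,k},\xi_{i,k})-F_i(x_{i,k},\xi_{i,k})\big)}{\mu_{i,k}}\,\zeta_{i,k},$$ $$y_{i,k+1}=y_{i,k}+\omega q_{i,k},\qquad z_{i,k+1}=z_{i,k}+\omega\sum_jL_{ij}q_{j,k},$$ $$x_{i,k+1}=x_{i,k}-\alpha\beta\Big(z_{i,k}+\sum_jL_{ij}q_{j,k}\Big)-\alpha\big(\gamma v_{i,k}+g^z_{i,k}\big),\qquad v_{i,k+1}=v_{i,k}+\alpha\gamma\Big(z_{i,k}+\sum_jL_{ij}q_{j,k}\Big).$$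 The samples $\xi_{i,k}$, the directions $\zeta_{i,k}$ and the compressor randomness of the different iterations are mutually independent. Let $\bar x_k=\frac1n\sum_ix_{i,k}$. **Parameters.** For a horizon $T\in\mathbb N$, $$\alpha=\epsilon_3\frac{\sqrt n}{\sqrt{pT}},\quad \gamma=\frac{\epsilon_2}{\alpha},\quad \beta=\epsilon_1\gamma,\quad 0<\mu_{i,k}\le\frac{\kappa_\mu\sqrt{p\alpha}}{\sqrt{n+p}},\quad 0<\omega\le\frac1r,\quad \kappa_\mu>0,$$ $$\epsilon_1>\kappa_1,\quad \epsilon_2\in(0,\kappa_2(\epsilon_1)),\quad \epsilon_3\in[\underline\kappa_3,\bar\kappa_3],\quad T\ge\max\Big\{\frac{n\epsilon_3^2\tilde\kappa_0^2}{p\,\epsilon_2^2},\ \frac{n^3\tilde\kappa_T}{p}\Big\},$$ where $\underline\kappa_3<\bar\kappa_3$ are the positive roots of $8(1+\eta_1^2)\ell^2\epsilon^2+\epsilon^3=\frac14$ and $=\frac34$, respectively. **Theorem.** There exist positive constants $\kappa_1$ (depending only on $\rho_2,\rho$), $\kappa_2$ (depending only on $\rho_2,\rho,\delta,r,\omega,\ell,\epsilon_1$),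 $\tilde\kappa_0=\kappa_0\,p$ with $\kappa_0$ depending only on $\rho_2,\rho,\delta,r,\omega,\ell,\eta_1,\epsilon_1,\epsilon_2$, and $\tilde\kappa_T$ (depending on the same quantities as $\kappa_0$ and on $\sigma_1,\kappa_\mu$ and an upper bound $H$ of $f^*-\frac1n\sum_if_i^*$) such that, for all parameters as above, $$\frac1T\sum_{k=0}^{T-1}\mathbb E\|\nabla f(\bar x_k)\|^2\le C_1\frac{\sqrt p}{\sqrt{nT}}+C_2\frac nT,\qquad \mathbb E[f(\bar x_T)]-f^*\le C_1,\qquad \mathbb E\Big[\frac1n\sum_{i=1}^n\|x_{i,T}-\bar x_T\|^2\Big]\le C_2\frac nT,$$ all expectations being finite. Here $C_1$ depends only on $\ell,\eta_1,\sigma_1,\kappa_\mu,H$ and on upper bounds $\Delta$ of $f(\bar x_0)-f^*$ and $R$ of $\frac1n\sum_i\|x_{i,0}\|^2$; in particular it does not depend on $n$, $p$, $T$, the network, the compressor, $\omega$, $\epsilon_1$ or $\epsilon_2$. The constant $C_2$ depends only on the same quantities and on $\rho_2,\rho,\delta,r,\omega,\epsilon_1,\epsilon_2$; in particular it does not depend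 on $T$ or $p$, and on the network and $n$ only through $\rho_2,\rho$. -/

import Mathlib

open MeasureTheory ProbabilityTheory
open scoped BigOperators

universe u v w

namespace HEDZOC

/-- The Euclidean space `ℝ^p`. -/
abbrev Vec (p : ℕ) : Type := EuclideanSpace ℝ (Fin p)

/-- The unit sphere of `ℝ^p`. -/
abbrev UnitSphere (p : ℕ) : Type := Metric.sphere (0 : Vec p) 1

/-- The uniform probability distribution on the unit sphere of `ℝ^p` (`p ≥ 1`): the
normalized surface measure. -/
noncomputable def uniformSphere (p : ℕ) : Measure (UnitSphere p) :=
  ((volume : Measure (Vec p)).toSphere Set.univ)⁻¹ • (volume : Measure (Vec p)).toSphere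

section Graph

variable {n : ℕ}

/-- The weighted graph Laplacian `L = D - A`, with `D` the diagonal matrix of the row sums. -/
def laplacian (A : Matrix (Fin n) (Fin n) ℝ) : Matrix (Fin n) (Fin n) ℝ :=
  Matrix.diagonal (fun i => ∑ j, A i j) - A

/-- `A` is the weighted adjacency matrix of an undirected connected graph on `n` nodes;
`(j, i)` is an edge exactly when `A i j > 0`. -/
structure IsUndirectedConnected (A : Matrix (Fin n) (Fin n) ℝ) : Prop where
  nonneg : ∀ i j, 0 ≤ A i j
  symm : ∀ i j, A i j = A j i
  connected : (SimpleGraph.fromRel (fun i j => 0 < A i j)).Connected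

/-- All nonzero eigenvalues of `L` lie in `[ρ₂, ρ]`, i.e. the minimum positive eigenvalue of
the (positive semidefinite) matrix `L` is at least `ρ₂` and its spectral radius at most `ρ`. -/
def SpectrumWithin (L : Matrix (Fin n) (Fin n) ℝ) (ρ₂ ρ : ℝ) : Prop :=
  ∀ lam ∈ spectrum ℝ L, lam ≠ 0 → ρ₂ ≤ lam ∧ lam ≤ ρ

end Graph

section Cost

variable {n p : ℕ} {Ξ : Fin n → Type u} [∀ i, MeasurableSpace (Ξ i)]

/-- The local cost `f_i(x) = E_{ξ ∼ D_i} F_i(x, ξ)`. -/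
noncomputable def localCost (F : (i : Fin n) → Vec p → Ξ i → ℝ)
    (D : (i : Fin n) → Measure (Ξ i)) (i : Fin n) (x : Vec p) : ℝ :=
  ∫ ξ, F i x ξ ∂(D i)

/-- The global cost `f = (1/n) ∑ f_i`. -/
noncomputable def globalCost (F : (i : Fin n) → Vec p → Ξ i → ℝ)
    (D : (i : Fin n) → Measure (Ξ i)) (x : Vec p) : ℝ :=
  (1 / (n : ℝ)) * ∑ i, localCost F D i x

/-- The per-sample costs are measurable, and integrable in the sample, so that the local
costs are well-defined expectations. -/
structure WellDefinedCosts (F : (i : Fin n) → Vec p → Ξ i → ℝ)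
    (D : (i : Fin n) → Measure (Ξ i)) : Prop where
  measurable : ∀ i, Measurable (Function.uncurry (F i))
  integrable : ∀ i x, Integrable (F i x) (D i)

/-- Every local cost is bounded below. -/
def LocallyLowerBounded (F : (i : Fin n) → Vec p → Ξ i → ℝ)
    (D : (i : Fin n) → Measure (Ξ i)) : Prop :=
  ∀ i, BddBelow (Set.range (localCost F D i))

/-- For almost every sample, the per-sample cost is `ℓ`-smooth. -/
def SmoothCosts (F : (i : Fin n) → Vec p → Ξ i → ℝ)
    (D : (i : Fin n) → Measure (Ξ i)) (ℓ : ℝ) : Prop :=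
  ∀ i, ∀ᵐ ξ ∂(D i), Differentiable ℝ (fun x => F i x ξ) ∧
    ∀ x y, ‖gradient (fun z => F i z ξ) x - gradient (fun z => F i z ξ) y‖ ≤ ℓ * ‖x - y‖

/-- The variance of the stochastic gradients is at most `η₁² ‖∇ f_i‖² + σ₁²`. -/
def BoundedVariance (F : (i : Fin n) → Vec p → Ξ i → ℝ)
    (D : (i : Fin n) → Measure (Ξ i)) (η₁ σ₁ : ℝ) : Prop :=
  ∀ i x,
    Integrable (fun ξ => ‖gradient (fun z => F i z ξ) x - gradient (localCost F D i) x‖ ^ 2)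
      (D i) ∧
    ∫ ξ, ‖gradient (fun z => F i z ξ) x - gradient (localCost F D i) x‖ ^ 2 ∂(D i)
      ≤ η₁ ^ 2 * ‖gradient (localCost F D i) x‖ ^ 2 + σ₁ ^ 2

end Cost

/-- A stochastic compressor `C : seed × ℝ^p → ℝ^p`, whose seed has law `ν`, with bounded
relative error: `E ‖C(x)/r - x‖² ≤ (1 - δ) ‖x‖²` for all `x`. -/
structure IsCompressor {p : ℕ} {S : Type v} [MeasurableSpace S] (ν : Measure S)
    (C : S → Vec p → Vec p) (δ r : ℝ) : Prop where
  measurable : Measurable (Function.uncurry C)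
  integrable : ∀ x, Integrable (fun s => ‖r⁻¹ • C s x - x‖ ^ 2) ν
  error_le : ∀ x, ∫ s, ‖r⁻¹ • C s x - x‖ ^ 2 ∂ν ≤ (1 - δ) * ‖x‖ ^ 2

section Algorithm

/-- The variables held by the `n` agents at one iteration. -/
structure State (n p : ℕ) where
  x : Fin n → Vec p
  y : Fin n → Vec p
  z : Fin n → Vec p
  v : Fin n → Vec p

/-- The network average `x̄ = (1/n) ∑ x_i`. -/
noncomputable def average {n p : ℕ} (x : Fin n → Vec p) : Vec p :=
  (1 / (n : ℝ)) • ∑ i, x i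

/-- The two-point zeroth-order gradient estimate
`p (F(x + μ ζ, ξ) - F(x, ξ)) / μ • ζ`. -/
noncomputable def zerothOrderGrad {p : ℕ} {X : Type u} (F : Vec p → X → ℝ) (μ : ℝ)
    (ζ : UnitSphere p) (ξ : X) (x : Vec p) : Vec p :=
  ((p : ℝ) * (F (x + μ • (ζ : Vec p)) ξ - F x ξ) / μ) • (ζ : Vec p)

variable {n p : ℕ} {Ξ : Fin n → Type u} {S : Type v}

/-- One iteration of the algorithm, with samples `ξ`, directions `ζ`, compressor seeds `s`. -/
noncomputable def step (L : Matrix (Fin n) (Fin n) ℝ) (F : (i : Fin n) → Vec p → Ξ i → ℝ)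
    (C : S → Vec p → Vec p) (α β γ ω : ℝ) (μ : Fin n → ℝ)
    (ξ : (i : Fin n) → Ξ i) (ζ : Fin n → UnitSphere p) (s : Fin n → S)
    (X : State n p) : State n p :=
  let q : Fin n → Vec p := fun i => C (s i) (X.x i - X.y i)
  let g : Fin n → Vec p := fun i => zerothOrderGrad (F i) (μ i) (ζ i) (ξ i) (X.x i)
  { x := fun i => X.x i - (α * β) • (X.z i + ∑ j, L i j • q j) - α • (γ • X.v i + g i)
    y := fun i => X.y i + ω • q i
    z := fun i => X.z i + ω • ∑ j, L i j • q j
    v := fun i => X.v i + (α * γ) • (X.z i + ∑ j, L i j • q j) }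

/-- The iterates: `x_{i,0} = x0 i`, `y_{i,0} = z_{i,0} = v_{i,0} = 0`, and iteration `k` uses
the parameters `α k, β k, γ k, ω, μ i k` and the random inputs `ξ i k, ζ i k, s i k`. -/
noncomputable def iterates {Ω : Type w} (L : Matrix (Fin n) (Fin n) ℝ)
    (F : (i : Fin n) → Vec p → Ξ i → ℝ) (C : S → Vec p → Vec p)
    (α β γ : ℕ → ℝ) (ω : ℝ) (μ : Fin n → ℕ → ℝ) (x0 : Fin n → Vec p)
    (ξ : (i : Fin n) → ℕ → Ω → Ξ i) (ζ : Fin n → ℕ → Ω → UnitSphere p)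
    (s : Fin n → ℕ → Ω → S) : ℕ → Ω → State n p
  | 0, _ => { x := x0, y := 0, z := 0, v := 0 }
  | k + 1, o =>
      step L F C (α k) (β k) (γ k) ω (fun i => μ i k) (fun i => ξ i k o) (fun i => ζ i k o)
        (fun i => s i k o) (iterates L F C α β γ ω μ x0 ξ ζ s k o)

variable {Ω : Type w} [MeasurableSpace Ω] [∀ i, MeasurableSpace (Ξ i)] [MeasurableSpace S]

/-- The σ-algebras generated by each sample `ξ i k`, by each direction `ζ i k`, and, for each
iteration `k`, by all compressor seeds `s i k`, `i = 1, …, n`, of that iteration. -/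
@[reducible] def inputSigma (ξ : (i : Fin n) → ℕ → Ω → Ξ i) (ζ : Fin n → ℕ → Ω → UnitSphere p)
    (s : Fin n → ℕ → Ω → S) : (Fin n × ℕ) ⊕ (Fin n × ℕ) ⊕ ℕ → MeasurableSpace Ω
  | Sum.inl (i, k) => MeasurableSpace.comap (ξ i k) inferInstance
  | Sum.inr (Sum.inl (i, k)) => MeasurableSpace.comap (ζ i k) inferInstance
  | Sum.inr (Sum.inr k) => ⨆ i, MeasurableSpace.comap (s i k) inferInstance

/-- The random inputs of the algorithm: `ξ i k ∼ D i`, `ζ i k` uniform on the sphere, `s i k ∼ ν`,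
all samples, all directions, and the compressor randomness of the different iterations being
mutually independent (seeds of different agents at the same iteration may be dependent). -/
structure IsRandomInput (P : Measure Ω) (D : (i : Fin n) → Measure (Ξ i)) (ν : Measure S)
    (ξ : (i : Fin n) → ℕ → Ω → Ξ i) (ζ : Fin n → ℕ → Ω → UnitSphere p)
    (s : Fin n → ℕ → Ω → S) : Prop where
  measurable_sample : ∀ i k, Measurable (ξ i k)
  measurable_direction : ∀ i k, Measurable (ζ i k)
  measurable_seed : ∀ i k, Measurable (s i k)
  law_sample : ∀ i k, P.map (ξ i k) = D i
  law_direction : ∀ i k, P.map (ζ i k) = uniformSphere p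
  law_seed : ∀ i k, P.map (s i k) = ν
  indep : iIndep (inputSigma ξ ζ s) P

end Algorithm

/-- The admissible range of the constant `ε₃` in the stepsize `ε₃ √n / √(p T)`: the interval
between the positive roots of `a ε² + ε³ = 1/4` and `a ε² + ε³ = 3/4`, where
`a = 8 (1 + η₁²) ℓ²` (the left side is strictly increasing in `ε > 0`). -/
def StepConstantRange (ℓ η₁ : ℝ) : Set ℝ :=
  {ε | 0 < ε ∧ 1 / 4 ≤ 8 * (1 + η₁ ^ 2) * ℓ ^ 2 * ε ^ 2 + ε ^ 3 ∧
    8 * (1 + η₁ ^ 2) * ℓ ^ 2 * ε ^ 2 + ε ^ 3 ≤ 3 / 4}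

end HEDZOC

/-!
The network average and the disagreement of the agents are analysed separately.

*Disagreement.* Stacking the agents, `L` acts on `(ℝ^p)^n`, and the algorithm keeps `z = L y` and
`∑ v_i = 0` (`IsRun.invariants`). With `h = α γ = ε₂` and the coding error `e = y + q - x`, one
iteration reads `x⁺ = x - h (ε₁ (L x + L e) + v) - α g`, `v⁺ = v + h (L x + L e)`: an inexact
primal-dual flow with stepsize `h`. The energy `⟪x, L x⟫ + ‖v‖² + 2 θ ⟪x, v⟫`, for a small `θ`,
decreases strictly along it; the cross term is what makes it dissipate in `v`. Adding the
squared compression error `‖x - y‖²`, which the compressor contracts and which controls `e`, gives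
a Lyapunov function that contracts in expectation at a rate independent of `n`, `p` and `T`, up to
a multiple of `α² E‖g‖²` (`exists_lyapunov_decrease`, `IsRun.integral_lyapunov_succ_le`). No
primal-dual optimum is involved, hence no similarity between the agents. Since the cross term can
be as small as needed, every `ε₁ > 0` works, and `κ₁ = 1` is an arbitrary choice.

*Average.* The consensus terms cancel in the average, which therefore performs an inexact stochastic
gradient step (`average_step_x`). The bias of the two-point estimator is at most `ℓ μ`, without a
factor `p`: reflecting the direction in the hyperplane orthogonal to `w` shows that only the
variation of the Taylor remainder between mirror images matters
(`abs_integral_inner_zerothOrderGrad_sub_le`). The noises of different agents are uncorrelated, so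
averaging divides the variance by `n`, and the descent lemma applies
(`IsFreshSample.integral_globalCost_le`). The second moment of the estimators is at most `p` times
an affine function of the suboptimality and the consensus error
(`IsFreshSample.integral_average_sq_le`), because `‖∇ f_i‖² ≤ 4 ℓ (f_i - f_i*)`.

*Coupling.* As `α² p ≤ n / T`, the suboptimality `a_k` and the normalised Lyapunov function `V_k`
satisfy a closed pair of recursions. For small `α n` the combination `a_k + (α B / c) V_k` grows by
a factor `1 + O(1 / T)` per iteration, with constants free of the network, so it stays bounded over
the horizon by Grönwall's inequality; bounds for `V_T`, `∑ V_k` and the summed gradients follow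
(`bounds_of_recursions`). The conditions `α p ≲ 1` and `α n ≲ 1` come from the two lower bounds for
`T` (`stepsize_bounds`).
-/

namespace HEDZOC

open scoped RealInnerProductSpace Gradient Pointwise

/-! ### Smooth functions -/

section Smooth

variable {E : Type*} [NormedAddCommGroup E] [InnerProductSpace ℝ E] [CompleteSpace E]

/-- `h` is differentiable and its gradient is `ℓ`-Lipschitz. -/
structure IsSmooth (h : E → ℝ) (ℓ : ℝ) : Prop where
  differentiable : Differentiable ℝ h
  lipschitz : ∀ x y, ‖∇ h x - ∇ h y‖ ≤ ℓ * ‖x - y‖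

variable {h : E → ℝ} {ℓ : ℝ}

/-- On a ball of radius `R` around `x`, the first-order Taylor remainder of a smooth function
is `ℓ R`-Lipschitz. -/
theorem IsSmooth.abs_remainder_sub_le (hh : IsSmooth h ℓ) (hℓ : 0 ≤ ℓ) (x : E) {a b : E} {R : ℝ}
    (ha : ‖a‖ ≤ R) (hb : ‖b‖ ≤ R) :
    |h (x + a) - h (x + b) - ⟪∇ h x, a - b⟫| ≤ ℓ * R * ‖a - b‖ := by
  have hd : ∀ z, HasFDerivAt h (fderiv ℝ h z) z := fun z => (hh.differentiable z).hasFDerivAt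
  have := (convex_closedBall x R).norm_image_sub_le_of_norm_hasFDerivWithin_le'
    (f := h) (f' := fderiv ℝ h) (φ := fderiv ℝ h x) (C := ℓ * R) (x := x + b) (y := x + a)
    (fun z _ => (hd z).hasFDerivWithinAt) (fun z hz => ?_) (by simpa using hb) (by simpa using ha)
  · rw [Real.norm_eq_abs] at this
    rw [inner_gradient_left]
    have e : x + a - (x + b) = a - b := by abel
    rw [e] at this
    exact this
  · rw [← toDual_gradient, ← toDual_gradient, ← map_sub, LinearIsometryEquiv.norm_map]
    refine (hh.lipschitz z x).trans ?_
    have : ‖z - x‖ ≤ R := by simpa [dist_eq_norm] using hz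
    gcongr

theorem IsSmooth.abs_remainder_le (hh : IsSmooth h ℓ) (hℓ : 0 ≤ ℓ) (x a : E) :
    |h (x + a) - h x - ⟪∇ h x, a⟫| ≤ ℓ * ‖a‖ ^ 2 := by
  have := hh.abs_remainder_sub_le hℓ x (a := a) (b := 0) le_rfl (by simp)
  simpa [pow_two, mul_assoc] using this

/-- The squared gradient of a smooth function is controlled by its height above any lower
bound, as seen by a gradient step of length `1 / (2 ℓ)`. -/
theorem IsSmooth.norm_gradient_sq_le (hh : IsSmooth h ℓ) (hℓ : 0 < ℓ) {m : ℝ}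
    (hm : ∀ y, m ≤ h y) (x : E) : ‖∇ h x‖ ^ 2 ≤ 4 * ℓ * (h x - m) := by
  have h1 := (abs_le.1 (hh.abs_remainder_le hℓ.le x (-(1 / (2 * ℓ)) • ∇ h x))).2
  have h2 := hm (x + -(1 / (2 * ℓ)) • ∇ h x)
  rw [inner_smul_right, real_inner_self_eq_norm_sq, norm_smul, mul_pow] at h1
  have e : ‖-(1 / (2 * ℓ))‖ ^ 2 = 1 / (4 * ℓ ^ 2) := by
    rw [Real.norm_eq_abs, sq_abs]; field_simp; norm_num
  rw [e] at h1
  have h3 : ‖∇ h x‖ ^ 2 / (4 * ℓ) ≤ h x - m := by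
    have : ℓ * (1 / (4 * ℓ ^ 2) * ‖∇ h x‖ ^ 2) = ‖∇ h x‖ ^ 2 / (4 * ℓ) := by field_simp
    rw [this] at h1
    have : -(1 / (2 * ℓ)) * ‖∇ h x‖ ^ 2 = - 2 * (‖∇ h x‖ ^ 2 / (4 * ℓ)) := by
      field_simp; ring
    rw [this] at h1
    linarith
  rw [div_le_iff₀ (by positivity)] at h3
  linarith

theorem IsSmooth.continuous_gradient (hh : IsSmooth h ℓ) : Continuous (∇ h) := by
  refine (LipschitzWith.of_dist_le_mul (K := ℓ.toNNReal) fun x y => ?_).continuous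
  rw [dist_eq_norm, dist_eq_norm]
  refine (hh.lipschitz x y).trans ?_
  gcongr
  exact Real.le_coe_toNNReal ℓ

/-- A function with a quadratically small first-order remainder has that gradient. -/
theorem hasGradientAt_of_abs_remainder_le {x g : E} {c : ℝ}
    (H : ∀ a, |h (x + a) - h x - ⟪g, a⟫| ≤ c * ‖a‖ ^ 2) : HasGradientAt h g x := by
  rw [hasGradientAt_iff_isLittleO_nhds_zero]
  refine Asymptotics.IsBigO.trans_isLittleO (g := fun a : E => ‖a‖ ^ 2) ?_ ?_
  · refine Asymptotics.IsBigO.of_bound c (Filter.Eventually.of_forall fun a => ?_)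
    simpa using H a
  · simpa using (Asymptotics.isLittleO_norm_pow_id (E' := E) (n := 2) (by norm_num))

end Smooth

/-! ### The uniform distribution on the sphere -/

section Sphere

variable {p : ℕ}

theorem isProbabilityMeasure_uniformSphere (hp : 1 ≤ p) :
    IsProbabilityMeasure (uniformSphere p) := by
  have : Nontrivial (Vec p) := by
    have : Nonempty (Fin p) := ⟨⟨0, hp⟩⟩
    infer_instance
  constructor
  rw [uniformSphere, Measure.smul_apply, smul_eq_mul]
  refine ENNReal.inv_mul_cancel ?_ (measure_ne_top _ _)
  simp only [ne_eq, Measure.measure_univ_eq_zero]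
  exact Measure.toSphere_ne_zero _

/-- The action of a linear isometry on the unit sphere. -/
noncomputable def sphereMap (e : Vec p ≃ₗᵢ[ℝ] Vec p) (ζ : UnitSphere p) : UnitSphere p :=
  ⟨e ζ, by simp⟩

theorem continuous_sphereMap (e : Vec p ≃ₗᵢ[ℝ] Vec p) : Continuous (sphereMap e) := by
  unfold sphereMap; fun_prop

theorem measurePreserving_sphereMap (e : Vec p ≃ₗᵢ[ℝ] Vec p) :
    MeasurePreserving (sphereMap e) (uniformSphere p) (uniformSphere p) := by
  refine ⟨(continuous_sphereMap e).measurable, ?_⟩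
  rw [uniformSphere, Measure.map_smul]
  congr 1
  ext s hs
  have hm := (continuous_sphereMap e).measurable
  rw [Measure.map_apply hm hs, Measure.toSphere_apply' _ hs, Measure.toSphere_apply' _ (hm hs)]
  congr 1
  have : (Set.Ioo (0 : ℝ) 1 • ((↑) '' (sphereMap e ⁻¹' s)) : Set (Vec p))
      = e ⁻¹' (Set.Ioo (0 : ℝ) 1 • ((↑) '' s)) := by
    ext y
    simp only [Set.mem_smul, Set.mem_image, Set.mem_preimage]
    constructor
    · rintro ⟨t, ht, _, ⟨ζ, hζ, rfl⟩, rfl⟩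
      exact ⟨t, ht, _, ⟨_, hζ, rfl⟩, by simp [sphereMap]⟩
    · rintro ⟨t, ht, _, ⟨ζ, hζ, rfl⟩, hy⟩
      refine ⟨t, ht, _, ⟨sphereMap e.symm ζ, ?_, rfl⟩, ?_⟩
      · convert hζ
        apply Subtype.ext; simp [sphereMap]
      · apply e.injective
        simp [sphereMap, hy]
  rw [this]
  exact (LinearIsometryEquiv.measurePreserving e).measure_preimage_equiv (f := e.toMeasurableEquiv) _

theorem integral_sphereMap (e : Vec p ≃ₗᵢ[ℝ] Vec p) (φ : UnitSphere p → ℝ) :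
    ∫ ζ, φ (sphereMap e ζ) ∂(uniformSphere p) = ∫ ζ, φ ζ ∂(uniformSphere p) := by
  have hinj : Function.Injective (sphereMap e) := fun a b hab =>
    Subtype.ext (e.injective (congrArg Subtype.val hab))
  exact (measurePreserving_sphereMap e).integral_comp
    ((continuous_sphereMap e).isClosedEmbedding hinj).measurableEmbedding φ

theorem integrable_sphere_of_continuous (hp : 1 ≤ p) {φ : UnitSphere p → ℝ} (hφ : Continuous φ) :
    Integrable φ (uniformSphere p) := by
  have := isProbabilityMeasure_uniformSphere hp
  exact hφ.integrable_of_hasCompactSupport (HasCompactSupport.of_compactSpace φ)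

/-- The uniform distribution on the sphere is isotropic. -/
theorem integral_inner_sq (hp : 1 ≤ p) (w : Vec p) :
    ∫ ζ, ⟪w, (ζ : Vec p)⟫ ^ 2 ∂(uniformSphere p) = ‖w‖ ^ 2 / p := by
  have := isProbabilityMeasure_uniformSphere hp
  -- a reflection exchanges any two vectors of equal norm, so the second moment depends on `‖w‖`
  have key : ∀ u w : Vec p, ‖u‖ = ‖w‖ → ∫ ζ, ⟪u, (ζ : Vec p)⟫ ^ 2 ∂(uniformSphere p)
      = ∫ ζ, ⟪w, (ζ : Vec p)⟫ ^ 2 ∂(uniformSphere p) := by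
    intro u w huw
    have hr := Submodule.reflection_sub (F := Vec p) huw
    rw [← integral_sphereMap (Submodule.reflection (ℝ ∙ (u - w))ᗮ)]
    congr 1; ext ζ
    have := LinearIsometryEquiv.inner_map_map (Submodule.reflection (ℝ ∙ (u - w))ᗮ) u
      (sphereMap (Submodule.reflection (ℝ ∙ (u - w))ᗮ) ζ)
    rw [hr] at this
    rw [← this]
    simp [sphereMap]
  have hw : ∀ i : Fin p, ∫ ζ, ⟪w, (ζ : Vec p)⟫ ^ 2 ∂(uniformSphere p)
      = ‖w‖ ^ 2 * ∫ ζ : UnitSphere p, (ζ : Vec p) i ^ 2 ∂(uniformSphere p) := by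
    intro i
    rw [key w (EuclideanSpace.single i ‖w‖) (by simp), ← integral_const_mul]
    congr 1; ext ζ
    simp [mul_pow, PiLp.inner_apply, mul_comm]
  have hsum : (p : ℝ) * ∫ ζ, ⟪w, (ζ : Vec p)⟫ ^ 2 ∂(uniformSphere p) = ‖w‖ ^ 2 := by
    calc (p : ℝ) * ∫ ζ, ⟪w, (ζ : Vec p)⟫ ^ 2 ∂(uniformSphere p)
        = ∑ i : Fin p, ∫ ζ, ⟪w, (ζ : Vec p)⟫ ^ 2 ∂(uniformSphere p) := by simp
      _ = ∑ i : Fin p, ‖w‖ ^ 2 * ∫ ζ : UnitSphere p, (ζ : Vec p) i ^ 2 ∂(uniformSphere p) :=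
          Finset.sum_congr rfl fun i _ => hw i
      _ = ‖w‖ ^ 2 * ∫ ζ : UnitSphere p, ∑ i, (ζ : Vec p) i ^ 2 ∂(uniformSphere p) := by
          rw [← Finset.mul_sum, integral_finsetSum]
          intro i _
          exact integrable_sphere_of_continuous hp (by fun_prop)
      _ = ‖w‖ ^ 2 * ∫ _ζ : UnitSphere p, (1 : ℝ) ∂(uniformSphere p) := by
          congr 2; ext ζ
          have : ‖(ζ : Vec p)‖ ^ 2 = 1 := by simp
          rw [EuclideanSpace.norm_sq_eq] at this
          simpa using this
      _ = ‖w‖ ^ 2 := by simp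
  have : (p : ℝ) ≠ 0 := by positivity
  rw [← hsum]; field_simp

end Sphere

/-! ### Moments of the two-point estimator for one smooth function -/

section Estimator

variable {p : ℕ} {X : Type u}

theorem integral_inner_mul_inner (hp : 1 ≤ p) (g w : Vec p) :
    ∫ ζ, ⟪g, (ζ : Vec p)⟫ * ⟪w, (ζ : Vec p)⟫ ∂(uniformSphere p) = ⟪g, w⟫ / p := by
  have hi : ∀ u : Vec p, Integrable (fun ζ : UnitSphere p => ⟪u, (ζ : Vec p)⟫ ^ 2)
      (uniformSphere p) := fun u => integrable_sphere_of_continuous hp (by fun_prop)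
  have e : ∀ ζ : UnitSphere p, ⟪g, (ζ : Vec p)⟫ * ⟪w, (ζ : Vec p)⟫
      = (1 / 2) * (⟪g + w, (ζ : Vec p)⟫ ^ 2 - ⟪g, (ζ : Vec p)⟫ ^ 2 - ⟪w, (ζ : Vec p)⟫ ^ 2) := by
    intro ζ; rw [inner_add_left]; ring
  simp_rw [e]
  rw [integral_const_mul, integral_sub, integral_sub,
    integral_inner_sq hp, integral_inner_sq hp, integral_inner_sq hp, norm_add_sq_real]
  · ring
  exacts [hi _, hi _, (hi _).sub (hi _), hi _]

theorem inner_zerothOrderGrad (F : Vec p → X → ℝ) (μ : ℝ) (ζ : UnitSphere p) (ξ : X)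
    (x w : Vec p) : ⟪zerothOrderGrad F μ ζ ξ x, w⟫
      = (p : ℝ) * (F (x + μ • (ζ : Vec p)) ξ - F x ξ) / μ * ⟪w, (ζ : Vec p)⟫ := by
  rw [zerothOrderGrad, real_inner_smul_left, real_inner_comm]

variable {F : Vec p → X → ℝ} {ξ : X} {ℓ μ : ℝ}

theorem continuous_zerothOrderGrad (hF : IsSmooth (fun z => F z ξ) ℓ) (x : Vec p) :
    Continuous fun ζ : UnitSphere p => zerothOrderGrad F μ ζ ξ x := by
  have := hF.differentiable.continuous
  unfold zerothOrderGrad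
  have h2 : Continuous fun ζ : UnitSphere p => F (x + μ • (ζ : Vec p)) ξ :=
    this.comp (f := fun ζ : UnitSphere p => x + μ • (ζ : Vec p)) (by fun_prop)
  fun_prop

/-- The reflection in `w` changes the sign of `⟪w, ·⟫`, so that only the variation of the Taylor
remainder between mirror images contributes to the bias. This is what keeps the bias free of
the dimension. -/
theorem abs_integral_inner_zerothOrderGrad_sub_le (hp : 1 ≤ p) (hF : IsSmooth (fun z => F z ξ) ℓ)
    (hℓ : 0 ≤ ℓ) (hμ : 0 < μ) (x : Vec p) {w : Vec p} (hw : ‖w‖ = 1) :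
    |∫ ζ, ⟪zerothOrderGrad F μ ζ ξ x, w⟫ ∂(uniformSphere p) - ⟪∇ (fun z => F z ξ) x, w⟫|
      ≤ ℓ * μ := by
  have hpr := isProbabilityMeasure_uniformSphere hp
  set h : Vec p → ℝ := fun z => F z ξ with hh
  have hc : Continuous h := hF.differentiable.continuous
  have hp0 : (0 : ℝ) < p := by positivity
  let R : UnitSphere p → ℝ := fun ζ => h (x + μ • (ζ : Vec p)) - h x - μ * ⟪∇ h x, (ζ : Vec p)⟫
  have hRc : Continuous R := by
    have h2 : Continuous fun ζ : UnitSphere p => h (x + μ • (ζ : Vec p)) :=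
      hc.comp (f := fun ζ : UnitSphere p => x + μ • (ζ : Vec p)) (by fun_prop)
    fun_prop
  let e := Submodule.reflection (ℝ ∙ w)ᗮ
  have he : ∀ ζ : UnitSphere p, (sphereMap e ζ : Vec p) = ζ - (2 * ⟪w, (ζ : Vec p)⟫) • w := by
    intro ζ
    change Submodule.reflection (ℝ ∙ w)ᗮ (ζ : Vec p) = _
    rw [Submodule.reflection_orthogonal_apply, Submodule.reflection_singleton_apply, hw]
    simp [mul_smul, two_smul]
  have hew : ∀ ζ : UnitSphere p, ⟪w, (sphereMap e ζ : Vec p)⟫ = - ⟪w, (ζ : Vec p)⟫ := by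
    intro ζ
    rw [he, inner_sub_right, real_inner_smul_right, real_inner_self_eq_norm_sq, hw]; ring
  have hRd : ∀ ζ, |(R ζ - R (sphereMap e ζ)) * ⟪w, (ζ : Vec p)⟫|
      ≤ 2 * ℓ * μ ^ 2 * ⟪w, (ζ : Vec p)⟫ ^ 2 := by
    intro ζ
    have h1 := hF.abs_remainder_sub_le hℓ x (a := μ • (ζ : Vec p))
      (b := μ • (sphereMap e ζ : Vec p)) (R := μ) (by simp [norm_smul, abs_of_pos hμ])
      (by simp [norm_smul, abs_of_pos hμ])
    have h2 : R ζ - R (sphereMap e ζ) = h (x + μ • (ζ : Vec p))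
        - h (x + μ • (sphereMap e ζ : Vec p))
        - ⟪∇ h x, μ • (ζ : Vec p) - μ • (sphereMap e ζ : Vec p)⟫ := by
      simp only [R, inner_sub_right, real_inner_smul_right]; ring
    have h3 : ‖μ • (ζ : Vec p) - μ • (sphereMap e ζ : Vec p)‖ = 2 * μ * |⟪w, (ζ : Vec p)⟫| := by
      rw [← smul_sub, he, sub_sub_cancel, norm_smul, norm_smul, hw, Real.norm_eq_abs,
        Real.norm_eq_abs, abs_mul, abs_of_pos hμ, abs_of_pos (two_pos)]; ring
    rw [h3, ← h2] at h1
    rw [abs_mul]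
    calc |R ζ - R (sphereMap e ζ)| * |⟪w, (ζ : Vec p)⟫|
        ≤ ℓ * μ * (2 * μ * |⟪w, (ζ : Vec p)⟫|) * |⟪w, (ζ : Vec p)⟫| := by gcongr
      _ = 2 * ℓ * μ ^ 2 * |⟪w, (ζ : Vec p)⟫| ^ 2 := by ring
      _ = _ := by rw [sq_abs]
  have hI1 : Integrable (fun ζ : UnitSphere p => R ζ * ⟪w, (ζ : Vec p)⟫) (uniformSphere p) :=
    integrable_sphere_of_continuous hp (by fun_prop)
  have hI2 : Integrable (fun ζ : UnitSphere p => R (sphereMap e ζ) * ⟪w, (ζ : Vec p)⟫)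
      (uniformSphere p) := by
    refine integrable_sphere_of_continuous hp ?_
    exact (hRc.comp (continuous_sphereMap e)).mul (by fun_prop)
  have hsym : ∫ ζ, R ζ * ⟪w, (ζ : Vec p)⟫ ∂(uniformSphere p)
      = (1 / 2) * ∫ ζ, (R ζ - R (sphereMap e ζ)) * ⟪w, (ζ : Vec p)⟫ ∂(uniformSphere p) := by
    have h1 := integral_sphereMap e (fun ζ => R ζ * ⟪w, (ζ : Vec p)⟫)
    simp_rw [hew, mul_neg] at h1
    rw [integral_neg] at h1
    simp_rw [sub_mul]
    rw [integral_sub hI1 hI2]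
    linarith
  have hRbound : |∫ ζ, R ζ * ⟪w, (ζ : Vec p)⟫ ∂(uniformSphere p)| ≤ ℓ * μ ^ 2 / p := by
    rw [hsym, abs_mul, abs_of_pos (by norm_num : (0 : ℝ) < 1 / 2)]
    have h1 : |∫ ζ, (R ζ - R (sphereMap e ζ)) * ⟪w, (ζ : Vec p)⟫ ∂(uniformSphere p)|
        ≤ ∫ ζ, 2 * ℓ * μ ^ 2 * ⟪w, (ζ : Vec p)⟫ ^ 2 ∂(uniformSphere p) := by
      have := norm_integral_le_of_norm_le (μ := uniformSphere p)
        (f := fun ζ => (R ζ - R (sphereMap e ζ)) * ⟪w, (ζ : Vec p)⟫)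
        (g := fun ζ => 2 * ℓ * μ ^ 2 * ⟪w, (ζ : Vec p)⟫ ^ 2)
        (integrable_sphere_of_continuous hp (by fun_prop))
        (Filter.Eventually.of_forall hRd)
      simpa using this
    rw [integral_const_mul, integral_inner_sq hp, hw] at h1
    calc _ ≤ 1 / 2 * (2 * ℓ * μ ^ 2 * (1 ^ 2 / p)) := by gcongr
      _ = _ := by ring
  have hI3 : Integrable (fun ζ : UnitSphere p => ⟪∇ h x, (ζ : Vec p)⟫ * ⟪w, (ζ : Vec p)⟫)
      (uniformSphere p) := integrable_sphere_of_continuous hp (by fun_prop)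
  have hmain : ∫ ζ, ⟪zerothOrderGrad F μ ζ ξ x, w⟫ ∂(uniformSphere p)
      = (p : ℝ) / μ * (∫ ζ, R ζ * ⟪w, (ζ : Vec p)⟫ ∂(uniformSphere p)) + ⟪∇ h x, w⟫ := by
    have : ∀ ζ, ⟪zerothOrderGrad F μ ζ ξ x, w⟫ = (p : ℝ) / μ * (R ζ * ⟪w, (ζ : Vec p)⟫)
        + p * (⟪∇ h x, (ζ : Vec p)⟫ * ⟪w, (ζ : Vec p)⟫) := by
      intro ζ
      rw [inner_zerothOrderGrad]
      simp only [R, hh]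
      field_simp
      ring
    simp_rw [this]
    rw [integral_add (hI1.const_mul _) (hI3.const_mul _), integral_const_mul, integral_const_mul,
      integral_inner_mul_inner hp]
    field_simp
  rw [hmain, add_sub_cancel_right, abs_mul, abs_of_pos (by positivity)]
  calc _ ≤ (p : ℝ) / μ * (ℓ * μ ^ 2 / p) := by gcongr
    _ = ℓ * μ := by field_simp

theorem norm_zerothOrderGrad_sq_le (hF : IsSmooth (fun z => F z ξ) ℓ)
    (hℓ : 0 ≤ ℓ) (hμ : 0 < μ) (x : Vec p) (ζ : UnitSphere p) :
    ‖zerothOrderGrad F μ ζ ξ x‖ ^ 2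
      ≤ 2 * p ^ 2 * ⟪∇ (fun z => F z ξ) x, (ζ : Vec p)⟫ ^ 2 + 2 * p ^ 2 * ℓ ^ 2 * μ ^ 2 := by
  have h1 := hF.abs_remainder_le hℓ x (μ • (ζ : Vec p))
  have h2 : ‖μ • (ζ : Vec p)‖ = μ := by simp [norm_smul, abs_of_pos hμ]
  rw [h2, real_inner_smul_right] at h1
  set d := F (x + μ • (ζ : Vec p)) ξ - F x ξ
  set t := ⟪∇ (fun z => F z ξ) x, (ζ : Vec p)⟫
  have h3 : (d / μ) ^ 2 ≤ 2 * t ^ 2 + 2 * ℓ ^ 2 * μ ^ 2 := by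
    have h4 : |d / μ - t| ≤ ℓ * μ := by
      have : d / μ - t = (d - μ * t) / μ := by field_simp
      rw [this, abs_div, abs_of_pos hμ, div_le_iff₀ hμ]
      calc _ ≤ _ := h1
        _ = _ := by ring
    have h5 : (d / μ - t) ^ 2 ≤ (ℓ * μ) ^ 2 := by
      rw [← sq_abs]; gcongr
    nlinarith [sq_nonneg (d / μ - 2 * t)]
  have h6 : ‖zerothOrderGrad F μ ζ ξ x‖ ^ 2 = p ^ 2 * (d / μ) ^ 2 := by
    rw [zerothOrderGrad, norm_smul, mul_pow, Real.norm_eq_abs, sq_abs]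
    simp only [norm_eq_of_mem_sphere, one_pow, mul_one]
    ring
  rw [h6]
  calc _ ≤ (p : ℝ) ^ 2 * (2 * t ^ 2 + 2 * ℓ ^ 2 * μ ^ 2) := by gcongr
    _ = _ := by ring

theorem integral_norm_zerothOrderGrad_sq_le (hp : 1 ≤ p) (hF : IsSmooth (fun z => F z ξ) ℓ)
    (hℓ : 0 ≤ ℓ) (hμ : 0 < μ) (x : Vec p) :
    ∫ ζ, ‖zerothOrderGrad F μ ζ ξ x‖ ^ 2 ∂(uniformSphere p)
      ≤ 2 * p * ‖∇ (fun z => F z ξ) x‖ ^ 2 + 2 * p ^ 2 * ℓ ^ 2 * μ ^ 2 := by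
  have hpr := isProbabilityMeasure_uniformSphere hp
  have hg := continuous_zerothOrderGrad (μ := μ) hF x
  have hp0 : (0 : ℝ) < p := by positivity
  have hi : Integrable (fun ζ : UnitSphere p => ⟪∇ (fun z => F z ξ) x, (ζ : Vec p)⟫ ^ 2)
      (uniformSphere p) := integrable_sphere_of_continuous hp (by fun_prop)
  refine (integral_mono (integrable_sphere_of_continuous hp (by fun_prop))
    ((hi.const_mul (2 * (p : ℝ) ^ 2)).add (integrable_const (2 * (p : ℝ) ^ 2 * ℓ ^ 2 * μ ^ 2)))
    (fun ζ => norm_zerothOrderGrad_sq_le hF hℓ hμ x ζ)).trans ?_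
  simp only [Pi.add_apply]
  rw [integral_add (hi.const_mul _) (integrable_const _), integral_const_mul,
    integral_inner_sq hp, integral_const]
  simp only [probReal_univ, smul_eq_mul, one_mul]
  apply le_of_eq
  field_simp

end Estimator

/-! ### Local costs and their stochastic gradients -/

theorem integrable_prod_of_nonneg_of_le {X : Type*} {Y : Type*} [MeasurableSpace X]
    [MeasurableSpace Y] {μ : Measure X} {ν : Measure Y} [SFinite μ] [SFinite ν]
    {φ : X × Y → ℝ} {ψ : X → ℝ} (hφ : AEStronglyMeasurable φ (μ.prod ν)) (h0 : ∀ z, 0 ≤ φ z)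
    (hψ : Integrable ψ μ)
    (h : ∀ᵐ x ∂μ, Integrable (fun y => φ (x, y)) ν ∧ ∫ y, φ (x, y) ∂ν ≤ ψ x) :
    Integrable φ (μ.prod ν) ∧ ∫ z, φ z ∂(μ.prod ν) ≤ ∫ x, ψ x ∂μ := by
  have hi : Integrable φ (μ.prod ν) := by
    rw [integrable_prod_iff hφ]
    refine ⟨h.mono fun x hx => hx.1, ?_⟩
    refine hψ.mono' hφ.norm.integral_prod_right' (h.mono fun x hx => ?_)
    have : ∀ y, ‖φ (x, y)‖ = φ (x, y) := fun y => Real.norm_of_nonneg (h0 _)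
    simp_rw [this]
    rw [Real.norm_of_nonneg (integral_nonneg fun y => h0 _)]
    exact hx.2
  refine ⟨hi, ?_⟩
  rw [integral_prod _ hi]
  exact integral_mono_ae hi.integral_prod_left hψ (h.mono fun x hx => hx.2)

section Agent

variable {p : ℕ} {X : Type u} [MeasurableSpace X]

/-- The assumptions on the cost `F` and the data distribution `D` of a single agent. -/
structure IsAgentCost (F : Vec p → X → ℝ) (D : Measure X) (ℓ η₁ σ₁ : ℝ) : Prop where
  measurable : Measurable (Function.uncurry F)
  integrable : ∀ x, Integrable (F x) D
  smooth : ∀ᵐ ξ ∂D, IsSmooth (fun z => F z ξ) ℓ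
  integrable_variance : ∀ x, Integrable
    (fun ξ => ‖∇ (fun z => F z ξ) x - ∇ (fun y => ∫ ξ, F y ξ ∂D) x‖ ^ 2) D
  variance_le : ∀ x,
    ∫ ξ, ‖∇ (fun z => F z ξ) x - ∇ (fun y => ∫ ξ, F y ξ ∂D) x‖ ^ 2 ∂D
      ≤ η₁ ^ 2 * ‖∇ (fun y => ∫ ξ, F y ξ ∂D) x‖ ^ 2 + σ₁ ^ 2

variable {F : Vec p → X → ℝ} {D : Measure X} [IsProbabilityMeasure D] {ℓ η₁ σ₁ : ℝ}

namespace IsAgentCost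

variable (hF : IsAgentCost F D ℓ η₁ σ₁)
include hF

omit [IsProbabilityMeasure D] in
theorem aestronglyMeasurable_gradient (x : Vec p) :
    AEStronglyMeasurable (fun ξ => ∇ (fun z => F z ξ) x) D := by
  refine AEMeasurable.aestronglyMeasurable ?_
  -- each directional derivative is an a.e. limit of measurable difference quotients
  have hdir : ∀ u : Vec p, AEMeasurable (fun ξ => ⟪∇ (fun z => F z ξ) x, u⟫) D := by
    intro u
    refine aemeasurable_of_tendsto_metrizable_ae Filter.atTop
      (f := fun (k : ℕ) ξ => (k : ℝ) • (F (x + (k : ℝ)⁻¹ • u) ξ - F x ξ))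
      (fun k => ?_) (hF.smooth.mono fun ξ hξ => ?_)
    · have h1 := ((hF.integrable (x + (k : ℝ)⁻¹ • u)).sub (hF.integrable x)).1.aemeasurable
      exact h1.const_smul (k : ℝ)
    · have h1 := ((hξ.differentiable x).hasFDerivAt.lim_real u).comp tendsto_natCast_atTop_atTop
      simpa [inner_gradient_left, Function.comp_def] using h1
  have := (MeasurableEquiv.toLp 2 (Fin p → ℝ)).measurable.comp_aemeasurable
    (aemeasurable_pi_lambda _ fun i => hdir (EuclideanSpace.single i 1))
  convert this using 1
  ext ξ i
  rw [Function.comp_apply, MeasurableEquiv.toLp_apply]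
  simp only [EuclideanSpace.inner_single_right]
  simp

theorem integrable_norm_gradient_sq_and_integral_le (x : Vec p) :
    Integrable (fun ξ => ‖∇ (fun z => F z ξ) x‖ ^ 2) D ∧
    ∫ ξ, ‖∇ (fun z => F z ξ) x‖ ^ 2 ∂D
      ≤ 2 * (1 + η₁ ^ 2) * ‖∇ (fun y => ∫ ξ, F y ξ ∂D) x‖ ^ 2 + 2 * σ₁ ^ 2 := by
  set G := ∇ (fun y => ∫ ξ, F y ξ ∂D) x with hG
  have hm := hF.aestronglyMeasurable_gradient x
  have hle : ∀ ξ, ‖∇ (fun z => F z ξ) x‖ ^ 2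
      ≤ 2 * ‖∇ (fun z => F z ξ) x - G‖ ^ 2 + 2 * ‖G‖ ^ 2 := by
    intro ξ
    have := norm_add_le (∇ (fun z => F z ξ) x - G) G
    rw [sub_add_cancel] at this
    nlinarith [sq_nonneg (‖∇ (fun z => F z ξ) x - G‖ - ‖G‖), norm_nonneg (∇ (fun z => F z ξ) x),
      norm_nonneg G, norm_nonneg (∇ (fun z => F z ξ) x - G)]
  have hv := hF.integrable_variance x
  have hb : Integrable (fun ξ => 2 * ‖∇ (fun z => F z ξ) x - G‖ ^ 2 + 2 * ‖G‖ ^ 2) D :=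
    (hv.const_mul 2).add (integrable_const _)
  have hi : Integrable (fun ξ => ‖∇ (fun z => F z ξ) x‖ ^ 2) D := by
    refine hb.mono' (hm.norm.pow 2) (Filter.Eventually.of_forall fun ξ => ?_)
    rw [Real.norm_of_nonneg (by positivity)]
    exact hle ξ
  refine ⟨hi, (integral_mono hi hb hle).trans ?_⟩
  rw [integral_add (hv.const_mul 2) (integrable_const _), integral_const_mul, integral_const]
  simp only [probReal_univ, smul_eq_mul, one_mul]
  have := hF.variance_le x
  linarith

theorem integrable_gradient (x : Vec p) : Integrable (fun ξ => ∇ (fun z => F z ξ) x) D := by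
  have h2 : MemLp (fun ξ => ∇ (fun z => F z ξ) x) 2 D :=
    (memLp_two_iff_integrable_sq_norm (hF.aestronglyMeasurable_gradient x)).2
      (hF.integrable_norm_gradient_sq_and_integral_le x).1
  exact h2.integrable (by norm_num)

theorem hasGradientAt (hℓ : 0 ≤ ℓ) (x : Vec p) :
    HasGradientAt (fun y => ∫ ξ, F y ξ ∂D) (∫ ξ, ∇ (fun z => F z ξ) x ∂D) x := by
  refine hasGradientAt_of_abs_remainder_le (c := ℓ) fun a => ?_
  have hi := hF.integrable_gradient x
  have hin : Integrable (fun ξ => ⟪∇ (fun z => F z ξ) x, a⟫) D := hi.inner_const a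
  have : (∫ ξ, F (x + a) ξ ∂D) - (∫ ξ, F x ξ ∂D) - ⟪∫ ξ, ∇ (fun z => F z ξ) x ∂D, a⟫
      = ∫ ξ, (F (x + a) ξ - F x ξ - ⟪∇ (fun z => F z ξ) x, a⟫) ∂D := by
    rw [integral_sub, integral_sub (hF.integrable _) (hF.integrable _), real_inner_comm,
      ← integral_inner hi]
    · simp_rw [real_inner_comm a]
    exacts [(hF.integrable _).sub (hF.integrable _), hin]
  rw [this, ← Real.norm_eq_abs]
  refine (norm_integral_le_of_norm_le (integrable_const (ℓ * ‖a‖ ^ 2))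
    (hF.smooth.mono fun ξ hξ => hξ.abs_remainder_le hℓ x a)).trans ?_
  simp

theorem gradient_eq_integral (hℓ : 0 ≤ ℓ) (x : Vec p) :
    ∇ (fun y => ∫ ξ, F y ξ ∂D) x = ∫ ξ, ∇ (fun z => F z ξ) x ∂D :=
  (hF.hasGradientAt hℓ x).gradient

theorem isSmooth (hℓ : 0 ≤ ℓ) : IsSmooth (fun y => ∫ ξ, F y ξ ∂D) ℓ := by
  refine ⟨fun x => (hF.hasGradientAt hℓ x).differentiableAt, fun x y => ?_⟩
  rw [hF.gradient_eq_integral hℓ, hF.gradient_eq_integral hℓ,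
    ← integral_sub (hF.integrable_gradient x) (hF.integrable_gradient y)]
  refine (norm_integral_le_of_norm_le (integrable_const (ℓ * ‖x - y‖))
    (hF.smooth.mono fun ξ hξ => hξ.lipschitz x y)).trans ?_
  simp

omit [IsProbabilityMeasure D] in
theorem measurable_zerothOrderGrad (μ : ℝ) :
    Measurable fun t : Vec p × X × UnitSphere p => zerothOrderGrad F μ t.2.2 t.2.1 t.1 := by
  have hm : Measurable fun z : Vec p × X => F z.1 z.2 := hF.measurable
  have h1 : Measurable fun t : Vec p × X × UnitSphere p => F t.1 t.2.1 :=
    hm.comp (measurable_fst.prodMk measurable_snd.fst)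
  have h2 : Measurable fun t : Vec p × X × UnitSphere p =>
      F (t.1 + μ • (t.2.2 : Vec p)) t.2.1 :=
    hm.comp (Measurable.prodMk (by fun_prop) measurable_snd.fst)
  unfold zerothOrderGrad
  exact (((h2.sub h1).const_mul _).div_const _).smul (by fun_prop)

omit [IsProbabilityMeasure D] in
theorem measurable_zerothOrderGrad_right (μ : ℝ) (x : Vec p) :
    Measurable fun t : X × UnitSphere p => zerothOrderGrad F μ t.2 t.1 x :=
  Measurable.comp (g := fun t : Vec p × X × UnitSphere p => zerothOrderGrad F μ t.2.2 t.2.1 t.1)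
    (f := fun t => (x, t)) (hF.measurable_zerothOrderGrad μ) measurable_prodMk_left

theorem integrable_zerothOrderGrad_sq_and_integral_le (hp : 1 ≤ p) (hℓ : 0 ≤ ℓ) {μ : ℝ}
    (hμ : 0 < μ) (x : Vec p) :
    Integrable (fun t : X × UnitSphere p => ‖zerothOrderGrad F μ t.2 t.1 x‖ ^ 2)
      (D.prod (uniformSphere p)) ∧
    ∫ t, ‖zerothOrderGrad F μ t.2 t.1 x‖ ^ 2 ∂(D.prod (uniformSphere p))
      ≤ 4 * p * (1 + η₁ ^ 2) * ‖∇ (fun y => ∫ ξ, F y ξ ∂D) x‖ ^ 2 + 4 * p * σ₁ ^ 2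
        + 2 * p ^ 2 * ℓ ^ 2 * μ ^ 2 := by
  have hpr := isProbabilityMeasure_uniformSphere hp
  have hm := hF.measurable_zerothOrderGrad_right μ x
  obtain ⟨hi, hle⟩ := hF.integrable_norm_gradient_sq_and_integral_le x
  have := integrable_prod_of_nonneg_of_le (μ := D) (ν := uniformSphere p)
    (φ := fun t : X × UnitSphere p => ‖zerothOrderGrad F μ t.2 t.1 x‖ ^ 2)
    (ψ := fun ξ => 2 * p * ‖∇ (fun z => F z ξ) x‖ ^ 2 + 2 * p ^ 2 * ℓ ^ 2 * μ ^ 2)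
    (hm.norm.pow_const 2).aestronglyMeasurable (fun _ => by positivity)
    ((hi.const_mul _).add (integrable_const _))
    (hF.smooth.mono fun ξ hξ => ⟨integrable_sphere_of_continuous hp
      ((continuous_zerothOrderGrad hξ x).norm.pow 2),
      integral_norm_zerothOrderGrad_sq_le hp hξ hℓ hμ x⟩)
  refine ⟨this.1, this.2.trans ?_⟩
  rw [integral_add (hi.const_mul _) (integrable_const _), integral_const_mul, integral_const]
  simp only [probReal_univ, smul_eq_mul, one_mul]
  have h2 : 2 * (p : ℝ) * ∫ ξ, ‖∇ (fun z => F z ξ) x‖ ^ 2 ∂D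
      ≤ 2 * p * (2 * (1 + η₁ ^ 2) * ‖∇ (fun y => ∫ ξ, F y ξ ∂D) x‖ ^ 2 + 2 * σ₁ ^ 2) := by
    gcongr
  linarith

theorem integrable_zerothOrderGrad (hp : 1 ≤ p) (hℓ : 0 ≤ ℓ) {μ : ℝ} (hμ : 0 < μ) (x : Vec p) :
    Integrable (fun t : X × UnitSphere p => zerothOrderGrad F μ t.2 t.1 x)
      (D.prod (uniformSphere p)) := by
  have hpr := isProbabilityMeasure_uniformSphere hp
  have hm := hF.measurable_zerothOrderGrad_right μ x
  have h2 : MemLp (fun t : X × UnitSphere p => zerothOrderGrad F μ t.2 t.1 x) 2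
      (D.prod (uniformSphere p)) :=
    (memLp_two_iff_integrable_sq_norm hm.aestronglyMeasurable).2
      (hF.integrable_zerothOrderGrad_sq_and_integral_le hp hℓ hμ x).1
  exact h2.integrable (by norm_num)

theorem norm_integral_zerothOrderGrad_sub_le (hp : 1 ≤ p) (hℓ : 0 ≤ ℓ) {μ : ℝ} (hμ : 0 < μ)
    (x : Vec p) :
    ‖∫ t, zerothOrderGrad F μ t.2 t.1 x ∂(D.prod (uniformSphere p))
      - ∇ (fun y => ∫ ξ, F y ξ ∂D) x‖ ≤ ℓ * μ := by
  have hpr := isProbabilityMeasure_uniformSphere hp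
  set d := ∫ t, zerothOrderGrad F μ t.2 t.1 x ∂(D.prod (uniformSphere p))
      - ∇ (fun y => ∫ ξ, F y ξ ∂D) x with hd
  by_cases h0 : d = 0
  · rw [h0, norm_zero]; positivity
  have hn : 0 < ‖d‖ := norm_pos_iff.2 h0
  set w := ‖d‖⁻¹ • d with hw
  have hw1 : ‖w‖ = 1 := by rw [hw, norm_smul, norm_inv, norm_norm, inv_mul_cancel₀ hn.ne']
  have hdw : ⟪d, w⟫ = ‖d‖ := by
    rw [hw, real_inner_smul_right, real_inner_self_eq_norm_sq]; field_simp
  have hi := hF.integrable_zerothOrderGrad hp hℓ hμ x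
  have hi2 := hF.integrable_gradient x
  have e1 : ⟪∫ t, zerothOrderGrad F μ t.2 t.1 x ∂(D.prod (uniformSphere p)), w⟫
      = ∫ ξ, ∫ ζ, ⟪zerothOrderGrad F μ ζ ξ x, w⟫ ∂(uniformSphere p) ∂D := by
    rw [real_inner_comm, ← integral_inner hi, integral_prod _ (hi.const_inner w)]
    simp_rw [real_inner_comm w]
  have e2 : ⟪∇ (fun y => ∫ ξ, F y ξ ∂D) x, w⟫ = ∫ ξ, ⟪∇ (fun z => F z ξ) x, w⟫ ∂D := by
    rw [hF.gradient_eq_integral hℓ, real_inner_comm, ← integral_inner hi2]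
    simp_rw [real_inner_comm w]
  have hi3 : Integrable (fun ξ => ∫ ζ, ⟪zerothOrderGrad F μ ζ ξ x, w⟫ ∂(uniformSphere p)) D :=
    Integrable.integral_prod_left
      (f := fun t : X × UnitSphere p => ⟪zerothOrderGrad F μ t.2 t.1 x, w⟫) (hi.inner_const w)
  rw [← hdw, hd, inner_sub_left, e1, e2, ← integral_sub hi3 (hi2.inner_const w)]
  refine (le_abs_self _).trans ?_
  rw [← Real.norm_eq_abs]
  refine (norm_integral_le_of_norm_le (integrable_const (ℓ * μ)) (hF.smooth.mono fun ξ hξ =>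
    abs_integral_inner_zerothOrderGrad_sub_le hp hξ hℓ hμ x hw1)).trans ?_
  simp

end IsAgentCost

end Agent

/-! ### The Laplacian as an operator -/

section Laplacian

open Matrix

variable {n : ℕ} {A : Matrix (Fin n) (Fin n) ℝ} {ρ₂ ρ : ℝ}

theorem sum_laplacian_apply (A : Matrix (Fin n) (Fin n) ℝ) (i : Fin n) :
    ∑ j, laplacian A i j = 0 := by
  simp [laplacian, Matrix.sub_apply, Finset.sum_sub_distrib, Matrix.diagonal_apply]

theorem IsUndirectedConnected.isHermitian_laplacian (hA : IsUndirectedConnected A) :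
    (laplacian A).IsHermitian := by
  ext i j
  simp only [conjTranspose_apply, star_trivial, laplacian, Matrix.sub_apply, hA.symm j i]
  by_cases h : i = j
  · subst h; rfl
  · rw [diagonal_apply_ne _ h, diagonal_apply_ne _ (Ne.symm h)]

theorem laplacian_mulVec (A : Matrix (Fin n) (Fin n) ℝ) (u : Fin n → ℝ) (i : Fin n) :
    (laplacian A *ᵥ u) i = ∑ j, A i j * (u i - u j) := by
  rw [laplacian, sub_mulVec, Pi.sub_apply, mulVec_diagonal, mulVec, dotProduct, Finset.sum_mul]
  simp [mul_sub, Finset.sum_sub_distrib]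

theorem IsUndirectedConnected.two_mul_dotProduct_laplacian (hA : IsUndirectedConnected A)
    (u : Fin n → ℝ) :
    2 * (u ⬝ᵥ (laplacian A *ᵥ u)) = ∑ i, ∑ j, A i j * (u i - u j) ^ 2 := by
  have h1 : u ⬝ᵥ (laplacian A *ᵥ u) = ∑ i, ∑ j, A i j * (u i - u j) * u i := by
    simp only [dotProduct, laplacian_mulVec, Finset.mul_sum]
    exact Finset.sum_congr rfl fun i _ => Finset.sum_congr rfl fun j _ => by ring
  have h2 : u ⬝ᵥ (laplacian A *ᵥ u) = ∑ i, ∑ j, A i j * (u j - u i) * u j := by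
    rw [h1, Finset.sum_comm]
    exact Finset.sum_congr rfl fun i _ => Finset.sum_congr rfl fun j _ => by rw [hA.symm j i]
  rw [two_mul]
  nth_rw 1 [h1]
  rw [h2, ← Finset.sum_add_distrib]
  refine Finset.sum_congr rfl fun i _ => ?_
  rw [← Finset.sum_add_distrib]
  exact Finset.sum_congr rfl fun j _ => by ring

/-- On a connected graph the kernel of the Laplacian consists of the constant vectors. -/
theorem IsUndirectedConnected.eq_of_laplacian_mulVec_eq_zero (hA : IsUndirectedConnected A)
    {u : Fin n → ℝ} (hu : laplacian A *ᵥ u = 0) (i j : Fin n) : u i = u j := by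
  have h0 := hA.two_mul_dotProduct_laplacian u
  rw [hu, dotProduct_zero, mul_zero] at h0
  have hnn : ∀ i j, 0 ≤ A i j * (u i - u j) ^ 2 := fun i j =>
    mul_nonneg (hA.nonneg i j) (sq_nonneg _)
  have hz : ∀ i j, A i j * (u i - u j) ^ 2 = 0 := by
    intro i j
    have h1 := (Finset.sum_eq_zero_iff_of_nonneg
      fun i _ => Finset.sum_nonneg fun j _ => hnn i j).1 h0.symm i (Finset.mem_univ _)
    exact (Finset.sum_eq_zero_iff_of_nonneg fun j _ => hnn i j).1 h1 j (Finset.mem_univ _)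
  have hadj : ∀ a b, 0 < A a b → u a = u b := by
    intro a b hab
    have := hz a b
    rcases mul_eq_zero.1 this with h | h
    · exact absurd h hab.ne'
    · exact sub_eq_zero.1 (pow_eq_zero_iff (two_ne_zero) |>.1 h)
  obtain ⟨walk⟩ := hA.connected.preconnected i j
  induction walk with
  | nil => rfl
  | cons h _ ih =>
    refine Eq.trans ?_ ih
    rw [SimpleGraph.fromRel_adj] at h
    rcases h.2 with h | h
    · exact hadj _ _ h
    · exact (hadj _ _ h).symm

/-- The eigenbasis expansion of the three quadratic forms attached to the Laplacian. -/
theorem IsUndirectedConnected.exists_spectral_coordinates (hA : IsUndirectedConnected A)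
    (u : Fin n → ℝ) (hs : ∑ i, u i = 0) :
    ∃ lam c : Fin n → ℝ, (∀ i, lam i ∈ spectrum ℝ (laplacian A)) ∧
      (∀ i, lam i = 0 → c i = 0) ∧ ∑ i, u i ^ 2 = ∑ i, c i ^ 2 ∧
      u ⬝ᵥ (laplacian A *ᵥ u) = ∑ i, lam i * c i ^ 2 ∧
      ∑ i, (laplacian A *ᵥ u) i ^ 2 = ∑ i, lam i ^ 2 * c i ^ 2 := by
  have hH := hA.isHermitian_laplacian
  set b := hH.eigenvectorBasis with hb
  set U : EuclideanSpace ℝ (Fin n) := WithLp.toLp 2 u with hU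
  set LU : EuclideanSpace ℝ (Fin n) := WithLp.toLp 2 (laplacian A *ᵥ u) with hLU
  have hinner : ∀ x y : Fin n → ℝ,
      ⟪(WithLp.toLp 2 x : EuclideanSpace ℝ (Fin n)), WithLp.toLp 2 y⟫ = x ⬝ᵥ y := by
    intro x y
    simp [PiLp.inner_apply, dotProduct, mul_comm]
  have hbL : ∀ i, ⟪b i, LU⟫ = hH.eigenvalues i * ⟪b i, U⟫ := by
    intro i
    have h1 : ⟪b i, LU⟫ = (b i).ofLp ⬝ᵥ (laplacian A *ᵥ u) := hinner (b i).ofLp _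
    have h2 : ⟪b i, U⟫ = (b i).ofLp ⬝ᵥ u := hinner (b i).ofLp _
    have h3 : (laplacian A)ᵀ = laplacian A := by
      have := hH; rwa [IsHermitian, conjTranspose_eq_transpose_of_trivial] at this
    rw [h1, h2, dotProduct_mulVec, ← mulVec_transpose, h3, hH.mulVec_eigenvectorBasis,
      smul_dotProduct, smul_eq_mul]
  refine ⟨hH.eigenvalues, fun i => ⟪b i, U⟫, hH.eigenvalues_mem_spectrum_real, ?_, ?_, ?_, ?_⟩
  · intro i hi
    have h1 : laplacian A *ᵥ (b i).ofLp = 0 := by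
      rw [hH.mulVec_eigenvectorBasis, hi, zero_smul]
    have h2 : ⟪b i, U⟫ = (b i).ofLp ⬝ᵥ u := hinner (b i).ofLp _
    simp only
    rw [h2, dotProduct]
    have h3 : ∀ j, (b i).ofLp j * u j = (b i).ofLp i * u j := fun j => by
      rw [hA.eq_of_laplacian_mulVec_eq_zero h1 j i]
    rw [Finset.sum_congr rfl fun j _ => h3 j, ← Finset.mul_sum, hs, mul_zero]
  · have := b.sum_sq_norm_inner_right U
    rw [EuclideanSpace.norm_sq_eq] at this
    simpa [hU] using this.symm
  · have := b.sum_inner_mul_inner U LU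
    rw [hinner] at this
    rw [← this]
    refine Finset.sum_congr rfl fun i _ => ?_
    rw [hbL, real_inner_comm]; ring
  · have := b.sum_sq_norm_inner_right LU
    rw [EuclideanSpace.norm_sq_eq] at this
    simp only [hbL] at this
    simpa [hLU, mul_pow] using this.symm

/-- The stacked space `(ℝ^p)^n`, with its Euclidean norm. -/
abbrev Stack (n p : ℕ) : Type := PiLp 2 (fun _ : Fin n => Vec p)

variable {p : ℕ}

/-- The operator `L ⊗ I_p` on the stacked space. -/
noncomputable def stackOp (L : Matrix (Fin n) (Fin n) ℝ) : Stack n p →ₗ[ℝ] Stack n p where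
  toFun x := WithLp.toLp 2 fun i => ∑ j, L i j • x j
  map_add' x y := by
    ext i : 1
    simp [smul_add, Finset.sum_add_distrib]
  map_smul' c x := by
    ext i : 1
    simp [Finset.smul_sum, smul_comm c]

theorem stackOp_apply (L : Matrix (Fin n) (Fin n) ℝ) (x : Stack n p) (i : Fin n) :
    stackOp L x i = ∑ j, L i j • x j := rfl

theorem stackOp_apply_apply (L : Matrix (Fin n) (Fin n) ℝ) (x : Stack n p) (i : Fin n)
    (a : Fin p) : stackOp L x i a = (L *ᵥ fun j => x j a) i := by
  rw [stackOp_apply]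
  simp [mulVec, dotProduct]

theorem stack_norm_sq (x : Stack n p) : ‖x‖ ^ 2 = ∑ i, ‖x i‖ ^ 2 :=
  PiLp.norm_sq_eq_of_L2 _ x

theorem stack_norm_sq_eq_sum (x : Stack n p) : ‖x‖ ^ 2 = ∑ a, ∑ i, x i a ^ 2 := by
  rw [stack_norm_sq, Finset.sum_comm]
  simp [EuclideanSpace.norm_sq_eq]

theorem stack_inner_eq_sum (x y : Stack n p) :
    ⟪x, y⟫ = ∑ a, (fun i => x i a) ⬝ᵥ (fun i => y i a) := by
  rw [PiLp.inner_apply]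
  simp only [PiLp.inner_apply, dotProduct]
  rw [Finset.sum_comm]
  simp [mul_comm]

/-- The stacked vector all of whose blocks are the network average. -/
noncomputable def stackAvg (x : Stack n p) : Stack n p := WithLp.toLp 2 fun _ => average x

theorem sum_sub_average (x : Fin n → Vec p) : ∑ i, (x i - average x) = 0 := by
  rcases Nat.eq_zero_or_pos n with h | h
  · subst h; simp
  · have : (n : ℝ) ≠ 0 := by positivity
    rw [Finset.sum_sub_distrib, average, Finset.sum_const, Finset.card_univ, Fintype.card_fin,
      ← Nat.cast_smul_eq_nsmul ℝ, smul_smul, mul_one_div_cancel this, one_smul, sub_self]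

theorem stackOp_sub_stackAvg (A : Matrix (Fin n) (Fin n) ℝ) (x : Stack n p) :
    stackOp (laplacian A) (x - stackAvg x) = stackOp (laplacian A) x := by
  rw [map_sub, sub_eq_self]
  ext i : 1
  rw [stackOp_apply]
  change ∑ j, laplacian A i j • average x = 0
  rw [← Finset.sum_smul, sum_laplacian_apply, zero_smul]

namespace IsUndirectedConnected

variable (hA : IsUndirectedConnected A)
include hA

theorem inner_stackOp_left (x y : Stack n p) :
    ⟪stackOp (laplacian A) x, y⟫ = ⟪x, stackOp (laplacian A) y⟫ := by
  rw [stack_inner_eq_sum, stack_inner_eq_sum]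
  refine Finset.sum_congr rfl fun a _ => ?_
  simp only [stackOp_apply_apply]
  have h3 : (laplacian A)ᵀ = laplacian A := by
    have := hA.isHermitian_laplacian
    rwa [IsHermitian, conjTranspose_eq_transpose_of_trivial] at this
  change (laplacian A *ᵥ _) ⬝ᵥ _ = _ ⬝ᵥ (laplacian A *ᵥ _)
  rw [dotProduct_mulVec, ← mulVec_transpose, h3]

theorem sum_stackOp (x : Stack n p) : ∑ i, stackOp (laplacian A) x i = 0 := by
  have h : ∀ j, ∑ i, laplacian A i j = 0 := fun j => by
    rw [← sum_laplacian_apply A j]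
    refine Finset.sum_congr rfl fun i _ => ?_
    have := congrFun (congrFun hA.isHermitian_laplacian j) i
    simpa [conjTranspose_apply] using this
  simp only [stackOp_apply]
  rw [Finset.sum_comm]
  simp [← Finset.sum_smul, h]

variable (hs : SpectrumWithin (laplacian A) ρ₂ ρ) (hρ₂ : 0 < ρ₂)
include hs hρ₂

theorem quadratic_form_bounds (x : Stack n p) :
    ρ₂ * ‖x - stackAvg x‖ ^ 2 ≤ ⟪x, stackOp (laplacian A) x⟫ ∧
    ρ₂ * ⟪x, stackOp (laplacian A) x⟫ ≤ ‖stackOp (laplacian A) x‖ ^ 2 ∧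
    ‖stackOp (laplacian A) x‖ ^ 2 ≤ ρ * ⟪x, stackOp (laplacian A) x⟫ := by
  have e : ⟪x, stackOp (laplacian A) x⟫
      = ⟪x - stackAvg x, stackOp (laplacian A) (x - stackAvg x)⟫ := by
    rw [stackOp_sub_stackAvg, ← hA.inner_stackOp_left, ← hA.inner_stackOp_left,
      stackOp_sub_stackAvg]
  rw [e, ← stackOp_sub_stackAvg A x]
  set y := x - stackAvg x with hy
  have hsum : ∀ a, ∑ i, y i a = 0 := by
    intro a
    have := congrArg (fun t : Vec p => t a) (sum_sub_average (fun i => x i))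
    simpa [hy, stackAvg] using this
  choose lam c hlam h0 h1 h2 h3 using fun a =>
    hA.exists_spectral_coordinates (fun i => y i a) (hsum a)
  have e1 : ‖y‖ ^ 2 = ∑ a, ∑ i, c a i ^ 2 := by
    rw [stack_norm_sq_eq_sum]; exact Finset.sum_congr rfl fun a _ => h1 a
  have e2 : ⟪y, stackOp (laplacian A) y⟫ = ∑ a, ∑ i, lam a i * c a i ^ 2 := by
    rw [stack_inner_eq_sum]; simp only [stackOp_apply_apply]
    exact Finset.sum_congr rfl fun a _ => h2 a
  have e3 : ‖stackOp (laplacian A) y‖ ^ 2 = ∑ a, ∑ i, lam a i ^ 2 * c a i ^ 2 := by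
    rw [stack_norm_sq_eq_sum]; simp only [stackOp_apply_apply]
    exact Finset.sum_congr rfl fun a _ => h3 a
  have hb : ∀ a i, c a i = 0 ∨ (ρ₂ ≤ lam a i ∧ lam a i ≤ ρ) := by
    intro a i
    by_cases h : lam a i = 0
    · exact Or.inl (h0 a i h)
    · exact Or.inr (hs _ (hlam a i) h)
  rw [e1, e2, e3]
  simp only [Finset.mul_sum]
  refine ⟨?_, ?_, ?_⟩ <;>
  · refine Finset.sum_le_sum fun a _ => Finset.sum_le_sum fun i _ => ?_
    rcases hb a i with h | ⟨h, h'⟩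
    · simp [h]
    · have hl : 0 ≤ lam a i := hρ₂.le.trans h
      first
        | exact mul_le_mul_of_nonneg_right h (sq_nonneg _)
        | rw [← mul_assoc, pow_two (lam a i)]; gcongr

end IsUndirectedConnected

end Laplacian

/-! ### A Lyapunov function for the primal-dual consensus dynamics -/

section Lyapunov

variable {E : Type} [NormedAddCommGroup E] [InnerProductSpace ℝ E]

theorem two_mul_inner_le (u w : E) {κ : ℝ} (hκ : 0 < κ) :
    2 * ⟪u, w⟫ ≤ κ * ‖u‖ ^ 2 + κ⁻¹ * ‖w‖ ^ 2 := by
  have h1 := real_inner_le_norm u w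
  have h2 : 2 * (‖u‖ * ‖w‖) ≤ κ * ‖u‖ ^ 2 + κ⁻¹ * ‖w‖ ^ 2 := by
    have h3 := mul_nonneg hκ.le (sq_nonneg (‖u‖ - κ⁻¹ * ‖w‖))
    have h4 : κ * (‖u‖ - κ⁻¹ * ‖w‖) ^ 2
        = κ * ‖u‖ ^ 2 - 2 * (‖u‖ * ‖w‖) + κ⁻¹ * ‖w‖ ^ 2 := by
      field_simp; ring
    linarith
  linarith

theorem neg_two_mul_inner_le (u w : E) {κ : ℝ} (hκ : 0 < κ) :
    -(2 * ⟪u, w⟫) ≤ κ * ‖u‖ ^ 2 + κ⁻¹ * ‖w‖ ^ 2 := by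
  have := two_mul_inner_le (-u) w hκ
  rwa [inner_neg_left, norm_neg, mul_neg] at this

theorem norm_add_sq_le_weighted (u w : E) {κ : ℝ} (hκ : 0 < κ) :
    ‖u + w‖ ^ 2 ≤ (1 + κ) * ‖u‖ ^ 2 + (1 + κ⁻¹) * ‖w‖ ^ 2 := by
  rw [norm_add_sq_real]
  have := two_mul_inner_le u w hκ
  linarith

theorem norm_add_sq_le_two (u w : E) : ‖u + w‖ ^ 2 ≤ 2 * ‖u‖ ^ 2 + 2 * ‖w‖ ^ 2 := by
  have := norm_add_sq_le_weighted u w one_pos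
  norm_num at this
  linarith

/-- `L` is a symmetric operator whose nonzero spectrum lies in `[ρ₂, ρ]`, expressed through
quadratic forms. -/
structure IsGapOperator (L : E →ₗ[ℝ] E) (ρ₂ ρ : ℝ) : Prop where
  symm : ∀ x y, ⟪L x, y⟫ = ⟪x, L y⟫
  lower : ∀ x, ρ₂ * ⟪x, L x⟫ ≤ ‖L x‖ ^ 2
  upper : ∀ x, ‖L x‖ ^ 2 ≤ ρ * ⟪x, L x⟫

/-- The Lyapunov function of the primal-dual dynamics, for the Laplacian `L`: the energy
`⟪x, L x⟫ + ‖v‖²`, which the continuous-time dynamics only dissipates along `L x`, plus a small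
cross term that makes the dissipation strict in `v` as well. -/
noncomputable def energy (L : E →ₗ[ℝ] E) (θ : ℝ) (x v : E) : ℝ :=
  ⟪x, L x⟫ + ‖v‖ ^ 2 + 2 * θ * ⟪x, v⟫

namespace IsGapOperator

variable {L : E →ₗ[ℝ] E} {ρ₂ ρ : ℝ} (hL : IsGapOperator L ρ₂ ρ)
include hL

theorem norm_apply_le (hρ : 0 < ρ) (x : E) : ‖L x‖ ≤ ρ * ‖x‖ := by
  have h1 := hL.upper x
  have h2 := real_inner_le_norm x (L x)
  by_contra! h
  have h3 : 0 < ‖L x‖ := lt_of_le_of_lt (by positivity) h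
  nlinarith [mul_le_mul_of_nonneg_left h2 hρ.le]

theorem norm_apply_sq_le (hρ : 0 < ρ) (x : E) : ‖L x‖ ^ 2 ≤ ρ ^ 2 * ‖x‖ ^ 2 := by
  rw [← mul_pow]
  have := hL.norm_apply_le hρ x
  gcongr

theorem inner_apply_le (hρ : 0 < ρ) (x : E) : ⟪x, L x⟫ ≤ ρ * ‖x‖ ^ 2 := by
  have h1 := hL.norm_apply_le hρ x
  have h2 := real_inner_le_norm x (L x)
  calc _ ≤ _ := h2
    _ ≤ ‖x‖ * (ρ * ‖x‖) := by gcongr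
    _ = _ := by ring

variable {a h θ : ℝ}

/-- The change of the energy in one step, before any estimate. -/
theorem energy_step (x v e d : E) :
    energy L θ (x + (-(h • (a • (L x + L e) + v)) + d)) (v + h • (L x + L e)) - energy L θ x v
      = h * (-(2 * a) * ‖L x‖ ^ 2 - 2 * θ * ‖v‖ ^ 2 + 2 * θ * ⟪x, L x⟫
          - a * (2 * ⟪L x, L e⟫) + 2 * ⟪v, L e⟫ + θ * (2 * ⟪L x, e⟫)
          - θ * a * (2 * ⟪v, L x⟫) - θ * a * (2 * ⟪v, L e⟫))
        + 2 * ⟪L x, d⟫ + θ * (2 * ⟪v, d⟫)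
        + ⟪-(h • (a • (L x + L e) + v)) + d, L (-(h • (a • (L x + L e) + v)) + d)⟫
        + ‖h • (L x + L e)‖ ^ 2
        + θ * (2 * ⟪-(h • (a • (L x + L e) + v)) + d, h • (L x + L e)⟫) := by
  set t := L x + L e with ht
  set Δ := -(h • (a • t + v)) + d with hΔ
  have h1 : energy L θ (x + Δ) (v + h • t) - energy L θ x v
      = 2 * ⟪L x, Δ⟫ + ⟪Δ, L Δ⟫ + 2 * h * ⟪v, t⟫ + ‖h • t‖ ^ 2
        + 2 * θ * (h * ⟪x, t⟫ + ⟪Δ, v⟫ + ⟪Δ, h • t⟫) := by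
    unfold energy
    rw [map_add, norm_add_sq_real]
    simp only [inner_add_left, inner_add_right, real_inner_smul_right]
    have e1 : ⟪x, L Δ⟫ = ⟪L x, Δ⟫ := (hL.symm x Δ).symm
    have e2 : ⟪Δ, L x⟫ = ⟪L x, Δ⟫ := real_inner_comm _ _
    rw [e1, e2]
    ring
  have h2 : ⟪L x, Δ⟫ = -(h * (a * ‖L x‖ ^ 2 + a * ⟪L x, L e⟫ + ⟪v, L x⟫)) + ⟪L x, d⟫ := by
    rw [hΔ, ht]
    simp only [inner_add_right, inner_neg_right, real_inner_smul_right,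
      real_inner_self_eq_norm_sq]
    rw [real_inner_comm v]; ring
  have h3 : ⟪Δ, v⟫ = -(h * (a * ⟪v, L x⟫ + a * ⟪v, L e⟫ + ‖v‖ ^ 2)) + ⟪v, d⟫ := by
    rw [real_inner_comm, hΔ, ht]
    simp only [inner_add_right, inner_neg_right, real_inner_smul_right,
      real_inner_self_eq_norm_sq]
    ring
  have h4 : ⟪x, t⟫ = ⟪x, L x⟫ + ⟪L x, e⟫ := by rw [ht, inner_add_right, hL.symm x e]
  have h5 : ⟪v, t⟫ = ⟪v, L x⟫ + ⟪v, L e⟫ := by rw [ht, inner_add_right]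
  rw [h1, h2, h3, h4, h5]
  ring

theorem norm_increment_sq_le (hρ : 0 < ρ) (x v e d : E) :
    ‖-(h • (a • (L x + L e) + v)) + d‖ ^ 2
      ≤ h ^ 2 * (8 * a ^ 2 * ‖L x‖ ^ 2 + 8 * a ^ 2 * ρ ^ 2 * ‖e‖ ^ 2 + 4 * ‖v‖ ^ 2)
        + 2 * ‖d‖ ^ 2 := by
  have h1 := norm_add_sq_le_two (-(h • (a • (L x + L e) + v))) d
  have h2 := norm_add_sq_le_two (a • (L x + L e)) v
  have h3 := norm_add_sq_le_two (L x) (L e)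
  have h4 := hL.norm_apply_sq_le hρ e
  rw [norm_neg, norm_smul, mul_pow, Real.norm_eq_abs, sq_abs] at h1
  rw [norm_smul, mul_pow, Real.norm_eq_abs, sq_abs] at h2
  have h5 : ‖a • (L x + L e) + v‖ ^ 2
      ≤ 4 * a ^ 2 * ‖L x‖ ^ 2 + 4 * a ^ 2 * ρ ^ 2 * ‖e‖ ^ 2 + 2 * ‖v‖ ^ 2 := by
    have : a ^ 2 * ‖L x + L e‖ ^ 2 ≤ a ^ 2 * (2 * ‖L x‖ ^ 2 + 2 * (ρ ^ 2 * ‖e‖ ^ 2)) := by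
      gcongr; linarith
    linarith
  have h6 := mul_le_mul_of_nonneg_left h5 (sq_nonneg h)
  linarith

theorem norm_dual_increment_sq_le (hρ : 0 < ρ) (x e : E) :
    ‖h • (L x + L e)‖ ^ 2 ≤ h ^ 2 * (2 * ‖L x‖ ^ 2 + 2 * ρ ^ 2 * ‖e‖ ^ 2) := by
  have h3 := norm_add_sq_le_two (L x) (L e)
  have h4 := hL.norm_apply_sq_le hρ e
  rw [norm_smul, mul_pow, Real.norm_eq_abs, sq_abs]
  gcongr
  linarith

end IsGapOperator

/-- Strict decrease of the Lyapunov function of the whole network, the energy plus the squared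
compression error, up to the compression noise `e` and the gradient perturbation `d`. Here `h` is
the consensus stepsize, `w` the compression error after the update of the reference point, and
`w + Δ` the one after the move `Δ` of the iterate. -/
theorem exists_lyapunov_decrease {ρ₂ ρ a η : ℝ} (hρ₂ : 0 < ρ₂) (hρ : 0 < ρ) (ha : 0 < a)
    (hη : 0 < η) :
    ∃ θ m Cₑ h₀ : ℝ, 0 < θ ∧ θ ≤ 1 / 2 ∧ θ ≤ ρ₂ / 2 ∧ 0 < m ∧ 0 < Cₑ ∧ 0 < h₀ ∧
    ∀ h : ℝ, 0 < h → h ≤ h₀ → ∃ K : ℝ, 0 < K ∧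
    ∀ (E : Type) [NormedAddCommGroup E] [InnerProductSpace ℝ E] (L : E →ₗ[ℝ] E),
      IsGapOperator L ρ₂ ρ → ∀ x v e d w : E,
      energy L θ (x + (-(h • (a • (L x + L e) + v)) + d)) (v + h • (L x + L e))
        + ‖w + (-(h • (a • (L x + L e) + v)) + d)‖ ^ 2
      ≤ energy L θ x v - h * m * (‖L x‖ ^ 2 + ‖v‖ ^ 2) + Cₑ * h * ‖e‖ ^ 2
        + (1 + η / 2) * ‖w‖ ^ 2 + K * ‖d‖ ^ 2 := by
  -- the smallness of `θ` makes the cross terms of the derivative subordinate to `‖L x‖²`, `‖v‖²`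
  obtain ⟨θ, hθ0, hθ1, hθ2, hθ3, hθ4⟩ : ∃ θ : ℝ, 0 < θ ∧ θ ≤ 1 / 2 ∧ θ ≤ ρ₂ / 2 ∧
      θ ≤ a * ρ₂ / 4 ∧ θ ≤ 1 / (8 * a) :=
    ⟨min (min (1 / 2) (ρ₂ / 2)) (min (a * ρ₂ / 4) (1 / (8 * a))), by positivity,
      (min_le_left _ _).trans (min_le_left _ _), (min_le_left _ _).trans (min_le_right _ _),
      (min_le_right _ _).trans (min_le_left _ _), (min_le_right _ _).trans (min_le_right _ _)⟩
  have hm0 : 0 < min (a / 4) (θ / 2) := by positivity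
  -- `b` collects the coefficients of the second-order terms
  set k₁ := ρ + θ + (1 + 2 / η) with hk₁
  set b := k₁ * (8 * a ^ 2 + 4) + (1 + θ) * 2 with hb
  set bₑ := k₁ * (8 * a ^ 2 * ρ ^ 2) + (1 + θ) * (2 * ρ ^ 2) with hbₑ
  have hk₁0 : 0 < k₁ := by positivity
  have hb0 : 0 < b := by positivity
  have hbₑ0 : 0 < bₑ := by positivity
  set C₁ := 4 * a * ρ ^ 2 + 4 / θ * ρ ^ 2 + 4 * θ ^ 2 / a + 4 * θ * a ^ 2 * ρ ^ 2 with hC₁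
  have hC₁0 : 0 < C₁ := by positivity
  refine ⟨θ, min (a / 4) (θ / 2), C₁ + bₑ, min 1 (min (a / 8 / b) (θ / 2 / b)), hθ0, hθ1, hθ2,
    hm0, by positivity, by positivity, fun h h0 hh => ?_⟩
  have hh1 : h ≤ 1 := hh.trans (min_le_left _ _)
  have hh2 : h * b ≤ a / 8 := by
    rw [← le_div_iff₀ hb0]; exact hh.trans ((min_le_right _ _).trans (min_le_left _ _))
  have hh3 : h * b ≤ θ / 2 := by
    rw [← le_div_iff₀ hb0]; exact hh.trans ((min_le_right _ _).trans (min_le_right _ _))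
  set K₁ := 8 / (h * a) + 4 * θ / h with hK₁
  refine ⟨K₁ + 2 * k₁, by positivity, ?_⟩
  intro E _ _ L hL x v e d w
  have hW := hL.energy_step (a := a) (h := h) (θ := θ) x v e d
  have hΔ := hL.norm_increment_sq_le (a := a) (h := h) hρ x v e d
  have hT := hL.norm_dual_increment_sq_le (h := h) hρ x e
  set t := h • (L x + L e) with ht
  set Δ := -(h • (a • (L x + L e) + v)) + d with hΔd
  have hLe := hL.norm_apply_sq_le hρ e
  have hQ := hL.lower x
  have hq := hL.inner_apply_le hρ Δ
  have hw := norm_add_sq_le_weighted w Δ (κ := η / 2) (by positivity)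
  have hΔt := two_mul_inner_le Δ t one_pos
  have y1 := neg_two_mul_inner_le (L x) (L e) (κ := 1 / 4) (by positivity)
  have y2 := two_mul_inner_le v (L e) (κ := θ / 4) (by positivity)
  have y3 := two_mul_inner_le (L x) e (κ := a / (4 * θ)) (by positivity)
  have y4 := neg_two_mul_inner_le v (L x) (κ := 1 / (4 * a)) (by positivity)
  have y5 := neg_two_mul_inner_le v (L e) (κ := 1 / (4 * a)) (by positivity)
  have y6 := two_mul_inner_le (L x) d (κ := h * a / 8) (by positivity)
  have y7 := two_mul_inner_le v d (κ := h / 4) (by positivity)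
  set N := ‖L x‖ ^ 2
  set M := ‖v‖ ^ 2
  set D := ‖d‖ ^ 2
  set e2 := ‖e‖ ^ 2
  set Q := ⟪x, L x⟫
  have hN : 0 ≤ N := sq_nonneg _
  have hM : 0 ≤ M := sq_nonneg _
  have he2 : 0 ≤ e2 := sq_nonneg _
  have hD : 0 ≤ D := sq_nonneg _
  have hLxQ := hL.upper x
  have hQ0 : 0 ≤ Q := by
    by_contra! hneg
    have : ρ * Q < 0 := mul_neg_of_pos_of_neg hρ hneg
    linarith
  have z1 : 2 * θ * Q ≤ a / 2 * N := by
    have h1 : θ * Q ≤ a * ρ₂ / 4 * Q := by gcongr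
    have h2 : a * (ρ₂ * Q) ≤ a * N := by gcongr
    linarith
  have z2 : -(a * (2 * ⟪L x, L e⟫)) ≤ a / 4 * N + 4 * a * ρ ^ 2 * e2 := by
    have h1 := mul_le_mul_of_nonneg_left y1 ha.le
    have h2 := mul_le_mul_of_nonneg_left hLe ha.le
    norm_num at h1
    linarith
  have z3 : 2 * ⟪v, L e⟫ ≤ θ / 4 * M + 4 / θ * ρ ^ 2 * e2 := by
    have h1 : (θ / 4)⁻¹ = 4 / θ := inv_div _ _
    rw [h1] at y2
    have h2 : 4 / θ * ‖L e‖ ^ 2 ≤ 4 / θ * (ρ ^ 2 * e2) := by gcongr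
    linarith
  have z4 : θ * (2 * ⟪L x, e⟫) ≤ a / 4 * N + 4 * θ ^ 2 / a * e2 := by
    have h1 := mul_le_mul_of_nonneg_left y3 hθ0.le
    have h2 : θ * (a / (4 * θ) * N + (a / (4 * θ))⁻¹ * e2)
        = a / 4 * N + 4 * θ ^ 2 / a * e2 := by field_simp
    linarith
  have hθa : 4 * θ * a ^ 2 * N ≤ a / 2 * N := by
    have h1 : 4 * θ * a ^ 2 ≤ 4 * (1 / (8 * a)) * a ^ 2 := by gcongr
    have h2 : 4 * (1 / (8 * a)) * a ^ 2 = a / 2 := by field_simp; norm_num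
    rw [h2] at h1
    gcongr
  have hκ : (1 / (4 * a))⁻¹ = 4 * a := by rw [one_div, inv_inv]
  have hκ2 : θ * a * (1 / (4 * a) * M) = θ / 4 * M := by field_simp
  have z5 : -(θ * a * (2 * ⟪v, L x⟫)) ≤ θ / 4 * M + a / 2 * N := by
    have h1 := mul_le_mul_of_nonneg_left y4 (mul_pos hθ0 ha).le
    rw [hκ, mul_add, hκ2] at h1
    linarith
  have z6 : -(θ * a * (2 * ⟪v, L e⟫)) ≤ θ / 4 * M + 4 * θ * a ^ 2 * ρ ^ 2 * e2 := by
    have h1 := mul_le_mul_of_nonneg_left y5 (mul_pos hθ0 ha).le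
    rw [hκ, mul_add, hκ2] at h1
    have h2 : θ * a * (4 * a * ‖L e‖ ^ 2) ≤ θ * a * (4 * a * (ρ ^ 2 * e2)) := by gcongr
    linarith
  have z7 : 2 * ⟪L x, d⟫ ≤ h * (a / 8 * N) + 8 / (h * a) * D := by
    rw [inv_div] at y6; linarith
  have z8 : θ * (2 * ⟪v, d⟫) ≤ h * (θ / 4 * M) + 4 * θ / h * D := by
    have h1 := mul_le_mul_of_nonneg_left y7 hθ0.le
    rw [inv_div] at h1
    have h2 : θ * (h / 4 * M + 4 / h * D) = h * (θ / 4 * M) + 4 * θ / h * D := by ring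
    linarith
  have z9 : θ * (2 * ⟪Δ, t⟫) ≤ θ * ‖Δ‖ ^ 2 + θ * ‖t‖ ^ 2 := by
    have h1 := mul_le_mul_of_nonneg_left hΔt hθ0.le
    rw [inv_one] at h1
    linarith
  rw [inv_div] at hw
  have z10 : k₁ * ‖Δ‖ ^ 2 + (1 + θ) * ‖t‖ ^ 2
      ≤ h * (h * b * N) + h * (h * b * M) + h * (h * (bₑ * e2)) + 2 * k₁ * D := by
    have h1 := mul_le_mul_of_nonneg_left hΔ hk₁0.le
    have h2 := mul_le_mul_of_nonneg_left hT (by positivity : 0 ≤ 1 + θ)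
    have h3 : 0 ≤ h ^ 2 * (k₁ * 4) * N := by positivity
    have h4 : 0 ≤ h ^ 2 * (k₁ * (8 * a ^ 2) + (1 + θ) * 2) * M := by positivity
    rw [hb, hbₑ]
    linarith
  have z11 : h * (h * b * N) ≤ h * (a / 8 * N) := by gcongr
  have z12 : h * (h * b * M) ≤ h * (θ / 2 * M) := by gcongr
  have z13 : h * (h * (bₑ * e2)) ≤ h * (1 * (bₑ * e2)) := by gcongr
  have z14 : min (a / 4) (θ / 2) * (N + M) ≤ a / 4 * N + θ / 2 * M := by
    have h1 : min (a / 4) (θ / 2) * N ≤ a / 4 * N := by gcongr; exact min_le_left _ _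
    have h2 : min (a / 4) (θ / 2) * M ≤ θ / 2 * M := by gcongr; exact min_le_right _ _
    linarith
  have z14' := mul_le_mul_of_nonneg_left z14 h0.le
  have z15 : -(2 * a) * N - 2 * θ * M + 2 * θ * Q - a * (2 * ⟪L x, L e⟫) + 2 * ⟪v, L e⟫
      + θ * (2 * ⟪L x, e⟫) - θ * a * (2 * ⟪v, L x⟫) - θ * a * (2 * ⟪v, L e⟫)
      ≤ -(a / 2 * N) - 5 / 4 * (θ * M) + C₁ * e2 := by
    rw [hC₁]; linarith
  have z15' := mul_le_mul_of_nonneg_left z15 h0.le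
  have z16 : k₁ * ‖Δ‖ ^ 2 = (ρ + θ + (1 + 2 / η)) * ‖Δ‖ ^ 2 := rfl
  linarith

end Lyapunov

/-! ### Measurability and independence of the iterates -/

section Independence

/-- Conditioning on `X` when `Y` is independent of it: a bound on the second moment for frozen
first argument integrates to a bound on the expectation. -/
theorem integrable_comp_and_integral_le_of_indepFun {Ω : Type*} {𝒳 : Type*} {𝒴 : Type*}
    [MeasurableSpace Ω] [MeasurableSpace 𝒳] [MeasurableSpace 𝒴] {P : Measure Ω}
    [IsProbabilityMeasure P] {X : Ω → 𝒳} {Y : Ω → 𝒴} {ν : Measure 𝒴} (hX : Measurable X)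
    (hY : Measurable Y) (hν : P.map Y = ν) (hXY : IndepFun X Y P) {φ : 𝒳 × 𝒴 → ℝ}
    (hφ : Measurable φ) (h0 : ∀ z, 0 ≤ φ z) {ψ : 𝒳 → ℝ} (hψm : Measurable ψ)
    (hψ : Integrable (fun o => ψ (X o)) P)
    (h : ∀ x, Integrable (fun y => φ (x, y)) ν ∧ ∫ y, φ (x, y) ∂ν ≤ ψ x) :
    Integrable (fun o => φ (X o, Y o)) P ∧ ∫ o, φ (X o, Y o) ∂P ≤ ∫ o, ψ (X o) ∂P := by
  have hlaw : P.map (fun o => (X o, Y o)) = (P.map X).prod ν := by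
    rw [(indepFun_iff_map_prod_eq_prod_map_map hX.aemeasurable hY.aemeasurable).1 hXY, hν]
  have : IsProbabilityMeasure ν := hν ▸ Measure.isProbabilityMeasure_map hY.aemeasurable
  have : IsProbabilityMeasure (P.map X) := Measure.isProbabilityMeasure_map hX.aemeasurable
  have hψ' : Integrable ψ (P.map X) :=
    (integrable_map_measure hψm.aestronglyMeasurable hX.aemeasurable).2 hψ
  obtain ⟨h1, h2⟩ := integrable_prod_of_nonneg_of_le (μ := P.map X) (ν := ν)
    hφ.aestronglyMeasurable h0 hψ' (Filter.Eventually.of_forall h)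
  rw [← hlaw] at h1 h2
  rw [integral_map (hX.prodMk hY).aemeasurable hφ.aestronglyMeasurable,
    integral_map hX.aemeasurable hψm.aestronglyMeasurable] at h2
  exact ⟨(integrable_map_measure hφ.aestronglyMeasurable (hX.prodMk hY).aemeasurable).1 h1, h2⟩

theorem integral_comp_eq_of_indepFun {Ω : Type*} {𝒳 : Type*} {𝒴 : Type*}
    [MeasurableSpace Ω] [MeasurableSpace 𝒳] [MeasurableSpace 𝒴] {P : Measure Ω}
    [IsProbabilityMeasure P] {X : Ω → 𝒳} {Y : Ω → 𝒴} {ν : Measure 𝒴} (hX : Measurable X)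
    (hY : Measurable Y) (hν : P.map Y = ν) (hXY : IndepFun X Y P) {φ : 𝒳 × 𝒴 → ℝ}
    (hφ : Measurable φ) (hi : Integrable (fun o => φ (X o, Y o)) P) :
    ∫ o, φ (X o, Y o) ∂P = ∫ o, ∫ y, φ (X o, y) ∂ν ∂P := by
  have hlaw : P.map (fun o => (X o, Y o)) = (P.map X).prod ν := by
    rw [(indepFun_iff_map_prod_eq_prod_map_map hX.aemeasurable hY.aemeasurable).1 hXY, hν]
  have : IsProbabilityMeasure ν := hν ▸ Measure.isProbabilityMeasure_map hY.aemeasurable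
  have : IsProbabilityMeasure (P.map X) := Measure.isProbabilityMeasure_map hX.aemeasurable
  have h1 := (integrable_map_measure (f := fun o => (X o, Y o)) hφ.aestronglyMeasurable
    (hX.prodMk hY).aemeasurable).2 hi
  rw [hlaw] at h1
  rw [← integral_map (f := φ) (φ := fun o => (X o, Y o)) (hX.prodMk hY).aemeasurable
    hφ.aestronglyMeasurable, hlaw, integral_prod _ h1,
    integral_map hX.aemeasurable h1.1.integral_prod_right']

variable {n p : ℕ} {Ξ : Fin n → Type u} {S : Type v} {Ω : Type w}
  [∀ i, MeasurableSpace (Ξ i)] [MeasurableSpace S]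

/-- All components of the state are measurable functions of `o : Ω`. -/
structure MeasurableState [MeasurableSpace Ω] (X : Ω → State n p) : Prop where
  x : ∀ i, Measurable fun o => (X o).x i
  y : ∀ i, Measurable fun o => (X o).y i
  z : ∀ i, Measurable fun o => (X o).z i
  v : ∀ i, Measurable fun o => (X o).v i

variable {L : Matrix (Fin n) (Fin n) ℝ} {F : (i : Fin n) → Vec p → Ξ i → ℝ}
  {C : S → Vec p → Vec p} {α β γ : ℕ → ℝ} {ω : ℝ} {μ : Fin n → ℕ → ℝ} {x0 : Fin n → Vec p}
  {ξ : (i : Fin n) → ℕ → Ω → Ξ i} {ζ : Fin n → ℕ → Ω → UnitSphere p} {s : Fin n → ℕ → Ω → S}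

theorem measurable_zerothOrderGrad_comp {X : Type u} [MeasurableSpace X] [MeasurableSpace Ω]
    {F : Vec p → X → ℝ} (hF : Measurable (Function.uncurry F)) (μ : ℝ)
    {x : Ω → Vec p} {ξ : Ω → X} {ζ : Ω → UnitSphere p} (hx : Measurable x) (hξ : Measurable ξ)
    (hζ : Measurable ζ) : Measurable fun o => zerothOrderGrad F μ (ζ o) (ξ o) (x o) := by
  have hm : Measurable fun z : Vec p × X => F z.1 z.2 := hF
  have hζ' : Measurable fun o => (ζ o : Vec p) := hζ.subtype_val
  have h1 : Measurable fun o => F (x o) (ξ o) := hm.comp (hx.prodMk hξ)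
  have h2 : Measurable fun o => F (x o + μ • (ζ o : Vec p)) (ξ o) :=
    hm.comp ((hx.add (hζ'.const_smul μ)).prodMk hξ)
  unfold zerothOrderGrad
  exact (((h2.sub h1).const_mul _).div_const _).smul hζ'

/-- The state at time `k` is a measurable function of the inputs of the iterations before `k`. -/
theorem measurableState_iterates [MeasurableSpace Ω]
    (hF : ∀ i, Measurable (Function.uncurry (F i)))
    (hC : Measurable (Function.uncurry C)) (k : ℕ)
    (hξ : ∀ i, ∀ l < k, Measurable (ξ i l)) (hζ : ∀ i, ∀ l < k, Measurable (ζ i l))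
    (hs : ∀ i, ∀ l < k, Measurable (s i l)) :
    MeasurableState (iterates L F C α β γ ω μ x0 ξ ζ s k) := by
  induction k with
  | zero =>
    exact ⟨fun _ => measurable_const, fun _ => measurable_const, fun _ => measurable_const,
      fun _ => measurable_const⟩
  | succ k ih =>
    have h := ih (fun i l hl => hξ i l (hl.trans k.lt_succ_self))
      (fun i l hl => hζ i l (hl.trans k.lt_succ_self))
      (fun i l hl => hs i l (hl.trans k.lt_succ_self))
    set X := iterates L F C α β γ ω μ x0 ξ ζ s k
    have hq : ∀ i, Measurable fun o => C (s i k o) ((X o).x i - (X o).y i) := fun i =>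
      hC.comp ((hs i k k.lt_succ_self).prodMk ((h.x i).sub (h.y i)))
    have hg : ∀ i, Measurable fun o =>
        zerothOrderGrad (F i) (μ i k) (ζ i k o) (ξ i k o) ((X o).x i) := fun i =>
      measurable_zerothOrderGrad_comp (hF i) _ (h.x i) (hξ i k k.lt_succ_self)
        (hζ i k k.lt_succ_self)
    have hLq : ∀ i, Measurable fun o => ∑ j, L i j • C (s j k o) ((X o).x j - (X o).y j) :=
      fun i => Finset.measurable_fun_sum _ fun j _ => (hq j).const_smul (L i j)
    refine ⟨fun i => ?_, fun i => ?_, fun i => ?_, fun i => ?_⟩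
    · exact ((h.x i).sub (((h.z i).add (hLq i)).const_smul (α k * β k))).sub
        ((((h.v i).const_smul (γ k)).add (hg i)).const_smul (α k))
    · exact (h.y i).add ((hq i).const_smul ω)
    · exact (h.z i).add ((hLq i).const_smul ω)
    · exact (h.v i).add (((h.z i).add (hLq i)).const_smul (α k * γ k))

/-- The iteration to which a random input belongs. -/
def inputTime : (Fin n × ℕ) ⊕ (Fin n × ℕ) ⊕ ℕ → ℕ
  | Sum.inl (_, k) => k
  | Sum.inr (Sum.inl (_, k)) => k
  | Sum.inr (Sum.inr k) => k

/-- The σ-algebra generated by the inputs with index in `I`. -/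
@[reducible] def inputsIn (ξ : (i : Fin n) → ℕ → Ω → Ξ i) (ζ : Fin n → ℕ → Ω → UnitSphere p)
    (s : Fin n → ℕ → Ω → S) (I : Set ((Fin n × ℕ) ⊕ (Fin n × ℕ) ⊕ ℕ)) : MeasurableSpace Ω :=
  ⨆ t ∈ I, inputSigma ξ ζ s t

theorem inputSigma_le_inputsIn {I : Set ((Fin n × ℕ) ⊕ (Fin n × ℕ) ⊕ ℕ)} {t} (ht : t ∈ I) :
    inputSigma ξ ζ s t ≤ inputsIn ξ ζ s I :=
  le_iSup₂ (f := fun t (_ : t ∈ I) => inputSigma ξ ζ s t) t ht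

theorem measurable_sample_inputsIn {I : Set ((Fin n × ℕ) ⊕ (Fin n × ℕ) ⊕ ℕ)} {i : Fin n} {k : ℕ}
    (h : Sum.inl (i, k) ∈ I) : Measurable[inputsIn ξ ζ s I] (ξ i k) :=
  (comap_measurable (ξ i k)).mono (inputSigma_le_inputsIn (ξ := ξ) (ζ := ζ) (s := s) h) le_rfl

theorem measurable_direction_inputsIn {I : Set ((Fin n × ℕ) ⊕ (Fin n × ℕ) ⊕ ℕ)} {i : Fin n}
    {k : ℕ} (h : Sum.inr (Sum.inl (i, k)) ∈ I) : Measurable[inputsIn ξ ζ s I] (ζ i k) :=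
  (comap_measurable (ζ i k)).mono (inputSigma_le_inputsIn (ξ := ξ) (ζ := ζ) (s := s) h) le_rfl

theorem measurable_seed_inputsIn {I : Set ((Fin n × ℕ) ⊕ (Fin n × ℕ) ⊕ ℕ)} {k : ℕ} (i : Fin n)
    (h : Sum.inr (Sum.inr k) ∈ I) : Measurable[inputsIn ξ ζ s I] (s i k) :=
  (comap_measurable (s i k)).mono
    ((le_iSup (fun i => MeasurableSpace.comap (s i k) inferInstance) i).trans
      (inputSigma_le_inputsIn (ξ := ξ) (ζ := ζ) (s := s) h)) le_rfl

theorem measurableState_iterates_inputsIn (hF : ∀ i, Measurable (Function.uncurry (F i)))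
    (hC : Measurable (Function.uncurry C)) {k : ℕ}
    {I : Set ((Fin n × ℕ) ⊕ (Fin n × ℕ) ⊕ ℕ)} (hI : ∀ t, inputTime t < k → t ∈ I) :
    Measurable[inputsIn ξ ζ s I] (fun o => (iterates L F C α β γ ω μ x0 ξ ζ s k o).x) ∧
    ∀ i, Measurable[inputsIn ξ ζ s I] (fun o => (iterates L F C α β γ ω μ x0 ξ ζ s k o).x i
      - (iterates L F C α β γ ω μ x0 ξ ζ s k o).y i) := by
  have h := @measurableState_iterates n p Ξ S Ω _ _ L F C α β γ ω μ x0 ξ ζ s (inputsIn ξ ζ s I)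
    hF hC k (fun _ _ hl => measurable_sample_inputsIn (hI _ hl))
    (fun _ _ hl => measurable_direction_inputsIn (hI _ hl))
    (fun i _ hl => measurable_seed_inputsIn i (hI _ hl))
  have hx := @MeasurableState.x n p Ω (inputsIn ξ ζ s I) _ h
  have hy := @MeasurableState.y n p Ω (inputsIn ξ ζ s I) _ h
  exact ⟨@measurable_pi_lambda _ _ _ (inputsIn ξ ζ s I) _ _ hx, fun i => (hx i).sub (hy i)⟩

namespace IsRandomInput

variable [MeasurableSpace Ω] {P : Measure Ω}
  {D : (i : Fin n) → Measure (Ξ i)} {ν : Measure S}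
  (hin : IsRandomInput P D ν ξ ζ s)
include hin

theorem inputSigma_le (t) : inputSigma ξ ζ s t ≤ ‹MeasurableSpace Ω› := by
  rcases t with ⟨i, k⟩ | ⟨i, k⟩ | k
  · exact (hin.measurable_sample i k).comap_le
  · exact (hin.measurable_direction i k).comap_le
  · exact iSup_le fun i => (hin.measurable_seed i k).comap_le

theorem indepFun_of_disjoint {𝒳 𝒴 : Type*} [MeasurableSpace 𝒳] [MeasurableSpace 𝒴]
    {I J : Set ((Fin n × ℕ) ⊕ (Fin n × ℕ) ⊕ ℕ)} (hIJ : Disjoint I J) {X : Ω → 𝒳} {Y : Ω → 𝒴}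
    (hX : Measurable[inputsIn ξ ζ s I] X) (hY : Measurable[inputsIn ξ ζ s J] Y) :
    IndepFun X Y P :=
  indep_of_indep_of_le_right (indep_of_indep_of_le_left
    (indep_iSup_of_disjoint hin.inputSigma_le hin.indep hIJ) hX.comap_le) hY.comap_le

theorem measurableState (hF : ∀ i, Measurable (Function.uncurry (F i)))
    (hC : Measurable (Function.uncurry C)) (k : ℕ) :
    MeasurableState (iterates L F C α β γ ω μ x0 ξ ζ s k) :=
  measurableState_iterates hF hC k (fun i l _ => hin.measurable_sample i l)
    (fun i l _ => hin.measurable_direction i l) (fun i l _ => hin.measurable_seed i l)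

theorem map_sample_direction [IsProbabilityMeasure P] (i : Fin n) (k : ℕ) :
    P.map (fun o => (ξ i k o, ζ i k o)) = (D i).prod (uniformSphere p) := by
  have h : IndepFun (ξ i k) (ζ i k) P :=
    hin.indepFun_of_disjoint (I := {Sum.inl (i, k)}) (J := {Sum.inr (Sum.inl (i, k))})
      (by simp) (measurable_sample_inputsIn rfl) (measurable_direction_inputsIn rfl)
  rw [(indepFun_iff_map_prod_eq_prod_map_map (hin.measurable_sample i k).aemeasurable
    (hin.measurable_direction i k).aemeasurable).1 h, hin.law_sample, hin.law_direction]

theorem indepFun_state_sample (hF : ∀ i, Measurable (Function.uncurry (F i)))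
    (hC : Measurable (Function.uncurry C)) (i : Fin n) (k : ℕ) :
    IndepFun (fun o => (iterates L F C α β γ ω μ x0 ξ ζ s k o).x)
      (fun o => (ξ i k o, ζ i k o)) P := by
  have hX := measurableState_iterates_inputsIn (L := L) (α := α) (β := β) (γ := γ) (ω := ω)
    (μ := μ) (x0 := x0) (ξ := ξ) (ζ := ζ) (s := s) hF hC (k := k) (I := {t | inputTime t < k})
    fun t ht => ht
  refine hin.indepFun_of_disjoint (J := {Sum.inl (i, k), Sum.inr (Sum.inl (i, k))}) ?_
    hX.1
    ((measurable_sample_inputsIn (by simp)).prodMk (measurable_direction_inputsIn (by simp)))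
  rw [Set.disjoint_left]
  rintro t ht (rfl | rfl) <;> simp [inputTime] at ht

theorem indepFun_state_sample_sample (hF : ∀ i, Measurable (Function.uncurry (F i)))
    (hC : Measurable (Function.uncurry C)) {i j : Fin n} (hij : i ≠ j) (k : ℕ) :
    IndepFun (fun o => ((iterates L F C α β γ ω μ x0 ξ ζ s k o).x, (ξ i k o, ζ i k o)))
      (fun o => (ξ j k o, ζ j k o)) P := by
  have hX := measurableState_iterates_inputsIn (L := L) (α := α) (β := β) (γ := γ) (ω := ω)
    (μ := μ) (x0 := x0) (ξ := ξ) (ζ := ζ) (s := s) hF hC (k := k)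
    (I := {t | inputTime t < k} ∪ {Sum.inl (i, k), Sum.inr (Sum.inl (i, k))})
    fun t ht => Or.inl ht
  refine hin.indepFun_of_disjoint (J := {Sum.inl (j, k), Sum.inr (Sum.inl (j, k))}) ?_
    (hX.1.prodMk ((measurable_sample_inputsIn (by simp)).prodMk
      (measurable_direction_inputsIn (by simp))))
    ((measurable_sample_inputsIn (by simp)).prodMk (measurable_direction_inputsIn (by simp)))
  rw [Set.disjoint_left]
  rintro t ht (rfl | rfl) <;> simp [inputTime, hij.symm] at ht

theorem indepFun_state_seed (hF : ∀ i, Measurable (Function.uncurry (F i)))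
    (hC : Measurable (Function.uncurry C)) (i : Fin n) (k : ℕ) :
    IndepFun (fun o => (iterates L F C α β γ ω μ x0 ξ ζ s k o).x i
      - (iterates L F C α β γ ω μ x0 ξ ζ s k o).y i) (s i k) P := by
  have hX := measurableState_iterates_inputsIn (L := L) (α := α) (β := β) (γ := γ) (ω := ω)
    (μ := μ) (x0 := x0) (ξ := ξ) (ζ := ζ) (s := s) hF hC (k := k) (I := {t | inputTime t < k})
    fun t ht => ht
  refine hin.indepFun_of_disjoint (J := {Sum.inr (Sum.inr k)}) ?_
    (hX.2 i) (measurable_seed_inputsIn i rfl)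
  rw [Set.disjoint_left]
  rintro t ht rfl
  simp [inputTime] at ht

end IsRandomInput

end Independence

/-! ### Conditional moments of one iteration -/

section OneStep

variable {n p : ℕ} {Ω : Type w} [MeasurableSpace Ω] {P : Measure Ω} [IsProbabilityMeasure P]

omit [IsProbabilityMeasure P] in
theorem integrable_inner_of_memLp {E : Type*} [NormedAddCommGroup E] [InnerProductSpace ℝ E]
    {f g : Ω → E} (hf : MemLp f 2 P) (hg : MemLp g 2 P) :
    Integrable (fun o => ⟪f o, g o⟫) P :=
  (hf.norm.integrable_mul hg.norm).mono' (hf.1.inner hg.1)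
    (Filter.Eventually.of_forall fun _ => norm_inner_le_norm _ _)

section Compressor

variable {S : Type v} [MeasurableSpace S] {ν : Measure S} {C : S → Vec p → Vec p} {δ r ω : ℝ}

/-- Moments of a compressed message `C u`: the reference point update contracts the compression
error `u` in mean square, and `C u` is close to `u` up to a multiple of `u`. -/
theorem IsCompressor.moments (hC : IsCompressor ν C δ r) (hr : 0 < r) (hω : 0 < ω)
    (hωr : ω ≤ 1 / r) {u : Ω → Vec p} {s : Ω → S} (hu : Measurable u)
    (hs : Measurable s) (hν : P.map s = ν) (hus : IndepFun u s P) (hu2 : MemLp u 2 P) :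
    MemLp (fun o => C (s o) (u o)) 2 P ∧
    ∫ o, ‖u o - ω • C (s o) (u o)‖ ^ 2 ∂P ≤ (1 - ω * r * δ) * ∫ o, ‖u o‖ ^ 2 ∂P ∧
    ∫ o, ‖C (s o) (u o) - u o‖ ^ 2 ∂P
      ≤ (2 * r ^ 2 * (1 - δ) + 2 * (1 - r) ^ 2) * ∫ o, ‖u o‖ ^ 2 ∂P := by
  have hCm : Measurable fun z : S × Vec p => C z.1 z.2 := hC.measurable
  have hui : Integrable (fun o => ‖u o‖ ^ 2) P := hu2.integrable_norm_pow (by norm_num)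
  have hφ : Measurable fun z : Vec p × S => ‖r⁻¹ • C z.2 z.1 - z.1‖ ^ 2 :=
    (((hCm.comp (measurable_snd.prodMk measurable_fst)).const_smul r⁻¹).sub
      measurable_fst).norm.pow_const 2
  obtain ⟨h1, h2⟩ := integrable_comp_and_integral_le_of_indepFun hu hs hν hus hφ
    (fun _ => by positivity) (ψ := fun x => (1 - δ) * ‖x‖ ^ 2) (by fun_prop) (hui.const_mul _)
    (fun x => ⟨hC.integrable x, hC.error_le x⟩)
  simp only at h1 h2
  rw [integral_const_mul] at h2
  have hCu : Measurable fun o => C (s o) (u o) := hCm.comp (hs.prodMk hu)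
  have hE : MemLp (fun o => r⁻¹ • C (s o) (u o) - u o) 2 P :=
    (memLp_two_iff_integrable_sq_norm
      ((hCu.const_smul r⁻¹).sub hu).aestronglyMeasurable).2 h1
  have hCmem : MemLp (fun o => C (s o) (u o)) 2 P := by
    have := (hE.add hu2).const_smul r
    refine this.congr_norm ?_ ?_
    · exact hCu.aestronglyMeasurable
    · refine Filter.Eventually.of_forall fun o => ?_
      simp [smul_smul, hr.ne']
  refine ⟨hCmem, ?_, ?_⟩
  · have hωr1 : ω * r ≤ 1 := by rwa [le_div_iff₀ hr] at hωr
    have hωr0 : 0 < ω * r := mul_pos hω hr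
    have hpt : ∀ o, ‖u o - ω • C (s o) (u o)‖ ^ 2
        ≤ (1 - ω * r) * ‖u o‖ ^ 2 + ω * r * ‖r⁻¹ • C (s o) (u o) - u o‖ ^ 2 := by
      intro o
      have e : u o - ω • C (s o) (u o)
          = (1 - ω * r) • u o + (ω * r) • (-(r⁻¹ • C (s o) (u o) - u o)) := by
        rw [neg_sub, smul_sub, smul_smul, sub_smul, one_smul, mul_assoc, mul_inv_cancel₀ hr.ne',
          mul_one]
        abel
      have h3 : ‖u o - ω • C (s o) (u o)‖
          ≤ (1 - ω * r) * ‖u o‖ + ω * r * ‖r⁻¹ • C (s o) (u o) - u o‖ := by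
        rw [e]
        refine (norm_add_le _ _).trans ?_
        rw [norm_smul, norm_smul, norm_neg, Real.norm_of_nonneg (by linarith),
          Real.norm_of_nonneg hωr0.le]
      have h4 : ‖u o - ω • C (s o) (u o)‖ ^ 2
          ≤ ((1 - ω * r) * ‖u o‖ + ω * r * ‖r⁻¹ • C (s o) (u o) - u o‖) ^ 2 := by gcongr
      nlinarith [mul_nonneg (mul_nonneg hωr0.le (sub_nonneg.2 hωr1))
        (sq_nonneg (‖u o‖ - ‖r⁻¹ • C (s o) (u o) - u o‖))]
    refine (integral_mono_of_nonneg (Filter.Eventually.of_forall fun _ => by positivity)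
      ((hui.const_mul _).add (h1.const_mul _)) (Filter.Eventually.of_forall hpt)).trans ?_
    simp only [Pi.add_apply]
    rw [integral_add (hui.const_mul _) (h1.const_mul _), integral_const_mul, integral_const_mul]
    nlinarith [mul_le_mul_of_nonneg_left h2 hωr0.le]
  · have hpt : ∀ o, ‖C (s o) (u o) - u o‖ ^ 2
        ≤ 2 * r ^ 2 * ‖r⁻¹ • C (s o) (u o) - u o‖ ^ 2 + 2 * (1 - r) ^ 2 * ‖u o‖ ^ 2 := by
      intro o
      have e : C (s o) (u o) - u o = r • (r⁻¹ • C (s o) (u o) - u o) + (r - 1) • u o := by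
        rw [smul_sub, smul_smul, mul_inv_cancel₀ hr.ne', sub_smul]; simp
      have h3 := norm_add_sq_le_two (r • (r⁻¹ • C (s o) (u o) - u o)) ((r - 1) • u o)
      rw [← e, norm_smul, norm_smul, mul_pow, mul_pow, Real.norm_eq_abs, Real.norm_eq_abs,
        sq_abs, sq_abs] at h3
      nlinarith
    refine (integral_mono_of_nonneg (Filter.Eventually.of_forall fun _ => by positivity)
      ((h1.const_mul _).add (hui.const_mul _)) (Filter.Eventually.of_forall hpt)).trans ?_
    simp only [Pi.add_apply]
    rw [integral_add (h1.const_mul _) (hui.const_mul _), integral_const_mul, integral_const_mul]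
    nlinarith [mul_le_mul_of_nonneg_left h2 (by positivity : 0 ≤ 2 * r ^ 2)]

end Compressor

variable {Ξ : Fin n → Type u} [∀ i, MeasurableSpace (Ξ i)]

/-- The iterates `x` and the samples `t i = (ξ i, ζ i)` of one iteration: the samples have the
prescribed laws and are independent of each other and of the iterates, pairwise over the agents. -/
structure IsFreshSample (P : Measure Ω) (D : (i : Fin n) → Measure (Ξ i))
    (x : Ω → Fin n → Vec p) (t : (i : Fin n) → Ω → Ξ i × UnitSphere p) : Prop where
  measurable_x : Measurable x
  measurable_t : ∀ i, Measurable (t i)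
  law : ∀ i, P.map (t i) = (D i).prod (uniformSphere p)
  indep : ∀ i, IndepFun x (t i) P
  indep_pair : ∀ i j, i ≠ j → IndepFun (fun o => (x o, t i o)) (t j) P

/-- The mean of the two-point estimator at `x`. -/
noncomputable def meanEstimate {X : Type u} [MeasurableSpace X] (F : Vec p → X → ℝ)
    (D : Measure X) (μ : ℝ) (x : Vec p) : Vec p :=
  ∫ t, zerothOrderGrad F μ t.2 t.1 x ∂(D.prod (uniformSphere p))

variable {D : (i : Fin n) → Measure (Ξ i)} [∀ i, IsProbabilityMeasure (D i)]
  {F : (i : Fin n) → Vec p → Ξ i → ℝ} {ℓ η₁ σ₁ : ℝ} {μ : Fin n → ℝ}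
  {x : Ω → Fin n → Vec p} {t : (i : Fin n) → Ω → Ξ i × UnitSphere p}

theorem IsSmooth.norm_gradient_le {h : Vec p → ℝ} (hh : IsSmooth h ℓ) (y : Vec p) :
    ‖∇ h y‖ ≤ ‖∇ h 0‖ + ℓ * ‖y‖ := by
  have h1 := hh.lipschitz y 0
  have h2 := norm_le_norm_add_norm_sub' (∇ h y) (∇ h 0)
  rw [sub_zero] at h1
  linarith

theorem IsSmooth.memLp_gradient {h : Vec p → ℝ} (hh : IsSmooth h ℓ) {y : Ω → Vec p}
    (hym : Measurable y) (hy : MemLp y 2 P) : MemLp (fun o => ∇ h (y o)) 2 P := by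
  have hb : MemLp (fun o => ‖∇ h 0‖ + ℓ * ‖y o‖) 2 P :=
    (memLp_const ‖∇ h 0‖).add (f := fun _ => ‖∇ h 0‖) (g := fun o => ℓ * ‖y o‖)
      (hy.norm.const_mul ℓ)
  have hm : Measurable fun o => ∇ h (y o) := hh.continuous_gradient.measurable.comp hym
  exact hb.mono' hm.aestronglyMeasurable (Filter.Eventually.of_forall fun o => hh.norm_gradient_le (y o))

theorem IsSmooth.integrable_comp {h : Vec p → ℝ} (hh : IsSmooth h ℓ) (hℓ : 0 ≤ ℓ)
    {y : Ω → Vec p} (hym : Measurable y) (hy : MemLp y 2 P) :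
    Integrable (fun o => h (y o)) P := by
  have hy1 : Integrable y P := hy.integrable (by norm_num)
  have hb : Integrable (fun o => |h 0| + ‖∇ h 0‖ * ‖y o‖ + ℓ * ‖y o‖ ^ 2) P :=
    ((integrable_const _).add (hy1.norm.const_mul _)).add
      ((hy.integrable_norm_pow (by norm_num)).const_mul ℓ)
  have hm : Measurable fun o => h (y o) := hh.differentiable.continuous.measurable.comp hym
  refine hb.mono' hm.aestronglyMeasurable (Filter.Eventually.of_forall fun o => ?_)
  have h1 := hh.abs_remainder_le hℓ 0 (y o)
  rw [zero_add] at h1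
  have h2 := abs_real_inner_le_norm (∇ h 0) (y o)
  have e : h (y o) = h 0 + ⟪∇ h 0, y o⟫ + (h (y o) - h 0 - ⟪∇ h 0, y o⟫) := by ring
  rw [Real.norm_eq_abs, e]
  refine (abs_add_three _ _ _).trans ?_
  gcongr

theorem IsAgentCost.measurable_meanEstimate (hp : 1 ≤ p) {X : Type u} [MeasurableSpace X]
    {F : Vec p → X → ℝ} {D : Measure X} [IsProbabilityMeasure D] (hF : IsAgentCost F D ℓ η₁ σ₁)
    (μ : ℝ) : Measurable (meanEstimate F D μ) := by
  have hpr := isProbabilityMeasure_uniformSphere hp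
  exact (hF.measurable_zerothOrderGrad μ).stronglyMeasurable.integral_prod_right'.measurable

namespace IsFreshSample

variable (ht : IsFreshSample P D x t) (hF : ∀ i, IsAgentCost (F i) (D i) ℓ η₁ σ₁) (hp : 1 ≤ p)
  (hℓ : 0 ≤ ℓ) (hμ : ∀ i, 0 < μ i) (hx : ∀ i, MemLp (fun o => x o i) 2 P)
include ht hF hp hℓ hμ hx

/-- Second moment of the estimator along the iterates. -/
theorem memLp_and_integral_sq_le (i : Fin n) :
    MemLp (fun o => zerothOrderGrad (F i) (μ i) (t i o).2 (t i o).1 (x o i)) 2 P ∧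
    ∫ o, ‖zerothOrderGrad (F i) (μ i) (t i o).2 (t i o).1 (x o i)‖ ^ 2 ∂P
      ≤ 4 * p * (1 + η₁ ^ 2) * ∫ o, ‖∇ (localCost F D i) (x o i)‖ ^ 2 ∂P + 4 * p * σ₁ ^ 2
        + 2 * p ^ 2 * ℓ ^ 2 * μ i ^ 2 := by
  have hf : IsSmooth (localCost F D i) ℓ := (hF i).isSmooth hℓ
  have hxi : Measurable fun o => x o i := (measurable_pi_apply i).comp ht.measurable_x
  have hG : Integrable (fun o => ‖∇ (localCost F D i) (x o i)‖ ^ 2) P :=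
    (hf.memLp_gradient hxi (hx i)).integrable_norm_pow (by norm_num)
  have hgm := (hF i).measurable_zerothOrderGrad (μ i)
  have hcont := hf.continuous_gradient
  have hind : IndepFun (fun o => x o i) (t i) P :=
    (ht.indep i).comp (measurable_pi_apply i) measurable_id
  obtain ⟨h1, h2⟩ := integrable_comp_and_integral_le_of_indepFun hxi (ht.measurable_t i)
    (ht.law i) hind (φ := fun z => ‖zerothOrderGrad (F i) (μ i) z.2.2 z.2.1 z.1‖ ^ 2)
    (hgm.norm.pow_const 2) (fun _ => by positivity)
    (ψ := fun y => 4 * p * (1 + η₁ ^ 2) * ‖∇ (localCost F D i) y‖ ^ 2 + 4 * p * σ₁ ^ 2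
        + 2 * p ^ 2 * ℓ ^ 2 * μ i ^ 2)
    (by fun_prop) (((hG.const_mul _).add (integrable_const _)).add (integrable_const _))
    (fun y => (hF i).integrable_zerothOrderGrad_sq_and_integral_le hp hℓ (hμ i) y)
  refine ⟨(memLp_two_iff_integrable_sq_norm
    (hgm.comp (hxi.prodMk (ht.measurable_t i))).aestronglyMeasurable).2 h1, h2.trans ?_⟩
  rw [integral_add, integral_add, integral_const_mul, integral_const, integral_const]
  · simp
  exacts [hG.const_mul _, integrable_const _, (hG.const_mul _).add (integrable_const _),
    integrable_const _]

theorem memLp_meanEstimate (i : Fin n) :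
    MemLp (fun o => meanEstimate (F i) (D i) (μ i) (x o i)) 2 P := by
  have hf : IsSmooth (localCost F D i) ℓ := (hF i).isSmooth hℓ
  have hxi : Measurable fun o => x o i := (measurable_pi_apply i).comp ht.measurable_x
  have hb : MemLp (fun o => ‖∇ (localCost F D i) (x o i)‖ + ℓ * μ i) 2 P :=
    (hf.memLp_gradient hxi (hx i)).norm.add (memLp_const _)
  have hm : Measurable fun o => meanEstimate (F i) (D i) (μ i) (x o i) :=
    ((hF i).measurable_meanEstimate hp (μ i)).comp hxi
  refine hb.mono' hm.aestronglyMeasurable (Filter.Eventually.of_forall fun o => ?_)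
  have h1 := (hF i).norm_integral_zerothOrderGrad_sub_le hp hℓ (hμ i) (x o i)
  have h2 := norm_le_norm_add_norm_sub' (meanEstimate (F i) (D i) (μ i) (x o i))
    (∇ (localCost F D i) (x o i))
  exact h2.trans (add_le_add_right h1 _)

/-- The estimator can be replaced by its mean against functions of the iterates. -/
theorem integral_inner_left (i : Fin n) {Φ : (Fin n → Vec p) → Vec p} (hΦm : Measurable Φ)
    (hΦ : MemLp (fun o => Φ (x o)) 2 P) :
    ∫ o, ⟪Φ (x o), zerothOrderGrad (F i) (μ i) (t i o).2 (t i o).1 (x o i)⟫ ∂P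
      = ∫ o, ⟪Φ (x o), meanEstimate (F i) (D i) (μ i) (x o i)⟫ ∂P := by
  have hg := (ht.memLp_and_integral_sq_le hF hp hℓ hμ hx i).1
  have hm : Measurable fun z : (Fin n → Vec p) × Ξ i × UnitSphere p =>
      ⟪Φ z.1, zerothOrderGrad (F i) (μ i) z.2.2 z.2.1 (z.1 i)⟫ :=
    Measurable.inner (f := fun z : (Fin n → Vec p) × Ξ i × UnitSphere p => Φ z.1)
      (hΦm.comp measurable_fst)
      (measurable_zerothOrderGrad_comp (hF i).measurable (μ i)
        ((measurable_pi_apply i).comp measurable_fst) measurable_snd.fst measurable_snd.snd)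
  rw [integral_comp_eq_of_indepFun (φ := fun z : (Fin n → Vec p) × Ξ i × UnitSphere p =>
      ⟪Φ z.1, zerothOrderGrad (F i) (μ i) z.2.2 z.2.1 (z.1 i)⟫) ht.measurable_x
    (ht.measurable_t i) (ht.law i) (ht.indep i) hm (integrable_inner_of_memLp hΦ hg)]
  have h1 : ∀ o, ∫ y, ⟪Φ (x o), zerothOrderGrad (F i) (μ i) y.2 y.1 (x o i)⟫
        ∂((D i).prod (uniformSphere p))
      = ⟪Φ (x o), meanEstimate (F i) (D i) (μ i) (x o i)⟫ := fun o =>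
    integral_inner ((hF i).integrable_zerothOrderGrad hp hℓ (hμ i) (x o i)) _
  simp only [h1]

/-- The noises of distinct agents are uncorrelated. -/
theorem integral_inner_of_ne {i j : Fin n} (hij : i ≠ j) :
    ∫ o, ⟪zerothOrderGrad (F i) (μ i) (t i o).2 (t i o).1 (x o i),
        zerothOrderGrad (F j) (μ j) (t j o).2 (t j o).1 (x o j)⟫ ∂P
      = ∫ o, ⟪meanEstimate (F i) (D i) (μ i) (x o i),
          meanEstimate (F j) (D j) (μ j) (x o j)⟫ ∂P := by
  have hgi := (ht.memLp_and_integral_sq_le hF hp hℓ hμ hx i).1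
  have hgj := (ht.memLp_and_integral_sq_le hF hp hℓ hμ hx j).1
  have hm : Measurable fun z : ((Fin n → Vec p) × Ξ i × UnitSphere p) × Ξ j × UnitSphere p =>
      ⟪zerothOrderGrad (F i) (μ i) z.1.2.2 z.1.2.1 (z.1.1 i),
        zerothOrderGrad (F j) (μ j) z.2.2 z.2.1 (z.1.1 j)⟫ :=
    (measurable_zerothOrderGrad_comp (hF i).measurable (μ i)
        ((measurable_pi_apply i).comp measurable_fst.fst) measurable_fst.snd.fst
        measurable_fst.snd.snd).inner
      (measurable_zerothOrderGrad_comp (hF j).measurable (μ j)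
        ((measurable_pi_apply j).comp measurable_fst.fst) measurable_snd.fst measurable_snd.snd)
  rw [integral_comp_eq_of_indepFun
    (φ := fun z : ((Fin n → Vec p) × Ξ i × UnitSphere p) × Ξ j × UnitSphere p =>
      ⟪zerothOrderGrad (F i) (μ i) z.1.2.2 z.1.2.1 (z.1.1 i),
        zerothOrderGrad (F j) (μ j) z.2.2 z.2.1 (z.1.1 j)⟫)
    (ht.measurable_x.prodMk (ht.measurable_t i)) (ht.measurable_t j) (ht.law j)
    (ht.indep_pair i j hij) hm (integrable_inner_of_memLp hgi hgj)]
  have h1 : ∀ o, ∫ y, ⟪zerothOrderGrad (F i) (μ i) (t i o).2 (t i o).1 (x o i),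
        zerothOrderGrad (F j) (μ j) y.2 y.1 (x o j)⟫ ∂((D j).prod (uniformSphere p))
      = ⟪zerothOrderGrad (F i) (μ i) (t i o).2 (t i o).1 (x o i),
          meanEstimate (F j) (D j) (μ j) (x o j)⟫ := fun o =>
    integral_inner ((hF j).integrable_zerothOrderGrad hp hℓ (hμ j) (x o j)) _
  simp only [h1]
  have h2 := ht.integral_inner_left hF hp hℓ hμ hx i
    (Φ := fun y => meanEstimate (F j) (D j) (μ j) (y j))
    (((hF j).measurable_meanEstimate hp (μ j)).comp (measurable_pi_apply j))
    (ht.memLp_meanEstimate hF hp hℓ hμ hx j)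
  simp only [real_inner_comm] at h2 ⊢
  exact h2

end IsFreshSample

end OneStep

/-! ### Descent of the global cost -/

section Descent

variable {n p : ℕ}

theorem norm_average_sq (a : Fin n → Vec p) :
    ‖average a‖ ^ 2 = (1 / (n : ℝ)) ^ 2 * ∑ i, ∑ j, ⟪a i, a j⟫ := by
  rw [average, norm_smul, mul_pow, Real.norm_eq_abs, sq_abs, ← real_inner_self_eq_norm_sq,
    sum_inner]
  simp_rw [inner_sum]

theorem norm_average_sq_le (a : Fin n → Vec p) :
    ‖average a‖ ^ 2 ≤ (1 / (n : ℝ)) * ∑ i, ‖a i‖ ^ 2 := by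
  rcases Nat.eq_zero_or_pos n with h | h
  · subst h; simp [average]
  have hn : (0 : ℝ) < n := by exact_mod_cast h
  have h1 : ‖∑ i, a i‖ ^ 2 ≤ n * ∑ i, ‖a i‖ ^ 2 := by
    have h2 : ‖∑ i, a i‖ ≤ ∑ i, ‖a i‖ := norm_sum_le _ _
    have h3 := sq_sum_le_card_mul_sum_sq (s := Finset.univ) (f := fun i => ‖a i‖)
    rw [Finset.card_univ, Fintype.card_fin] at h3
    calc ‖∑ i, a i‖ ^ 2 ≤ (∑ i, ‖a i‖) ^ 2 := by gcongr
      _ ≤ _ := h3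
  rw [average, norm_smul, mul_pow, Real.norm_eq_abs, sq_abs]
  calc (1 / (n : ℝ)) ^ 2 * ‖∑ i, a i‖ ^ 2 ≤ (1 / (n : ℝ)) ^ 2 * (n * ∑ i, ‖a i‖ ^ 2) := by gcongr
    _ = _ := by field_simp

theorem average_sub (a b : Fin n → Vec p) :
    average (fun i => a i - b i) = average a - average b := by
  rw [average, average, average, Finset.sum_sub_distrib, smul_sub]

theorem measurable_average : Measurable (average : (Fin n → Vec p) → Vec p) := by
  have h : Measurable fun x : Fin n → Vec p => ∑ i, x i :=
    Finset.measurable_fun_sum _ fun i _ => measurable_pi_apply i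
  exact h.const_smul (1 / (n : ℝ))

/-- The mean squared distance of the agents to their average. -/
noncomputable def consensusError (x : Fin n → Vec p) : ℝ :=
  (1 / (n : ℝ)) * ∑ i, ‖x i - average x‖ ^ 2

theorem consensusError_nonneg (x : Fin n → Vec p) : 0 ≤ consensusError x := by
  unfold consensusError; positivity

variable {Ω : Type w} [MeasurableSpace Ω] {P : Measure Ω} [IsProbabilityMeasure P]
  {Ξ : Fin n → Type u} [∀ i, MeasurableSpace (Ξ i)]
  {D : (i : Fin n) → Measure (Ξ i)} [∀ i, IsProbabilityMeasure (D i)]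
  {F : (i : Fin n) → Vec p → Ξ i → ℝ} {ℓ η₁ σ₁ : ℝ} {μ : Fin n → ℝ}
  {x : Ω → Fin n → Vec p} {t : (i : Fin n) → Ω → Ξ i × UnitSphere p}

omit [IsProbabilityMeasure P] in
theorem memLp_average {a : Ω → Fin n → Vec p} (ha : ∀ i, MemLp (fun o => a o i) 2 P) :
    MemLp (fun o => average (a o)) 2 P := by
  have h : MemLp (fun o => ∑ i, a o i) 2 P := memLp_finsetSum _ fun i _ => ha i
  exact h.const_smul (1 / (n : ℝ))

omit [IsProbabilityMeasure P] in
theorem integrable_consensusError (hx : ∀ i, MemLp (fun o => x o i) 2 P) :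
    Integrable (fun o => consensusError (x o)) P := by
  refine (integrable_finsetSum _ fun i _ => ?_).const_mul _
  exact ((hx i).sub (memLp_average hx)).integrable_norm_pow (by norm_num)

/-- The two-point estimates of all agents at the iterates `x`. -/
noncomputable def estimates (F : (i : Fin n) → Vec p → Ξ i → ℝ) (μ : Fin n → ℝ)
    (t : (i : Fin n) → Ω → Ξ i × UnitSphere p) (x : Ω → Fin n → Vec p) (o : Ω) : Fin n → Vec p :=
  fun i => zerothOrderGrad (F i) (μ i) (t i o).2 (t i o).1 (x o i)

section Smooth

variable (hF : ∀ i, IsAgentCost (F i) (D i) ℓ η₁ σ₁) (hℓ : 0 ≤ ℓ) (hn : 1 ≤ n)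
include hF hℓ hn

theorem hasGradientAt_globalCost (x : Vec p) :
    HasGradientAt (globalCost F D) (average fun i => ∇ (localCost F D i) x) x := by
  have hn0 : (0 : ℝ) < n := by exact_mod_cast hn
  refine hasGradientAt_of_abs_remainder_le (c := ℓ) fun a => ?_
  have h1 : ∀ i, |localCost F D i (x + a) - localCost F D i x - ⟪∇ (localCost F D i) x, a⟫|
      ≤ ℓ * ‖a‖ ^ 2 := fun i => ((hF i).isSmooth hℓ).abs_remainder_le hℓ x a
  have e : globalCost F D (x + a) - globalCost F D x
        - ⟪average fun i => ∇ (localCost F D i) x, a⟫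
      = (1 / (n : ℝ)) * ∑ i, (localCost F D i (x + a) - localCost F D i x
        - ⟪∇ (localCost F D i) x, a⟫) := by
    simp only [globalCost, average, real_inner_smul_left, sum_inner, Finset.sum_sub_distrib]
    ring
  rw [e, abs_mul, abs_of_pos (by positivity)]
  calc _ ≤ (1 / (n : ℝ)) * ∑ _i : Fin n, ℓ * ‖a‖ ^ 2 := by
        gcongr
        exact (Finset.abs_sum_le_sum_abs _ _).trans (Finset.sum_le_sum fun i _ => h1 i)
    _ = ℓ * ‖a‖ ^ 2 := by simp; field_simp

theorem gradient_globalCost (x : Vec p) :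
    ∇ (globalCost F D) x = average fun i => ∇ (localCost F D i) x :=
  (hasGradientAt_globalCost hF hℓ hn x).gradient

theorem isSmooth_globalCost : IsSmooth (globalCost F D) ℓ := by
  have hn0 : (0 : ℝ) < n := by exact_mod_cast hn
  refine ⟨fun x => (hasGradientAt_globalCost hF hℓ hn x).differentiableAt, fun x y => ?_⟩
  rw [gradient_globalCost hF hℓ hn, gradient_globalCost hF hℓ hn, ← average_sub, average,
    norm_smul, Real.norm_of_nonneg (by positivity)]
  calc _ ≤ (1 / (n : ℝ)) * ∑ _i : Fin n, ℓ * ‖x - y‖ := by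
        gcongr
        exact (norm_sum_le _ _).trans (Finset.sum_le_sum fun i _ =>
          ((hF i).isSmooth hℓ).lipschitz x y)
    _ = ℓ * ‖x - y‖ := by simp; field_simp

end Smooth

/-- The averaged squared local gradients are controlled by the suboptimality at the average, the
data heterogeneity `f* - (1/n) ∑ f_i*`, and the consensus error. -/
theorem average_norm_gradient_sq_le (hF : ∀ i, IsAgentCost (F i) (D i) ℓ η₁ σ₁) (hℓ : 0 < ℓ)
    (hn : 1 ≤ n) {m : Fin n → ℝ} (hm : ∀ i y, m i ≤ localCost F D i y) (x : Fin n → Vec p) :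
    (1 / (n : ℝ)) * ∑ i, ‖∇ (localCost F D i) (x i)‖ ^ 2
      ≤ 8 * ℓ * (globalCost F D (average x) - (1 / (n : ℝ)) * ∑ i, m i)
        + 2 * ℓ ^ 2 * consensusError x := by
  have h1 : ∀ i, ‖∇ (localCost F D i) (x i)‖ ^ 2
      ≤ 8 * ℓ * (localCost F D i (average x) - m i) + 2 * ℓ ^ 2 * ‖x i - average x‖ ^ 2 := by
    intro i
    have hf : IsSmooth (localCost F D i) ℓ := (hF i).isSmooth hℓ.le
    have h2 := hf.norm_gradient_sq_le hℓ (hm i) (average x)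
    have h3 := hf.lipschitz (x i) (average x)
    have h4 := norm_add_sq_le_two (∇ (localCost F D i) (average x))
      (∇ (localCost F D i) (x i) - ∇ (localCost F D i) (average x))
    rw [add_sub_cancel] at h4
    have h5 : ‖∇ (localCost F D i) (x i) - ∇ (localCost F D i) (average x)‖ ^ 2
        ≤ ℓ ^ 2 * ‖x i - average x‖ ^ 2 := by rw [← mul_pow]; gcongr
    linarith
  calc _ ≤ (1 / (n : ℝ)) * ∑ i, (8 * ℓ * (localCost F D i (average x) - m i)
        + 2 * ℓ ^ 2 * ‖x i - average x‖ ^ 2) := by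
        gcongr with i; exact h1 i
    _ = _ := by
        rw [Finset.sum_add_distrib, ← Finset.mul_sum, ← Finset.mul_sum, Finset.sum_sub_distrib]
        simp only [globalCost, consensusError]
        ring

namespace IsFreshSample

variable (ht : IsFreshSample P D x t) (hF : ∀ i, IsAgentCost (F i) (D i) ℓ η₁ σ₁) (hp : 1 ≤ p)
  (hμ : ∀ i, 0 < μ i) (hx : ∀ i, MemLp (fun o => x o i) 2 P)
include ht hF hp hμ hx

/-- Averaging over the `n` agents divides the variance of the estimates by `n`. -/
theorem integral_norm_average_sq_le (hℓ : 0 ≤ ℓ) :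
    ∫ o, ‖average (estimates F μ t x o)‖ ^ 2 ∂P
      ≤ ∫ o, ‖average (fun i => meanEstimate (F i) (D i) (μ i) (x o i))‖ ^ 2 ∂P
        + (1 / (n : ℝ)) ^ 2 * ∑ i, ∫ o, ‖estimates F μ t x o i‖ ^ 2 ∂P := by
  have hg : ∀ i, MemLp (fun o => estimates F μ t x o i) 2 P := fun i =>
    (ht.memLp_and_integral_sq_le hF hp hℓ hμ hx i).1
  have hm := ht.memLp_meanEstimate hF hp hℓ hμ hx
  have e : ∀ a : Ω → Fin n → Vec p, (∀ i, MemLp (fun o => a o i) 2 P) →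
      ∫ o, ‖average (a o)‖ ^ 2 ∂P = (1 / (n : ℝ)) ^ 2 * ∑ i, ∑ j, ∫ o, ⟪a o i, a o j⟫ ∂P := by
    intro a ha
    simp_rw [norm_average_sq]
    rw [integral_const_mul, integral_finsetSum _ fun i _ => integrable_finsetSum _ fun j _ =>
      integrable_inner_of_memLp (ha i) (ha j)]
    congr 1
    refine Finset.sum_congr rfl fun i _ => ?_
    exact integral_finsetSum _ fun j _ => integrable_inner_of_memLp (ha i) (ha j)
  rw [e _ hg, e _ hm, ← mul_add, ← Finset.sum_add_distrib]
  gcongr with i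
  have h1 : ∑ j, (if i = j then ∫ o, ‖estimates F μ t x o i‖ ^ 2 ∂P else 0)
      = ∫ o, ‖estimates F μ t x o i‖ ^ 2 ∂P := by simp
  rw [← h1, ← Finset.sum_add_distrib]
  gcongr with j
  split_ifs with hij
  · subst hij
    have h2 : 0 ≤ ∫ o, ⟪meanEstimate (F i) (D i) (μ i) (x o i),
        meanEstimate (F i) (D i) (μ i) (x o i)⟫ ∂P :=
      integral_nonneg fun o => real_inner_self_nonneg
    simp only [real_inner_self_eq_norm_sq] at h2 ⊢
    linarith
  · rw [add_zero]
    exact (ht.integral_inner_of_ne hF hp hℓ hμ hx hij).le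

/-- Mean squared size of the gradient estimates. -/
theorem integral_average_sq_le (hℓ : 0 < ℓ) (hn : 1 ≤ n) {m : Fin n → ℝ}
    (hm : ∀ i y, m i ≤ localCost F D i y) {M : ℝ} (hM : ∀ i, μ i ^ 2 ≤ M) :
    ∫ o, (1 / (n : ℝ)) * ∑ i, ‖estimates F μ t x o i‖ ^ 2 ∂P
      ≤ 4 * p * (1 + η₁ ^ 2) * (8 * ℓ * (∫ o, globalCost F D (average (x o)) ∂P
          - (1 / (n : ℝ)) * ∑ i, m i) + 2 * ℓ ^ 2 * ∫ o, consensusError (x o) ∂P)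
        + 4 * p * σ₁ ^ 2 + 2 * p ^ 2 * ℓ ^ 2 * M := by
  have hn0 : (0 : ℝ) < n := by exact_mod_cast hn
  have hg := ht.memLp_and_integral_sq_le hF hp hℓ.le hμ hx
  have hxm : ∀ i, Measurable fun o => x o i := fun i =>
    (measurable_pi_apply i).comp ht.measurable_x
  have hG : ∀ i, Integrable (fun o => ‖∇ (localCost F D i) (x o i)‖ ^ 2) P := fun i =>
    (IsSmooth.memLp_gradient (h := localCost F D i) ((hF i).isSmooth hℓ.le) (hxm i)
      (hx i)).integrable_norm_pow (by norm_num)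
  have hav := memLp_average hx
  have havm : Measurable fun o => average (x o) := measurable_average.comp ht.measurable_x
  have hfi : Integrable (fun o => globalCost F D (average (x o))) P :=
    (isSmooth_globalCost hF hℓ.le hn).integrable_comp hℓ.le havm hav
  have hci := integrable_consensusError hx
  have h1 : ∫ o, (1 / (n : ℝ)) * ∑ i, ‖∇ (localCost F D i) (x o i)‖ ^ 2 ∂P
      ≤ 8 * ℓ * (∫ o, globalCost F D (average (x o)) ∂P
          - (1 / (n : ℝ)) * ∑ i, m i) + 2 * ℓ ^ 2 * ∫ o, consensusError (x o) ∂P := by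
    have hi : Integrable (fun o => 8 * ℓ * (globalCost F D (average (x o))
          - (1 / (n : ℝ)) * ∑ i, m i) + 2 * ℓ ^ 2 * consensusError (x o)) P :=
      ((hfi.sub (integrable_const _)).const_mul _).add (hci.const_mul _)
    refine (integral_mono ((integrable_finsetSum _ fun i _ => hG i).const_mul _) hi fun o =>
      average_norm_gradient_sq_le hF hℓ hn hm (x o)).trans ?_
    rw [integral_add, integral_const_mul, integral_const_mul, integral_sub hfi]
    · simp
    · exact integrable_const _
    · exact (hfi.sub (integrable_const _)).const_mul _
    · exact hci.const_mul _
  have hgi : ∀ i, Integrable (fun o => ‖estimates F μ t x o i‖ ^ 2) P := fun i =>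
    (hg i).1.integrable_norm_pow (by norm_num)
  rw [integral_const_mul, integral_finsetSum _ fun i _ => hgi i]
  rw [integral_const_mul, integral_finsetSum _ fun i _ => hG i] at h1
  have h2 : ∀ i, ∫ o, ‖estimates F μ t x o i‖ ^ 2 ∂P
      ≤ 4 * p * (1 + η₁ ^ 2) * ∫ o, ‖∇ (localCost F D i) (x o i)‖ ^ 2 ∂P
        + (4 * p * σ₁ ^ 2 + 2 * p ^ 2 * ℓ ^ 2 * M) := by
    intro i
    have h3 := (hg i).2
    have h4 : 2 * (p : ℝ) ^ 2 * ℓ ^ 2 * μ i ^ 2 ≤ 2 * p ^ 2 * ℓ ^ 2 * M := by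
      gcongr; exact hM i
    exact h3.trans (by linarith)
  calc _ ≤ (1 / (n : ℝ)) * ∑ i, (4 * p * (1 + η₁ ^ 2)
          * ∫ o, ‖∇ (localCost F D i) (x o i)‖ ^ 2 ∂P
        + (4 * p * σ₁ ^ 2 + 2 * p ^ 2 * ℓ ^ 2 * M)) := by gcongr with i; exact h2 i
    _ = 4 * p * (1 + η₁ ^ 2) * ((1 / (n : ℝ)) *
          ∑ i, ∫ o, ‖∇ (localCost F D i) (x o i)‖ ^ 2 ∂P)
        + (4 * p * σ₁ ^ 2 + 2 * p ^ 2 * ℓ ^ 2 * M) := by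
        rw [Finset.sum_add_distrib, ← Finset.mul_sum, Finset.sum_const, Finset.card_univ,
          Fintype.card_fin, nsmul_eq_mul]
        field_simp
    _ ≤ _ := by
        have := mul_le_mul_of_nonneg_left h1 (by positivity : 0 ≤ 4 * (p : ℝ) * (1 + η₁ ^ 2))
        linarith

/-- Expected descent of the global cost along the average of the agents. -/
theorem integral_globalCost_le (hℓ : 0 < ℓ) (hn : 1 ≤ n) {M α : ℝ} (hM : ∀ i, μ i ^ 2 ≤ M)
    (hα : 0 < α) (hαℓ : 2 * ℓ * α ≤ 1) :
    ∫ o, globalCost F D (average (x o) - α • average (estimates F μ t x o)) ∂P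
      ≤ ∫ o, globalCost F D (average (x o)) ∂P
        - α / 2 * ∫ o, ‖∇ (globalCost F D) (average (x o))‖ ^ 2 ∂P
        + α * ℓ ^ 2 * ∫ o, consensusError (x o) ∂P + α * ℓ ^ 2 * M
        + ℓ * α ^ 2 / n * ∫ o, (1 / (n : ℝ)) * ∑ i, ‖estimates F μ t x o i‖ ^ 2 ∂P := by
  have hn0 : (0 : ℝ) < n := by exact_mod_cast hn
  have hg : ∀ i, MemLp (fun o => estimates F μ t x o i) 2 P := fun i =>
    (ht.memLp_and_integral_sq_le hF hp hℓ.le hμ hx i).1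
  have hmm := ht.memLp_meanEstimate hF hp hℓ.le hμ hx
  have hf := isSmooth_globalCost hF hℓ.le hn
  have hav := memLp_average hx
  have havm : Measurable fun o => average (x o) := measurable_average.comp ht.measurable_x
  have hfi : Integrable (fun o => globalCost F D (average (x o))) P :=
    hf.integrable_comp hℓ.le havm hav
  have hci := integrable_consensusError hx
  have hgr := hf.memLp_gradient havm hav
  have hgri : Integrable (fun o => ‖∇ (globalCost F D) (average (x o))‖ ^ 2) P :=
    hgr.integrable_norm_pow (by norm_num)
  have hga := memLp_average hg
  have hma := memLp_average hmm
  set G : Ω → Vec p := fun o => average (estimates F μ t x o) with hG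
  set m : Ω → Vec p := fun o => average (fun i => meanEstimate (F i) (D i) (μ i) (x o i)) with hm
  set N : Ω → Vec p := fun o => ∇ (globalCost F D) (average (x o)) with hN
  have hGi : Integrable (fun o => ‖G o‖ ^ 2) P := hga.integrable_norm_pow (by norm_num)
  have hmi : Integrable (fun o => ‖m o‖ ^ 2) P := hma.integrable_norm_pow (by norm_num)
  have hNG := integrable_inner_of_memLp hgr hga
  have hNm := integrable_inner_of_memLp hgr hma
  -- smoothness along the averaged step
  have h1 : ∫ o, globalCost F D (average (x o) - α • G o) ∂P
      ≤ ∫ o, globalCost F D (average (x o)) ∂P - α * ∫ o, ⟪N o, G o⟫ ∂P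
        + ℓ * α ^ 2 * ∫ o, ‖G o‖ ^ 2 ∂P := by
    have hpt : ∀ o, globalCost F D (average (x o) - α • G o)
        ≤ globalCost F D (average (x o)) - α * ⟪N o, G o⟫ + ℓ * α ^ 2 * ‖G o‖ ^ 2 := by
      intro o
      have h2 := (abs_le.1 (hf.abs_remainder_le hℓ.le (average (x o)) (-(α • G o)))).2
      rw [← sub_eq_add_neg, inner_neg_right, real_inner_smul_right, norm_neg, norm_smul,
        Real.norm_of_nonneg hα.le] at h2
      have e : ℓ * (α * ‖G o‖) ^ 2 = ℓ * α ^ 2 * ‖G o‖ ^ 2 := by ring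
      linarith
    have hGm : MemLp (fun o => average (x o) - α • G o) 2 P := hav.sub (hga.const_smul α)
    have hL : Integrable (fun o => globalCost F D (average (x o) - α • G o)) P := by
      have hGmeas : Measurable G := by
        refine measurable_average.comp (measurable_pi_lambda _ fun i => ?_)
        exact measurable_zerothOrderGrad_comp (hF i).measurable (μ i)
          ((measurable_pi_apply i).comp ht.measurable_x) (ht.measurable_t i).fst
          (ht.measurable_t i).snd
      exact hf.integrable_comp hℓ.le (havm.sub (hGmeas.const_smul α)) hGm
    refine (integral_mono hL ((hfi.sub (hNG.const_mul α)).add (hGi.const_mul _)) hpt).trans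
      (le_of_eq ?_)
    simp only [Pi.add_apply, Pi.sub_apply]
    rw [integral_add, integral_sub hfi (hNG.const_mul α), integral_const_mul, integral_const_mul]
    · exact hfi.sub (hNG.const_mul α)
    · exact hGi.const_mul _
  have h2 : ∫ o, ⟪N o, G o⟫ ∂P = ∫ o, ⟪N o, m o⟫ ∂P := by
    simp only [hG, hm, average, real_inner_smul_right, inner_sum]
    rw [integral_const_mul, integral_const_mul,
      integral_finsetSum _ fun i _ => integrable_inner_of_memLp hgr (hg i),
      integral_finsetSum _ fun i _ => integrable_inner_of_memLp hgr (hmm i)]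
    congr 1
    refine Finset.sum_congr rfl fun i _ => ?_
    exact ht.integral_inner_left hF hp hℓ.le hμ hx i
      (Φ := fun y => ∇ (globalCost F D) (average y))
      (hf.continuous_gradient.measurable.comp measurable_average) hgr
  have h3 := ht.integral_norm_average_sq_le hF hp hμ hx hℓ.le
  -- the mean step is a gradient step up to the bias and the disagreement of the agents
  have h4 : - (α * ∫ o, ⟪N o, m o⟫ ∂P) + ℓ * α ^ 2 * ∫ o, ‖m o‖ ^ 2 ∂P
      ≤ -(α / 2 * ∫ o, ‖N o‖ ^ 2 ∂P) + α * ℓ ^ 2 * ∫ o, consensusError (x o) ∂P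
        + α * ℓ ^ 2 * M := by
    have hpt : ∀ o, -(α * ⟪N o, m o⟫) + ℓ * α ^ 2 * ‖m o‖ ^ 2
        ≤ -(α / 2 * ‖N o‖ ^ 2) + α * ℓ ^ 2 * consensusError (x o) + α * ℓ ^ 2 * M := by
      intro o
      have h5 : ‖N o - m o‖ ^ 2 ≤ 2 * ℓ ^ 2 * consensusError (x o) + 2 * ℓ ^ 2 * M := by
        rw [hN, hm]
        simp only
        rw [gradient_globalCost hF hℓ.le hn, ← average_sub]
        refine (norm_average_sq_le _).trans ?_
        have h6 : ∀ i, ‖∇ (localCost F D i) (average (x o))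
            - meanEstimate (F i) (D i) (μ i) (x o i)‖ ^ 2
            ≤ 2 * ℓ ^ 2 * ‖x o i - average (x o)‖ ^ 2 + 2 * ℓ ^ 2 * M := by
          intro i
          have h7 := (hF i).norm_integral_zerothOrderGrad_sub_le hp hℓ.le (hμ i) (x o i)
          have h8 : ‖∇ (localCost F D i) (average (x o)) - ∇ (localCost F D i) (x o i)‖
              ≤ ℓ * ‖average (x o) - x o i‖ := ((hF i).isSmooth hℓ.le).lipschitz _ _
          rw [norm_sub_rev] at h7
          rw [norm_sub_rev (average (x o))] at h8
          have h9 := norm_add_sq_le_two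
            (∇ (localCost F D i) (average (x o)) - ∇ (localCost F D i) (x o i))
            (∇ (localCost F D i) (x o i) - meanEstimate (F i) (D i) (μ i) (x o i))
          rw [sub_add_sub_cancel] at h9
          have h10 : ‖∇ (localCost F D i) (average (x o)) - ∇ (localCost F D i) (x o i)‖ ^ 2
              ≤ ℓ ^ 2 * ‖x o i - average (x o)‖ ^ 2 := by rw [← mul_pow]; gcongr
          have h11 : ‖∇ (localCost F D i) (x o i)
              - meanEstimate (F i) (D i) (μ i) (x o i)‖ ^ 2 ≤ ℓ ^ 2 * M := by
            calc _ ≤ (ℓ * μ i) ^ 2 := by gcongr; exact h7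
              _ = ℓ ^ 2 * μ i ^ 2 := by ring
              _ ≤ _ := by gcongr; exact hM i
          linarith
        calc _ ≤ (1 / (n : ℝ)) * ∑ i, (2 * ℓ ^ 2 * ‖x o i - average (x o)‖ ^ 2
              + 2 * ℓ ^ 2 * M) := by gcongr with i; exact h6 i
          _ = _ := by
            rw [Finset.sum_add_distrib, ← Finset.mul_sum, Finset.sum_const, Finset.card_univ,
              Fintype.card_fin, nsmul_eq_mul, consensusError]
            field_simp
      rw [norm_sub_sq_real] at h5
      have h6 : ℓ * α ^ 2 * ‖m o‖ ^ 2 ≤ α / 2 * ‖m o‖ ^ 2 := by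
        have : ℓ * α ^ 2 ≤ α / 2 := by nlinarith
        gcongr
      have h7 := mul_le_mul_of_nonneg_left h5 (by positivity : 0 ≤ α / 2)
      linarith
    have hi1 : Integrable (fun o => -(α * ⟪N o, m o⟫)) P := (hNm.const_mul α).neg
    have hi2 : Integrable (fun o => ℓ * α ^ 2 * ‖m o‖ ^ 2) P := hmi.const_mul _
    have hi3 : Integrable (fun o => -(α / 2 * ‖N o‖ ^ 2)) P := (hgri.const_mul _).neg
    have hi4 : Integrable (fun o => α * ℓ ^ 2 * consensusError (x o)) P := hci.const_mul _
    have := integral_mono (hi1.add hi2) ((hi3.add hi4).add (integrable_const (α * ℓ ^ 2 * M))) hpt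
    simp only [Pi.add_apply] at this
    rw [integral_add hi1 hi2, integral_add, integral_add hi3 hi4, integral_neg, integral_neg,
      integral_const_mul, integral_const_mul, integral_const_mul, integral_const_mul,
      integral_const] at this
    · simpa using this
    · exact hi3.add hi4
    · exact integrable_const _
  have h5 := mul_le_mul_of_nonneg_left h3 (by positivity : 0 ≤ ℓ * α ^ 2)
  have e : ℓ * α ^ 2 / n * ∫ o, (1 / (n : ℝ)) * ∑ i, ‖estimates F μ t x o i‖ ^ 2 ∂P
      = ℓ * α ^ 2 * ((1 / (n : ℝ)) ^ 2 * ∑ i, ∫ o, ‖estimates F μ t x o i‖ ^ 2 ∂P) := by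
    rw [integral_const_mul, integral_finsetSum _ fun i _ => (hg i).integrable_norm_pow
      (by norm_num)]
    ring
  rw [e]
  rw [h2] at h1
  linarith

end IsFreshSample

end Descent

/-! ### One iteration in the stacked space -/

section StackedStep

variable {n p : ℕ} {A : Matrix (Fin n) (Fin n) ℝ} {Ξ : Fin n → Type u} {S : Type v}
  {F : (i : Fin n) → Vec p → Ξ i → ℝ} {C : S → Vec p → Vec p} {α β γ ω a : ℝ} {μ : Fin n → ℝ}

/-- The block vector with blocks `x i`. -/
abbrev stack (x : Fin n → Vec p) : Stack n p := WithLp.toLp 2 x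

/-- The messages `q i = C (x i - y i)`. -/
def messages (C : S → Vec p → Vec p) (s : Fin n → S) (X : State n p) : Fin n → Vec p :=
  fun i => C (s i) (X.x i - X.y i)

/-- The two-point gradient estimates at the state `X`. -/
noncomputable def stepEstimates (F : (i : Fin n) → Vec p → Ξ i → ℝ) (μ : Fin n → ℝ)
    (ξ : (i : Fin n) → Ξ i) (ζ : Fin n → UnitSphere p) (X : State n p) : Fin n → Vec p :=
  fun i => zerothOrderGrad (F i) (μ i) (ζ i) (ξ i) (X.x i)

/-- The deviation of the decoded positions `y + q` from the true positions `x`. -/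
noncomputable def codingError (C : S → Vec p → Vec p) (s : Fin n → S) (X : State n p) :
    Stack n p :=
  stack X.y + stack (messages C s X) - stack X.x

/-- The increment of the stacked positions in one iteration, for consensus stepsize `h`. -/
noncomputable def increment (A : Matrix (Fin n) (Fin n) ℝ) (a h : ℝ) (x v e d : Stack n p) :
    Stack n p :=
  -(h • (a • (stackOp (laplacian A) x + stackOp (laplacian A) e) + v)) + d

variable {X : State n p} {ξ : (i : Fin n) → Ξ i} {ζ : Fin n → UnitSphere p} {s : Fin n → S}

theorem stackOp_stack_add_codingError (hz : stack X.z = stackOp (laplacian A) (stack X.y)) :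
    stackOp (laplacian A) (stack X.x) + stackOp (laplacian A) (codingError C s X)
      = stack X.z + stackOp (laplacian A) (stack (messages C s X)) := by
  rw [hz, ← map_add, ← map_add, codingError]
  congr 1
  abel

theorem stack_step_z (hz : stack X.z = stackOp (laplacian A) (stack X.y)) :
    stack (step (laplacian A) F C α β γ ω μ ξ ζ s X).z
      = stackOp (laplacian A) (stack (step (laplacian A) F C α β γ ω μ ξ ζ s X).y) := by
  have h1 : stack (step (laplacian A) F C α β γ ω μ ξ ζ s X).z
      = stack X.z + ω • stackOp (laplacian A) (stack (messages C s X)) := rfl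
  have h2 : stack (step (laplacian A) F C α β γ ω μ ξ ζ s X).y
      = stack X.y + ω • stack (messages C s X) := rfl
  rw [h1, h2, map_add, map_smul, hz]

theorem stack_step_v (hz : stack X.z = stackOp (laplacian A) (stack X.y)) :
    stack (step (laplacian A) F C α β γ ω μ ξ ζ s X).v
      = stack X.v + (α * γ) • (stackOp (laplacian A) (stack X.x)
          + stackOp (laplacian A) (codingError C s X)) := by
  rw [stackOp_stack_add_codingError hz]
  rfl

theorem stack_step_x (hβ : β = a * γ) (hz : stack X.z = stackOp (laplacian A) (stack X.y)) :
    stack (step (laplacian A) F C α β γ ω μ ξ ζ s X).x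
      = stack X.x + increment A a (α * γ) (stack X.x) (stack X.v) (codingError C s X)
          (-(α • stack (stepEstimates F μ ξ ζ X))) := by
  have h1 : stack (step (laplacian A) F C α β γ ω μ ξ ζ s X).x
      = stack X.x - (α * β) • (stack X.z + stackOp (laplacian A) (stack (messages C s X)))
        - α • (γ • stack X.v + stack (stepEstimates F μ ξ ζ X)) := rfl
  rw [h1, increment, stackOp_stack_add_codingError hz, hβ]
  module

theorem stack_step_x_sub_y (hβ : β = a * γ)
    (hz : stack X.z = stackOp (laplacian A) (stack X.y)) :
    stack (step (laplacian A) F C α β γ ω μ ξ ζ s X).x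
        - stack (step (laplacian A) F C α β γ ω μ ξ ζ s X).y
      = (stack X.x - stack X.y - ω • stack (messages C s X))
        + increment A a (α * γ) (stack X.x) (stack X.v) (codingError C s X)
          (-(α • stack (stepEstimates F μ ξ ζ X))) := by
  have h2 : stack (step (laplacian A) F C α β γ ω μ ξ ζ s X).y
      = stack X.y + ω • stack (messages C s X) := rfl
  rw [stack_step_x hβ hz, h2]
  abel

theorem sum_step_v (hA : IsUndirectedConnected A)
    (hz : stack X.z = stackOp (laplacian A) (stack X.y)) (hv : ∑ i, X.v i = 0) :
    ∑ i, (step (laplacian A) F C α β γ ω μ ξ ζ s X).v i = 0 := by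
  have h1 : ∀ i, (step (laplacian A) F C α β γ ω μ ξ ζ s X).v i
      = X.v i + (α * γ) • (stackOp (laplacian A) (stack X.x) i
          + stackOp (laplacian A) (codingError C s X) i) := fun i =>
    congrArg (fun y : Stack n p => y i) (stack_step_v (F := F) (C := C) (α := α) (β := β) (γ := γ)
      (ω := ω) (μ := μ) (ξ := ξ) (ζ := ζ) (s := s) hz)
  simp only [h1, Finset.sum_add_distrib, ← Finset.smul_sum, hv, hA.sum_stackOp]
  simp

/-- The network average follows an inexact stochastic gradient step: the consensus terms
cancel. -/
theorem average_step_x (hA : IsUndirectedConnected A) (hβ : β = a * γ)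
    (hz : stack X.z = stackOp (laplacian A) (stack X.y)) (hv : ∑ i, X.v i = 0) :
    average (step (laplacian A) F C α β γ ω μ ξ ζ s X).x
      = average X.x - α • average (stepEstimates F μ ξ ζ X) := by
  have h1 : ∀ i, (step (laplacian A) F C α β γ ω μ ξ ζ s X).x i
      = X.x i + (-((α * γ) • (a • (stackOp (laplacian A) (stack X.x) i
          + stackOp (laplacian A) (codingError C s X) i) + X.v i))
          + -(α • stepEstimates F μ ξ ζ X i)) := fun i =>
    congrArg (fun y : Stack n p => y i) (stack_step_x (F := F) (C := C) (α := α) (ω := ω) (μ := μ)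
      (ξ := ξ) (ζ := ζ) (s := s) hβ hz)
  simp only [average, h1, Finset.sum_add_distrib, Finset.sum_neg_distrib, ← Finset.smul_sum, hv,
    hA.sum_stackOp]
  module

/-! ### Bounds on the Lyapunov function -/

/-- The Lyapunov function of the network. -/
noncomputable def lyapunov (A : Matrix (Fin n) (Fin n) ℝ) (θ : ℝ) (X : State n p) : ℝ :=
  energy (stackOp (laplacian A)) θ (stack X.x) (stack X.v) + ‖stack X.x - stack X.y‖ ^ 2

theorem norm_sub_stackAvg_sq (hn : 1 ≤ n) (x : Fin n → Vec p) :
    ‖stack x - stackAvg (stack x)‖ ^ 2 = n * consensusError x := by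
  have hn0 : (0 : ℝ) < n := by exact_mod_cast hn
  rw [stack_norm_sq, consensusError]
  field_simp
  rfl

section EnergyBounds

variable {ρ₂ ρ θ : ℝ} (hA : IsUndirectedConnected A)
  (hs : SpectrumWithin (laplacian A) ρ₂ ρ) (hρ₂ : 0 < ρ₂)
include hA hs hρ₂

theorem isGapOperator_stackOp : IsGapOperator (stackOp (p := p) (laplacian A)) ρ₂ ρ :=
  ⟨hA.inner_stackOp_left, fun x => (hA.quadratic_form_bounds hs hρ₂ x).2.1,
    fun x => (hA.quadratic_form_bounds hs hρ₂ x).2.2⟩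

/-- The cross term of the energy is small because the dual variables sum to zero, so that only
the disagreement of the positions enters. -/
theorem abs_energy_sub_le (hθ : 0 < θ) (hθ1 : θ ≤ 1 / 2) (hθ2 : θ ≤ ρ₂ / 2) (x : Stack n p)
    {v : Fin n → Vec p} (hv : ∑ i, v i = 0) :
    |energy (stackOp (laplacian A)) θ x (stack v)
        - (⟪x, stackOp (laplacian A) x⟫ + ‖stack v‖ ^ 2)|
      ≤ (⟪x, stackOp (laplacian A) x⟫ + ‖stack v‖ ^ 2) / 2 := by
  have h0 : ⟪stackAvg x, stack v⟫ = 0 := by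
    rw [PiLp.inner_apply]
    change ∑ i, ⟪average (x : Fin n → Vec p), v i⟫ = 0
    rw [← inner_sum, hv, inner_zero_right]
  have h1 : ⟪x, stack v⟫ = ⟪x - stackAvg x, stack v⟫ := by rw [inner_sub_left, h0, sub_zero]
  have h2 := two_mul_inner_le (x - stackAvg x) (stack v) one_pos
  have h3 := neg_two_mul_inner_le (x - stackAvg x) (stack v) one_pos
  have h4 := (hA.quadratic_form_bounds hs hρ₂ x).1
  rw [inv_one, one_mul, one_mul] at h2 h3
  have h5 : |2 * ⟪x, stack v⟫| ≤ ‖x - stackAvg x‖ ^ 2 + ‖stack v‖ ^ 2 := by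
    rw [h1]; exact abs_le.2 ⟨by linarith, h2⟩
  have h6 : energy (stackOp (laplacian A)) θ x (stack v)
        - (⟪x, stackOp (laplacian A) x⟫ + ‖stack v‖ ^ 2) = θ * (2 * ⟪x, stack v⟫) := by
    rw [energy]; ring
  rw [h6, abs_mul, abs_of_pos hθ]
  have h7 : θ * |2 * ⟪x, stack v⟫| ≤ θ * (‖x - stackAvg x‖ ^ 2 + ‖stack v‖ ^ 2) := by gcongr
  have h8 : θ * ‖x - stackAvg x‖ ^ 2 ≤ ρ₂ / 2 * ‖x - stackAvg x‖ ^ 2 := by gcongr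
  have h9 : θ * ‖stack v‖ ^ 2 ≤ 1 / 2 * ‖stack v‖ ^ 2 := by gcongr
  linarith

theorem energy_le (hθ : 0 < θ) (hθ1 : θ ≤ 1 / 2) (hθ2 : θ ≤ ρ₂ / 2) (x : Stack n p)
    {v : Fin n → Vec p} (hv : ∑ i, v i = 0) :
    energy (stackOp (laplacian A)) θ x (stack v)
      ≤ 3 / 2 * (1 / ρ₂ + 1) * (‖stackOp (laplacian A) x‖ ^ 2 + ‖stack v‖ ^ 2) := by
  have h1 := (abs_le.1 (abs_energy_sub_le hA hs hρ₂ hθ hθ1 hθ2 x hv)).2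
  have h2 := (hA.quadratic_form_bounds hs hρ₂ x).2.1
  have h3 : ⟪x, stackOp (laplacian A) x⟫ ≤ 1 / ρ₂ * ‖stackOp (laplacian A) x‖ ^ 2 := by
    rw [one_div, ← div_eq_inv_mul, le_div_iff₀ hρ₂]; linarith
  have h4 : 0 ≤ 1 / ρ₂ * ‖stack v‖ ^ 2 := by positivity
  have h5 : 0 ≤ ‖stackOp (laplacian A) x‖ ^ 2 := by positivity
  linarith

theorem lyapunov_nonneg_and_consensusError_le (hn : 1 ≤ n) (hθ : 0 < θ) (hθ1 : θ ≤ 1 / 2)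
    (hθ2 : θ ≤ ρ₂ / 2) {X : State n p} (hv : ∑ i, X.v i = 0) :
    0 ≤ lyapunov A θ X ∧ consensusError X.x ≤ 2 / ρ₂ * (1 / n * lyapunov A θ X) := by
  have hn0 : (0 : ℝ) < n := by exact_mod_cast hn
  have h1 := (abs_le.1 (abs_energy_sub_le hA hs hρ₂ hθ hθ1 hθ2 (stack X.x) hv)).1
  have h2 := (hA.quadratic_form_bounds hs hρ₂ (stack X.x)).1
  rw [norm_sub_stackAvg_sq hn] at h2
  have h3 : 0 ≤ ‖stack X.v‖ ^ 2 := by positivity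
  have h4 : 0 ≤ ‖stack X.x - stack X.y‖ ^ 2 := by positivity
  have h5 : 0 ≤ ρ₂ * (n * consensusError X.x) :=
    mul_nonneg hρ₂.le (mul_nonneg hn0.le (consensusError_nonneg _))
  have h6 : ρ₂ * (n * consensusError X.x) ≤ 2 * lyapunov A θ X := by
    rw [lyapunov]; linarith
  refine ⟨by linarith, ?_⟩
  have : 2 / ρ₂ * (1 / n * lyapunov A θ X) = 2 * lyapunov A θ X / (ρ₂ * n) := by field_simp
  rw [this, le_div_iff₀ (by positivity)]
  linarith

theorem lyapunov_initial_le (hρ : 0 < ρ) (x0 : Fin n → Vec p) :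
    lyapunov A θ { x := x0, y := 0, z := 0, v := 0 } ≤ (ρ + 1) * ∑ i, ‖x0 i‖ ^ 2 := by
  have h1 := (isGapOperator_stackOp hA hs hρ₂).inner_apply_le hρ (stack x0)
  have h2 : stack (0 : Fin n → Vec p) = 0 := rfl
  have h3 : ‖stack x0‖ ^ 2 = ∑ i, ‖x0 i‖ ^ 2 := stack_norm_sq _
  rw [lyapunov, energy]
  simp only [h2, norm_zero, inner_zero_right, sub_zero, mul_zero, add_zero]
  rw [← h3]
  linarith

end EnergyBounds

end StackedStep

/-! ### The Lyapunov recursion along the algorithm -/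

section Run

variable {n p : ℕ} {Ω : Type w} [MeasurableSpace Ω] {P : Measure Ω}
  {Ξ : Fin n → Type u} [∀ i, MeasurableSpace (Ξ i)] {D : (i : Fin n) → Measure (Ξ i)}
  {F : (i : Fin n) → Vec p → Ξ i → ℝ} {S : Type v} [MeasurableSpace S] {ν : Measure S}
  {C : S → Vec p → Vec p} {A : Matrix (Fin n) (Fin n) ℝ} {α a γ ω ℓ η₁ σ₁ δ r : ℝ}
  {μ : Fin n → ℕ → ℝ} {x0 : Fin n → Vec p} {ξ : (i : Fin n) → ℕ → Ω → Ξ i}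
  {ζ : Fin n → ℕ → Ω → UnitSphere p} {s : Fin n → ℕ → Ω → S} {X : ℕ → Ω → State n p}

/-- `X` is a run of the algorithm with constant parameters `α`, `β = a γ`, `γ`, under the
standing assumptions on the costs, the compressor and the random inputs. -/
structure IsRun (P : Measure Ω) (D : (i : Fin n) → Measure (Ξ i))
    (F : (i : Fin n) → Vec p → Ξ i → ℝ) (ν : Measure S) (C : S → Vec p → Vec p)
    (A : Matrix (Fin n) (Fin n) ℝ) (α a γ ω ℓ η₁ σ₁ δ r : ℝ) (μ : Fin n → ℕ → ℝ)
    (x0 : Fin n → Vec p) (ξ : (i : Fin n) → ℕ → Ω → Ξ i) (ζ : Fin n → ℕ → Ω → UnitSphere p)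
    (s : Fin n → ℕ → Ω → S) (X : ℕ → Ω → State n p) : Prop where
  cost : ∀ i, IsAgentCost (F i) (D i) ℓ η₁ σ₁
  compressor : IsCompressor ν C δ r
  input : IsRandomInput P D ν ξ ζ s
  graph : IsUndirectedConnected A
  agents : 1 ≤ n
  dimension : 1 ≤ p
  smoothness_pos : 0 < ℓ
  scale_pos : 0 < r
  ω_pos : 0 < ω
  ω_le : ω ≤ 1 / r
  smoothing_pos : ∀ i k, 0 < μ i k
  eq_iterates : X = iterates (laplacian A) F C (fun _ => α) (fun _ => a * γ) (fun _ => γ) ω μ x0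
    ξ ζ s

namespace IsRun

variable (hR : IsRun P D F ν C A α a γ ω ℓ η₁ σ₁ δ r μ x0 ξ ζ s X)
include hR

theorem zero (o : Ω) : X 0 o = { x := x0, y := 0, z := 0, v := 0 } := by
  rw [hR.eq_iterates]; rfl

theorem succ (k : ℕ) (o : Ω) : X (k + 1) o = step (laplacian A) F C α (a * γ) γ ω
    (fun i => μ i k) (fun i => ξ i k o) (fun i => ζ i k o) (fun i => s i k o) (X k o) := by
  rw [hR.eq_iterates]; rfl

theorem invariants (k : ℕ) (o : Ω) :
    stack (X k o).z = stackOp (laplacian A) (stack (X k o).y) ∧ ∑ i, (X k o).v i = 0 := by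
  induction k with
  | zero =>
    rw [hR.zero]
    have : stack (0 : Fin n → Vec p) = 0 := rfl
    refine ⟨?_, by simp⟩
    rw [this, map_zero]
  | succ k ih =>
    rw [hR.succ]
    exact ⟨stack_step_z ih.1, sum_step_v hR.graph ih.1 ih.2⟩

theorem measurableState (k : ℕ) : MeasurableState (X k) := by
  rw [hR.eq_iterates]
  exact hR.input.measurableState (fun i => (hR.cost i).measurable) hR.compressor.measurable k

theorem isFreshSample [IsProbabilityMeasure P] (k : ℕ) :
    IsFreshSample P D (fun o => (X k o).x) (fun i o => (ξ i k o, ζ i k o)) := by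
  have hF := fun i => (hR.cost i).measurable
  have hC := hR.compressor.measurable
  have hm := hR.measurableState k
  rw [hR.eq_iterates] at hm ⊢
  exact ⟨measurable_pi_lambda _ hm.x,
    fun i => (hR.input.measurable_sample i k).prodMk (hR.input.measurable_direction i k),
    fun i => hR.input.map_sample_direction i k,
    fun i => hR.input.indepFun_state_sample hF hC i k,
    fun i j hij => hR.input.indepFun_state_sample_sample hF hC hij k⟩

theorem indepFun_seed (i : Fin n) (k : ℕ) :
    IndepFun (fun o => (X k o).x i - (X k o).y i) (s i k) P := by
  rw [hR.eq_iterates]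
  exact hR.input.indepFun_state_seed (fun i => (hR.cost i).measurable) hR.compressor.measurable i k

variable [IsProbabilityMeasure P]

/-- Moments of the compressed messages, given square-integrable states. -/
theorem message_moments (k : ℕ) (hx : ∀ i, MemLp (fun o => (X k o).x i) 2 P)
    (hy : ∀ i, MemLp (fun o => (X k o).y i) 2 P) (i : Fin n) :
    MemLp (fun o => messages C (fun i => s i k o) (X k o) i) 2 P ∧
    ∫ o, ‖(X k o).x i - (X k o).y i - ω • messages C (fun i => s i k o) (X k o) i‖ ^ 2 ∂P
      ≤ (1 - ω * r * δ) * ∫ o, ‖(X k o).x i - (X k o).y i‖ ^ 2 ∂P ∧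
    ∫ o, ‖messages C (fun i => s i k o) (X k o) i - ((X k o).x i - (X k o).y i)‖ ^ 2 ∂P
      ≤ (2 * r ^ 2 * (1 - δ) + 2 * (1 - r) ^ 2)
        * ∫ o, ‖(X k o).x i - (X k o).y i‖ ^ 2 ∂P := by
  have hm := hR.measurableState k
  exact hR.compressor.moments hR.scale_pos hR.ω_pos hR.ω_le ((hm.x i).sub (hm.y i))
    (hR.input.measurable_seed i k) (hR.input.law_seed i k) (hR.indepFun_seed i k)
    ((hx i).sub (hy i))

variable [∀ i, IsProbabilityMeasure (D i)]

theorem memLp (k : ℕ) (i : Fin n) :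
    MemLp (fun o => (X k o).x i) 2 P ∧ MemLp (fun o => (X k o).y i) 2 P ∧
    MemLp (fun o => (X k o).z i) 2 P ∧ MemLp (fun o => (X k o).v i) 2 P := by
  induction k generalizing i with
  | zero =>
    simp only [hR.zero]
    exact ⟨memLp_const _, memLp_const _, memLp_const _, memLp_const _⟩
  | succ k ih =>
    have hx := fun i => (ih i).1
    have hy := fun i => (ih i).2.1
    have hz := fun i => (ih i).2.2.1
    have hv := fun i => (ih i).2.2.2
    have hq := fun i => (hR.message_moments k hx hy i).1
    have hg := fun i => ((hR.isFreshSample k).memLp_and_integral_sq_le hR.cost hR.dimension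
      hR.smoothness_pos.le (fun i => hR.smoothing_pos i k) hx i).1
    have hLq : ∀ i, MemLp (fun o => ∑ j, laplacian A i j
        • messages C (fun i => s i k o) (X k o) j) 2 P :=
      fun i => memLp_finsetSum _ fun j _ => (hq j).const_smul (laplacian A i j)
    simp only [hR.succ]
    refine ⟨?_, ?_, ?_, ?_⟩
    · exact ((hx i).sub (((hz i).add (hLq i)).const_smul (α * (a * γ)))).sub
        ((((hv i).const_smul γ).add (hg i)).const_smul α)
    · exact (hy i).add ((hq i).const_smul ω)
    · exact (hz i).add ((hLq i).const_smul ω)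
    · exact (hv i).add (((hz i).add (hLq i)).const_smul (α * γ))

end IsRun

theorem memLp_stack {f : Ω → Fin n → Vec p}
    (hf : ∀ i, MemLp (fun o => f o i) 2 P) : MemLp (fun o => stack (f o)) 2 P := by
  have hm : AEStronglyMeasurable (fun o => stack (f o)) P :=
    (PiLp.continuous_toLp 2 (fun _ : Fin n => Vec p)).comp_aestronglyMeasurable
      (aemeasurable_pi_lambda _ fun i => (hf i).1.aemeasurable).aestronglyMeasurable
  refine (memLp_two_iff_integrable_sq_norm hm).2 ?_
  simp only [stack_norm_sq]
  exact integrable_finsetSum _ fun i _ => (hf i).integrable_norm_pow (by norm_num)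

theorem integral_norm_stack_sq {f : Ω → Fin n → Vec p} (hf : ∀ i, MemLp (fun o => f o i) 2 P) :
    ∫ o, ‖stack (f o)‖ ^ 2 ∂P = ∑ i, ∫ o, ‖f o i‖ ^ 2 ∂P := by
  simp only [stack_norm_sq]
  exact integral_finsetSum _ fun i _ => (hf i).integrable_norm_pow (by norm_num)

theorem integrable_energy (L : Matrix (Fin n) (Fin n) ℝ) (θ : ℝ) {f g : Ω → Fin n → Vec p}
    (hf : ∀ i, MemLp (fun o => f o i) 2 P) (hg : ∀ i, MemLp (fun o => g o i) 2 P) :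
    Integrable (fun o => energy (stackOp L) θ (stack (f o)) (stack (g o))) P := by
  have hL : MemLp (fun o => stackOp L (stack (f o))) 2 P :=
    memLp_stack (f := fun o i => ∑ j, L i j • f o j) fun i =>
      memLp_finsetSum _ fun j _ => (hf j).const_smul (L i j)
  exact ((integrable_inner_of_memLp (memLp_stack hf) hL).add
    ((memLp_stack hg).integrable_norm_pow (by norm_num))).add
    ((integrable_inner_of_memLp (memLp_stack hf) (memLp_stack hg)).const_mul (2 * θ))

namespace IsRun

variable (hR : IsRun P D F ν C A α a γ ω ℓ η₁ σ₁ δ r μ x0 ξ ζ s X)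
  [IsProbabilityMeasure P] [∀ i, IsProbabilityMeasure (D i)]
include hR

theorem integrable_lyapunov (θ : ℝ) (k : ℕ) : Integrable (fun o => lyapunov A θ (X k o)) P := by
  have hx := fun i => (hR.memLp k i).1
  have hy := fun i => (hR.memLp k i).2.1
  have hv := fun i => (hR.memLp k i).2.2.2
  exact (integrable_energy _ θ hx hv).add
    (((memLp_stack hx).sub (memLp_stack hy)).integrable_norm_pow (by norm_num))

/-- Geometric decay of the expected Lyapunov function, up to the size of the gradient
estimates. -/
theorem integral_lyapunov_succ_le {ρ₂ ρ θ m Cₑ K c h : ℝ}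
    (hs : SpectrumWithin (laplacian A) ρ₂ ρ) (hρ₂ : 0 < ρ₂)
    (hθ : 0 < θ) (hθ1 : θ ≤ 1 / 2) (hθ2 : θ ≤ ρ₂ / 2) (hh : h = α * γ) (hh0 : 0 < h)
    (hCₑ : 0 ≤ Cₑ)
    (hdec : ∀ x v e d w : Stack n p,
      energy (stackOp (laplacian A)) θ (x + increment A a h x v e d)
          (v + h • (stackOp (laplacian A) x + stackOp (laplacian A) e))
        + ‖w + increment A a h x v e d‖ ^ 2
      ≤ energy (stackOp (laplacian A)) θ x v
        - h * m * (‖stackOp (laplacian A) x‖ ^ 2 + ‖v‖ ^ 2) + Cₑ * h * ‖e‖ ^ 2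
        + (1 + ω * r * δ / 2) * ‖w‖ ^ 2 + K * ‖d‖ ^ 2)
    (hc0 : 0 ≤ c) (hc : c * (3 / 2 * (1 / ρ₂ + 1)) ≤ h * m) (hc' : c ≤ ω * r * δ / 4)
    (hδ : 0 ≤ δ)
    (hsmall : Cₑ * h * (2 * r ^ 2 * (1 - δ) + 2 * (1 - r) ^ 2) ≤ ω * r * δ / 4) (k : ℕ) :
    ∫ o, lyapunov A θ (X (k + 1) o) ∂P ≤ (1 - c) * ∫ o, lyapunov A θ (X k o) ∂P
      + K * α ^ 2 * ∑ i, ∫ o, ‖estimates F (fun i => μ i k) (fun i o => (ξ i k o, ζ i k o))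
          (fun o => (X k o).x) o i‖ ^ 2 ∂P := by
  have hx := fun i => (hR.memLp k i).1
  have hy := fun i => (hR.memLp k i).2.1
  have hv := fun i => (hR.memLp k i).2.2.2
  have hq := fun i => (hR.message_moments k hx hy i).1
  set g := estimates F (fun i => μ i k) (fun i o => (ξ i k o, ζ i k o)) (fun o => (X k o).x)
    with hg'
  have hg : ∀ i, MemLp (fun o => g o i) 2 P := fun i =>
    ((hR.isFreshSample k).memLp_and_integral_sq_le hR.cost hR.dimension
      hR.smoothness_pos.le (fun i => hR.smoothing_pos i k) hx i).1
  have hu : ∀ i, MemLp (fun o => (X k o).x i - (X k o).y i) 2 P := fun i => (hx i).sub (hy i)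
  set u : Ω → Fin n → Vec p := fun o i => (X k o).x i - (X k o).y i with hu'
  set e : Ω → Fin n → Vec p := fun o i => messages C (fun i => s i k o) (X k o) i
    - ((X k o).x i - (X k o).y i) with he'
  set w : Ω → Fin n → Vec p := fun o i => (X k o).x i - (X k o).y i
    - ω • messages C (fun i => s i k o) (X k o) i with hw'
  have he : ∀ i, MemLp (fun o => e o i) 2 P := fun i => (hq i).sub (hu i)
  have hw : ∀ i, MemLp (fun o => w o i) 2 P := fun i => (hu i).sub ((hq i).const_smul ω)
  have hsq : ∀ {f : Ω → Fin n → Vec p}, (∀ i, MemLp (fun o => f o i) 2 P) →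
      Integrable (fun o => ‖stack (f o)‖ ^ 2) P := fun hf =>
    (memLp_stack hf).integrable_norm_pow (by norm_num)
  have hEn := integrable_energy (laplacian A) θ hx hv
  have hpt : ∀ o, lyapunov A θ (X (k + 1) o)
      ≤ (1 - c) * energy (stackOp (laplacian A)) θ (stack (X k o).x) (stack (X k o).v)
        + Cₑ * h * ‖stack (e o)‖ ^ 2 + (1 + ω * r * δ / 2) * ‖stack (w o)‖ ^ 2
        + K * α ^ 2 * ‖stack (g o)‖ ^ 2 := by
    intro o
    obtain ⟨hz, hv0⟩ := hR.invariants k o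
    have h1 := hdec (stack (X k o).x) (stack (X k o).v)
      (codingError C (fun i => s i k o) (X k o))
      (-(α • stack (stepEstimates F (fun i => μ i k) (fun i => ξ i k o) (fun i => ζ i k o)
        (X k o))))
      (stack (X k o).x - stack (X k o).y - ω • stack (messages C (fun i => s i k o) (X k o)))
    rw [hh, ← stack_step_x (F := F) (C := C) (β := a * γ) (ω := ω) (μ := fun i => μ i k) rfl hz,
      ← stack_step_v (F := F) (C := C) (β := a * γ) (ω := ω) (μ := fun i => μ i k)
        (ξ := fun i => ξ i k o) (ζ := fun i => ζ i k o) hz,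
      ← stack_step_x_sub_y (F := F) (C := C) (β := a * γ) (ω := ω) (μ := fun i => μ i k) rfl hz,
      ← hR.succ, ← hh] at h1
    have e1 : codingError C (fun i => s i k o) (X k o) = stack (e o) := by
      ext i : 1
      simp only [codingError, he', PiLp.sub_apply, PiLp.add_apply]
      abel
    have e2 : stack (X k o).x - stack (X k o).y
        - ω • stack (messages C (fun i => s i k o) (X k o)) = stack (w o) := rfl
    have e3 : stepEstimates F (fun i => μ i k) (fun i => ξ i k o) (fun i => ζ i k o) (X k o)
        = g o := rfl
    rw [e1, e2, e3, norm_neg, norm_smul, mul_pow, Real.norm_eq_abs, sq_abs] at h1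
    have h2 := energy_le hR.graph hs hρ₂ hθ hθ1 hθ2 (stack (X k o).x) hv0
    have h3 := mul_le_mul_of_nonneg_left h2 hc0
    have h4 : 0 ≤ ‖stackOp (laplacian A) (stack (X k o).x)‖ ^ 2 + ‖stack (X k o).v‖ ^ 2 := by
      positivity
    have h5 := mul_le_mul_of_nonneg_right hc h4
    rw [lyapunov]
    linarith
  have i1 := hEn.const_mul (1 - c)
  have i2 := (hsq he).const_mul (Cₑ * h)
  have i3 := (hsq hw).const_mul (1 + ω * r * δ / 2)
  have i4 := (hsq hg).const_mul (K * α ^ 2)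
  have h1 := integral_mono (hR.integrable_lyapunov θ (k + 1)) (((i1.add i2).add i3).add i4) hpt
  simp only [Pi.add_apply] at h1
  rw [integral_add, integral_add, integral_add i1 i2, integral_const_mul, integral_const_mul,
    integral_const_mul, integral_const_mul, integral_norm_stack_sq hg] at h1
  rotate_left
  · exact i1.add i2
  · exact i3
  · exact (i1.add i2).add i3
  · exact i4
  have h2 : ∫ o, lyapunov A θ (X k o) ∂P
      = ∫ o, energy (stackOp (laplacian A)) θ (stack (X k o).x) (stack (X k o).v) ∂P
        + ∫ o, ‖stack (u o)‖ ^ 2 ∂P := integral_add hEn (hsq hu)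
  have h3 : ∫ o, ‖stack (e o)‖ ^ 2 ∂P
      ≤ (2 * r ^ 2 * (1 - δ) + 2 * (1 - r) ^ 2) * ∫ o, ‖stack (u o)‖ ^ 2 ∂P := by
    rw [integral_norm_stack_sq he, integral_norm_stack_sq hu, Finset.mul_sum]
    exact Finset.sum_le_sum fun i _ => (hR.message_moments k hx hy i).2.2
  have h4 : ∫ o, ‖stack (w o)‖ ^ 2 ∂P ≤ (1 - ω * r * δ) * ∫ o, ‖stack (u o)‖ ^ 2 ∂P := by
    rw [integral_norm_stack_sq hw, integral_norm_stack_sq hu, Finset.mul_sum]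
    exact Finset.sum_le_sum fun i _ => (hR.message_moments k hx hy i).2.1
  set U := ∫ o, ‖stack (u o)‖ ^ 2 ∂P with hU
  have hU0 : 0 ≤ U := integral_nonneg fun o => by positivity
  have hη : 0 ≤ ω * r * δ := mul_nonneg (mul_pos hR.ω_pos hR.scale_pos).le hδ
  have h5 := mul_le_mul_of_nonneg_left h3 (by positivity : 0 ≤ Cₑ * h)
  have h6 := mul_le_mul_of_nonneg_left h4 (by positivity : 0 ≤ 1 + ω * r * δ / 2)
  have h7 := mul_le_mul_of_nonneg_right hsmall hU0
  have h8 := mul_le_mul_of_nonneg_right hc' hU0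
  have h9 : 0 ≤ (ω * r * δ) ^ 2 * U := by positivity
  rw [h2]
  linarith

end IsRun

end Run

/-! ### Coupled scalar recursions -/

section Recursions

/-- A discrete Grönwall inequality over the horizon `T`. -/
theorem le_exp_mul_of_le_one_add_div {U : ℕ → ℝ} {T : ℕ} {A B : ℝ} (hT : 0 < T) (hA : 0 ≤ A)
    (hB : 0 ≤ B) (hU0 : 0 ≤ U 0) (hU : ∀ k, U (k + 1) ≤ (1 + A * (1 / T)) * U k + B * (1 / T))
    {k : ℕ} (hk : k ≤ T) : U k ≤ Real.exp A * (U 0 + B) := by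
  have hT0 : (0 : ℝ) < T := by exact_mod_cast hT
  have hτ : (0 : ℝ) < 1 / T := by positivity
  have h1 : ∀ k : ℕ, U k ≤ (1 + A * (1 / T)) ^ k * (U 0 + k * (1 / T) * B) := by
    intro k
    induction k with
    | zero => simp
    | succ k ih =>
      have h2 : (1 : ℝ) ≤ (1 + A * (1 / T)) ^ (k + 1) :=
        one_le_pow₀ (by linarith [mul_nonneg hA hτ.le])
      have h3 : B * (1 / T) ≤ (1 + A * (1 / T)) ^ (k + 1) * (B * (1 / T)) :=
        le_mul_of_one_le_left (mul_nonneg hB hτ.le) h2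
      calc U (k + 1) ≤ (1 + A * (1 / T)) * U k + B * (1 / T) := hU k
        _ ≤ (1 + A * (1 / T)) * ((1 + A * (1 / T)) ^ k * (U 0 + k * (1 / T) * B))
            + (1 + A * (1 / T)) ^ (k + 1) * (B * (1 / T)) := by gcongr
        _ = _ := by push_cast; ring
  have h2 : (1 + A * (1 / T)) ^ k ≤ Real.exp A := by
    calc (1 + A * (1 / T)) ^ k ≤ (Real.exp (A * (1 / T))) ^ k := by
          gcongr; linarith [Real.add_one_le_exp (A * (1 / T))]
      _ = Real.exp (k * (A * (1 / T))) := by rw [← Real.exp_nat_mul]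
      _ ≤ Real.exp A := by
          gcongr
          have : (k : ℝ) ≤ T := by exact_mod_cast hk
          calc (k : ℝ) * (A * (1 / T)) ≤ T * (A * (1 / T)) := by gcongr
            _ = A := by field_simp
  refine (h1 k).trans ?_
  have h3 : (k : ℝ) * (1 / T) * B ≤ B := by
    have : (k : ℝ) ≤ T := by exact_mod_cast hk
    have h4 : (k : ℝ) * (1 / T) ≤ 1 := by rw [mul_one_div, div_le_one hT0]; exact this
    exact mul_le_of_le_one_left hB h4
  gcongr

/-- The error bounds implied by the coupled recursions for the suboptimality `a`, the Lyapunov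
function `V` and the squared gradient `N`. The combination `a + (α B / c) V` absorbs the effect of
`V` on `a`; it grows by a factor `1 + O(1/T)` per iteration, because the feedback of `a` on `V` is
weighted by `α`. -/
theorem bounds_of_recursions {a V N : ℕ → ℝ} {T : ℕ} {α c B E A₁ A₂ g b Δ R K₀ n : ℝ}
    (hT : 0 < T) (hα : 0 < α) (hc : 0 < c) (hc1 : c ≤ 1) (hB : 0 ≤ B) (hE : 0 ≤ E) (hA₁ : 0 ≤ A₁)
    (hA₂ : 0 ≤ A₂) (hg : 0 ≤ g) (hb : 0 ≤ b) (hK₀ : 0 ≤ K₀) (hn : 1 ≤ n) (hR : 0 ≤ R)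
    (ha : ∀ k, 0 ≤ a k) (hV : ∀ k, 0 ≤ V k)
    (hrec₁ : ∀ k, a (k + 1) ≤ (1 + A₁ * (1 / T)) * a k - α / 2 * N k + α * B * V k
      + A₂ * (1 / T))
    (hN : ∀ k, 0 ≤ N k)
    (hrec₂ : ∀ k, V (k + 1) ≤ (1 - c) * V k + E * (n * (1 / T)) * (g * a k + b))
    (ha0 : a 0 ≤ Δ) (hV0 : V 0 ≤ K₀ * R) (hαn : α * n * (E * (B / c)) ≤ 1)
    (hαK : α * (B / c * K₀) ≤ 1) :
    a T ≤ Real.exp (A₁ + g) * (Δ + R + (A₂ + b)) ∧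
    V T ≤ (K₀ * R + E * (g * (Real.exp (A₁ + g) * (Δ + R + (A₂ + b))) + b)) / c * (n / T) ∧
    1 / T * ∑ k ∈ Finset.range T, N k
      ≤ 2 * (Δ + A₁ * (Real.exp (A₁ + g) * (Δ + R + (A₂ + b))) + A₂) * (1 / (α * T))
        + 2 * B * (K₀ * R + E * (g * (Real.exp (A₁ + g) * (Δ + R + (A₂ + b))) + b)) / c
          * (n / T) := by
  have hT0 : (0 : ℝ) < T := by exact_mod_cast hT
  have hτ : (0 : ℝ) < 1 / T := by positivity
  have hn0 : 0 < n := by linarith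
  set τ : ℝ := 1 / T with hτ'
  set Y := Real.exp (A₁ + g) * (Δ + R + (A₂ + b)) with hY
  have hw : 0 ≤ α * (B / c) := by positivity
  have hUY : ∀ k ≤ T, a k ≤ Y := by
    intro k hk
    have h1 := le_exp_mul_of_le_one_add_div (U := fun k => a k + α * (B / c) * V k) (T := T)
      (A := A₁ + g) (B := A₂ + b) hT (by positivity) (by positivity)
      (add_nonneg (ha 0) (mul_nonneg hw (hV 0))) (fun k => ?_) hk
    · have h2 : α * (B / c) * V 0 ≤ R := by
        calc α * (B / c) * V 0 ≤ α * (B / c) * (K₀ * R) := by gcongr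
          _ = α * (B / c * K₀) * R := by ring
          _ ≤ 1 * R := by gcongr
          _ = R := one_mul R
      have h3 := mul_nonneg hw (hV k)
      have h4 : Real.exp (A₁ + g) * (a 0 + α * (B / c) * V 0 + (A₂ + b)) ≤ Y := by
        rw [hY]; gcongr
      linarith
    · have h1 := hrec₁ k
      have h2 := mul_le_mul_of_nonneg_left (hrec₂ k) hw
      have h3 : α * (B / c) * (E * (n * τ) * (g * a k + b)) ≤ τ * (g * a k + b) := by
        have h4 : 0 ≤ τ * (g * a k + b) := by
          have := ha k; positivity
        calc α * (B / c) * (E * (n * τ) * (g * a k + b))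
            = α * n * (E * (B / c)) * (τ * (g * a k + b)) := by ring
          _ ≤ 1 * (τ * (g * a k + b)) := by gcongr
          _ = _ := one_mul _
      have h5 : α * (B / c) * ((1 - c) * V k) = α * (B / c) * V k - α * B * V k := by
        field_simp
      have h6 : 0 ≤ α / 2 * N k := mul_nonneg (by positivity) (hN k)
      have h7 : 0 ≤ (A₁ + g) * τ * (α * (B / c) * V k) :=
        mul_nonneg (by positivity) (mul_nonneg hw (hV k))
      linarith
  have hY0 : 0 ≤ Y := (ha 0).trans (hUY 0 (Nat.zero_le T))
  set Z := E * (g * Y + b) with hZ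
  have hZ0 : 0 ≤ Z := by positivity
  have hVrec : ∀ k < T, V (k + 1) ≤ (1 - c) * V k + n * τ * Z := by
    intro k hk
    refine (hrec₂ k).trans ?_
    have h1 := hUY k hk.le
    have : E * (n * τ) * (g * a k + b) ≤ E * (n * τ) * (g * Y + b) := by gcongr
    rw [hZ]
    linarith
  refine ⟨hUY T le_rfl, ?_, ?_⟩
  · have h1 : ∀ k ≤ T, V k ≤ (1 - c) ^ k * V 0 + n * τ * Z / c := by
      intro k hk
      induction k with
      | zero =>
        have : 0 ≤ n * τ * Z / c := by positivity
        simpa using this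
      | succ k ih =>
        have h2 := ih (by omega)
        have h3 := mul_le_mul_of_nonneg_left h2 (sub_nonneg.2 hc1)
        have h4 : (1 - c) * (n * τ * Z / c) = n * τ * Z / c - n * τ * Z := by field_simp
        have h5 := hVrec k (by omega)
        rw [pow_succ]
        linarith
    have h2 : (1 - c) ^ T ≤ τ / c := by
      have h3 : (1 - c) ^ T ≤ Real.exp (-(c * T)) := by
        calc (1 - c) ^ T ≤ (Real.exp (-c)) ^ T := by
              gcongr
              linarith [Real.add_one_le_exp (-c)]
          _ = Real.exp (-(c * T)) := by rw [← Real.exp_nat_mul]; congr 1; ring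
      have h4 : Real.exp (-(c * T)) ≤ τ / c := by
        rw [Real.exp_neg, hτ', div_div, one_div, mul_comm (T : ℝ)]
        gcongr
        linarith [Real.add_one_le_exp (c * T)]
      exact h3.trans h4
    calc V T ≤ (1 - c) ^ T * V 0 + n * τ * Z / c := h1 T le_rfl
      _ ≤ τ / c * (K₀ * R) + n * τ * Z / c := by
          have := mul_le_mul h2 hV0 (hV 0) (by positivity)
          linarith
      _ ≤ n * (τ / c * (K₀ * R)) + n * τ * Z / c := by
          have : 0 ≤ τ / c * (K₀ * R) := by positivity
          nlinarith
      _ = _ := by rw [hτ']; field_simp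
  · have hsumV : c * ∑ k ∈ Finset.range T, V k ≤ n * (K₀ * R + Z) := by
      have h1 : ∀ j ≤ T, c * ∑ k ∈ Finset.range j, V k ≤ V 0 - V j + j * (n * τ * Z) := by
        intro j hj
        induction j with
        | zero => simp
        | succ j ih =>
          have h2 := ih (by omega)
          have h3 := hVrec j (by omega)
          rw [Finset.sum_range_succ]
          push_cast
          linarith
      have h2 := h1 T le_rfl
      have h3 : (T : ℝ) * (n * τ * Z) = n * Z := by rw [hτ']; field_simp
      have h4 : K₀ * R ≤ n * (K₀ * R) := le_mul_of_one_le_left (by positivity) hn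
      linarith [hV T]
    have hsumN : α / 2 * ∑ k ∈ Finset.range T, N k
        ≤ Δ + A₁ * Y + A₂ + α * B * ∑ k ∈ Finset.range T, V k := by
      have h1 : ∀ j ≤ T, α / 2 * ∑ k ∈ Finset.range j, N k
          ≤ a 0 - a j + j * (τ * (A₁ * Y + A₂)) + α * B * ∑ k ∈ Finset.range j, V k := by
        intro j hj
        induction j with
        | zero => simp
        | succ j ih =>
          have h2 := ih (by omega)
          have h3 := hrec₁ j
          have h4 : A₁ * τ * a j ≤ A₁ * τ * Y := by
            have := hUY j (by omega); gcongr
          rw [Finset.sum_range_succ, Finset.sum_range_succ]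
          push_cast
          linarith
      have h2 := h1 T le_rfl
      have h3 : (T : ℝ) * (τ * (A₁ * Y + A₂)) = A₁ * Y + A₂ := by rw [hτ']; field_simp
      linarith [ha T]
    have h1 : ∑ k ∈ Finset.range T, V k ≤ n * (K₀ * R + Z) / c := by
      rw [le_div_iff₀ hc]; linarith
    have h2 : ∑ k ∈ Finset.range T, N k
        ≤ 2 / α * (Δ + A₁ * Y + A₂) + 2 * B * (n * (K₀ * R + Z) / c) := by
      have h3 : α * B * ∑ k ∈ Finset.range T, V k ≤ α * B * (n * (K₀ * R + Z) / c) := by gcongr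
      have h4 : ∑ k ∈ Finset.range T, N k = 2 / α * (α / 2 * ∑ k ∈ Finset.range T, N k) := by
        field_simp
      rw [h4]
      calc _ ≤ 2 / α * (Δ + A₁ * Y + A₂ + α * B * (n * (K₀ * R + Z) / c)) := by
            gcongr; linarith
        _ = _ := by field_simp
    calc τ * ∑ k ∈ Finset.range T, N k
        ≤ τ * (2 / α * (Δ + A₁ * Y + A₂) + 2 * B * (n * (K₀ * R + Z) / c)) := by gcongr
      _ = _ := by rw [hτ']; field_simp

end Recursions

/-! ### Error bounds for a run -/

section Constants

variable (ℓ η₁ σ₁ κμ Δ H R : ℝ)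

/-- The coefficient of the suboptimality in the bound for the second moment of the estimates,
divided by the dimension. -/
noncomputable def valueCoeff : ℝ := 32 * (1 + η₁ ^ 2) * ℓ

/-- The coefficient of the consensus error in the bound for the second moment of the estimates,
divided by the dimension. -/
noncomputable def consensusCoeff : ℝ := 8 * (1 + η₁ ^ 2) * ℓ ^ 2

/-- The constant term in the bound for the second moment of the estimates, divided by the
dimension; `H` bounds the heterogeneity `f* - (1/n) ∑ f_i*`. -/
noncomputable def noiseCoeff : ℝ :=
  32 * (1 + η₁ ^ 2) * ℓ * H + 4 * σ₁ ^ 2 + 2 * ℓ ^ 2 * κμ ^ 2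

/-- The constant term of the recursion for the suboptimality, in units of `1/T`. -/
noncomputable def driftCoeff : ℝ := ℓ * noiseCoeff ℓ η₁ σ₁ κμ H + ℓ ^ 2 * κμ ^ 2

/-- The bound for the expected suboptimality over the whole horizon. -/
noncomputable def valueBound : ℝ :=
  Real.exp (ℓ * valueCoeff ℓ η₁ + valueCoeff ℓ η₁)
    * (Δ + R + (driftCoeff ℓ η₁ σ₁ κμ H + noiseCoeff ℓ η₁ σ₁ κμ H))

/-- Twice the sum of the initial suboptimality and of the total increase which the suboptimality
recursion allows over the whole horizon, apart from the consensus error. -/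
noncomputable def gradientBound : ℝ :=
  2 * (Δ + ℓ * valueCoeff ℓ η₁ * valueBound ℓ η₁ σ₁ κμ Δ H R + driftCoeff ℓ η₁ σ₁ κμ H)

/-- `c` times the coefficient of `n / T` in the bound for the Lyapunov function, where `c` is
the contraction rate, `K` the gain of the Lyapunov function and `K₀ R` bounds its initial
value. -/
noncomputable def lyapunovBound (K₀ K : ℝ) : ℝ :=
  K₀ * R + K * (valueCoeff ℓ η₁ * valueBound ℓ η₁ σ₁ κμ Δ H R + noiseCoeff ℓ η₁ σ₁ κμ H)

variable {ℓ Δ H R}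

theorem noiseCoeff_nonneg (hℓ : 0 ≤ ℓ) (hH : 0 ≤ H) : 0 ≤ noiseCoeff ℓ η₁ σ₁ κμ H := by
  unfold noiseCoeff; positivity

theorem driftCoeff_nonneg (hℓ : 0 ≤ ℓ) (hH : 0 ≤ H) : 0 ≤ driftCoeff ℓ η₁ σ₁ κμ H :=
  add_nonneg (mul_nonneg hℓ (noiseCoeff_nonneg η₁ σ₁ κμ hℓ hH)) (by positivity)

theorem valueBound_nonneg (hℓ : 0 ≤ ℓ) (hΔ : 0 ≤ Δ) (hH : 0 ≤ H) (hR : 0 ≤ R) :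
    0 ≤ valueBound ℓ η₁ σ₁ κμ Δ H R := by
  have h1 := noiseCoeff_nonneg η₁ σ₁ κμ hℓ hH
  have h2 := driftCoeff_nonneg η₁ σ₁ κμ hℓ hH
  unfold valueBound; positivity

theorem gradientBound_nonneg (hℓ : 0 ≤ ℓ) (hΔ : 0 ≤ Δ) (hH : 0 ≤ H) (hR : 0 ≤ R) :
    0 ≤ gradientBound ℓ η₁ σ₁ κμ Δ H R := by
  have h1 := valueBound_nonneg η₁ σ₁ κμ hℓ hΔ hH hR
  have h2 := driftCoeff_nonneg η₁ σ₁ κμ hℓ hH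
  unfold gradientBound valueCoeff; positivity

theorem lyapunovBound_nonneg (hℓ : 0 ≤ ℓ) (hΔ : 0 ≤ Δ) (hH : 0 ≤ H) (hR : 0 ≤ R) {K₀ K : ℝ}
    (hK₀ : 0 ≤ K₀) (hK : 0 ≤ K) : 0 ≤ lyapunovBound ℓ η₁ σ₁ κμ Δ H R K₀ K := by
  have h1 := valueBound_nonneg η₁ σ₁ κμ hℓ hΔ hH hR
  have h2 := noiseCoeff_nonneg η₁ σ₁ κμ hℓ hH
  unfold lyapunovBound valueCoeff; positivity

end Constants

section Run

variable {n p : ℕ} {Ω : Type w} [MeasurableSpace Ω] {P : Measure Ω} [IsProbabilityMeasure P]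
  {Ξ : Fin n → Type u} [∀ i, MeasurableSpace (Ξ i)] {D : (i : Fin n) → Measure (Ξ i)}
  [∀ i, IsProbabilityMeasure (D i)]
  {F : (i : Fin n) → Vec p → Ξ i → ℝ} {S : Type v} [MeasurableSpace S] {ν : Measure S}
  {C : S → Vec p → Vec p} {A : Matrix (Fin n) (Fin n) ℝ} {α a γ ω ℓ η₁ σ₁ δ r : ℝ}
  {μ : Fin n → ℕ → ℝ} {x0 : Fin n → Vec p} {ξ : (i : Fin n) → ℕ → Ω → Ξ i}
  {ζ : Fin n → ℕ → Ω → UnitSphere p} {s : Fin n → ℕ → Ω → S} {X : ℕ → Ω → State n p}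

omit [∀ i, IsProbabilityMeasure (D i)] in
theorem average_iInf_le_globalCost (hb : LocallyLowerBounded F D) (x : Vec p) :
    (1 / (n : ℝ)) * ∑ i, (⨅ y, localCost F D i y) ≤ globalCost F D x := by
  unfold globalCost
  gcongr with i
  exact ciInf_le (hb i) x

omit [∀ i, IsProbabilityMeasure (D i)] in
theorem bddBelow_globalCost (hb : LocallyLowerBounded F D) :
    BddBelow (Set.range (globalCost F D)) :=
  ⟨_, Set.forall_mem_range.2 (average_iInf_le_globalCost hb)⟩

namespace IsRun

variable (hR : IsRun P D F ν C A α a γ ω ℓ η₁ σ₁ δ r μ x0 ξ ζ s X)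
include hR

theorem integrable_globalCost (k : ℕ) :
    Integrable (fun o => globalCost F D (average (X k o).x)) P :=
  (isSmooth_globalCost hR.cost hR.smoothness_pos.le hR.agents).integrable_comp
    hR.smoothness_pos.le
    (measurable_average.comp (measurable_pi_lambda _ (hR.measurableState k).x))
    (memLp_average fun i => (hR.memLp k i).1)

theorem integrable_gradient_sq (k : ℕ) :
    Integrable (fun o => ‖∇ (globalCost F D) (average (X k o).x)‖ ^ 2) P :=
  ((isSmooth_globalCost hR.cost hR.smoothness_pos.le hR.agents).memLp_gradient
    (measurable_average.comp (measurable_pi_lambda _ (hR.measurableState k).x))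
    (memLp_average fun i => (hR.memLp k i).1)).integrable_norm_pow (by norm_num)

theorem suboptimality_nonneg (hb : LocallyLowerBounded F D) (k : ℕ) :
    0 ≤ ∫ o, globalCost F D (average (X k o).x) ∂P - ⨅ x, globalCost F D x := by
  have h := integral_mono (integrable_const (⨅ x, globalCost F D x)) (hR.integrable_globalCost k)
    fun o => ciInf_le (bddBelow_globalCost hb) _
  rw [integral_const, probReal_univ, one_smul] at h
  linarith

variable {H κμ M : ℝ} (hb : LocallyLowerBounded F D)
  (hH : (⨅ x, globalCost F D x) - (1 / (n : ℝ)) * ∑ i, (⨅ x, localCost F D i x) ≤ H)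
  (hM : ∀ i k, μ i k ^ 2 ≤ M) (hpM : p * M ≤ κμ ^ 2)
include hb hH hM hpM

theorem integral_average_sq_le (k : ℕ) :
    ∫ o, (1 / (n : ℝ)) * ∑ i, ‖estimates F (fun i => μ i k) (fun i o => (ξ i k o, ζ i k o))
        (fun o => (X k o).x) o i‖ ^ 2 ∂P
      ≤ p * (valueCoeff ℓ η₁
          * (∫ o, globalCost F D (average (X k o).x) ∂P - ⨅ x, globalCost F D x)
        + consensusCoeff ℓ η₁ * ∫ o, consensusError (X k o).x ∂P
        + noiseCoeff ℓ η₁ σ₁ κμ H) := by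
  have hℓ := hR.smoothness_pos
  have h1 := (hR.isFreshSample k).integral_average_sq_le hR.cost hR.dimension
    (fun i => hR.smoothing_pos i k) (fun i => (hR.memLp k i).1) hℓ hR.agents
    (m := fun i => ⨅ x, localCost F D i x) (fun i y => ciInf_le (hb i) y) (fun i => hM i k)
  refine h1.trans ?_
  have hp0 : (0 : ℝ) ≤ p := by positivity
  have h2 : 32 * p * (1 + η₁ ^ 2) * ℓ * ((⨅ x, globalCost F D x)
      - (1 / (n : ℝ)) * ∑ i, (⨅ x, localCost F D i x))
      ≤ 32 * p * (1 + η₁ ^ 2) * ℓ * H := by gcongr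
  have h3 : 2 * p * ℓ ^ 2 * (p * M) ≤ 2 * p * ℓ ^ 2 * κμ ^ 2 := by gcongr
  unfold valueCoeff consensusCoeff noiseCoeff
  linarith

theorem suboptimality_succ_le {τ : ℝ} (hα : 0 < α) (hαℓ : 2 * ℓ * α ≤ 1)
    (hαM : α * M ≤ κμ ^ 2 * τ) (hατ : α ^ 2 * p ≤ n * τ)
    (hαp : α * p * consensusCoeff ℓ η₁ ≤ ℓ) (hnoise : 0 ≤ noiseCoeff ℓ η₁ σ₁ κμ H) (k : ℕ) :
    ∫ o, globalCost F D (average (X (k + 1) o).x) ∂P - ⨅ x, globalCost F D x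
      ≤ (1 + ℓ * valueCoeff ℓ η₁ * τ)
          * (∫ o, globalCost F D (average (X k o).x) ∂P - ⨅ x, globalCost F D x)
        - α / 2 * ∫ o, ‖∇ (globalCost F D) (average (X k o).x)‖ ^ 2 ∂P
        + α * (2 * ℓ ^ 2) * ∫ o, consensusError (X k o).x ∂P
        + driftCoeff ℓ η₁ σ₁ κμ H * τ := by
  have hℓ := hR.smoothness_pos
  have hn : (1 : ℝ) ≤ n := by exact_mod_cast hR.agents
  have hn0 : (0 : ℝ) < n := by linarith
  have h1 := (hR.isFreshSample k).integral_globalCost_le hR.cost hR.dimension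
    (fun i => hR.smoothing_pos i k) (fun i => (hR.memLp k i).1) hℓ hR.agents
    (fun i => hM i k) hα hαℓ
  have e : ∀ o, average (X (k + 1) o).x = average (X k o).x
      - α • average (estimates F (fun i => μ i k) (fun i o => (ξ i k o, ζ i k o))
        (fun o => (X k o).x) o) := by
    intro o
    rw [hR.succ]
    obtain ⟨hz, hv⟩ := hR.invariants k o
    exact average_step_x hR.graph rfl hz hv
  simp only [e]
  have h2 := hR.integral_average_sq_le hb hH hM hpM k
  have ha := hR.suboptimality_nonneg hb k
  have hcons : 0 ≤ ∫ o, consensusError (X k o).x ∂P :=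
    integral_nonneg fun o => consensusError_nonneg _
  set G := ∫ o, (1 / (n : ℝ)) * ∑ i, ‖estimates F (fun i => μ i k)
    (fun i o => (ξ i k o, ζ i k o)) (fun o => (X k o).x) o i‖ ^ 2 ∂P
  set q := ∫ o, consensusError (X k o).x ∂P
  set f₀ := ∫ o, globalCost F D (average (X k o).x) ∂P
  set fs := ⨅ x, globalCost F D x
  have hg : 0 ≤ valueCoeff ℓ η₁ := by unfold valueCoeff; positivity
  have h3 : ℓ * α ^ 2 / n * G ≤ ℓ * α ^ 2 / n * (p * (valueCoeff ℓ η₁ * (f₀ - fs)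
      + consensusCoeff ℓ η₁ * q + noiseCoeff ℓ η₁ σ₁ κμ H)) := by gcongr
  have h4 : ℓ * α ^ 2 / n * (p * (valueCoeff ℓ η₁ * (f₀ - fs) + noiseCoeff ℓ η₁ σ₁ κμ H))
      ≤ ℓ * τ * (valueCoeff ℓ η₁ * (f₀ - fs) + noiseCoeff ℓ η₁ σ₁ κμ H) := by
    have h5 : ℓ * (α ^ 2 * p / n) ≤ ℓ * τ := by
      gcongr; rw [div_le_iff₀ hn0]; linarith
    calc _ = ℓ * (α ^ 2 * p / n)
          * (valueCoeff ℓ η₁ * (f₀ - fs) + noiseCoeff ℓ η₁ σ₁ κμ H) := by ring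
      _ ≤ _ := by gcongr
  have h6 : ℓ * α ^ 2 / n * (p * (consensusCoeff ℓ η₁ * q)) ≤ α * ℓ ^ 2 * q := by
    calc _ = ℓ * α / n * (α * p * consensusCoeff ℓ η₁) * q := by ring
      _ ≤ ℓ * α / n * ℓ * q := by gcongr
      _ ≤ ℓ * α / 1 * ℓ * q := by gcongr
      _ = _ := by ring
  have h7 : ℓ ^ 2 * (α * M) ≤ ℓ ^ 2 * (κμ ^ 2 * τ) := by gcongr
  unfold driftCoeff
  linarith

/-- The three error bounds for a run, from the contraction of the Lyapunov function with rate
`2 c` and from smallness conditions on the stepsize. Half of the contraction absorbs the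
contribution of the consensus error to the second moment of the estimates. -/
theorem bounds {ρ₂ ρ θ c K Δ R : ℝ} {T : ℕ} (hs : SpectrumWithin (laplacian A) ρ₂ ρ)
    (hρ₂ : 0 < ρ₂) (hρ : 0 < ρ) (hθ : 0 < θ) (hθ1 : θ ≤ 1 / 2) (hθ2 : θ ≤ ρ₂ / 2)
    (hc : 0 < c) (hc1 : c ≤ 1) (hK : 0 ≤ K)
    (hlyap : ∀ k, ∫ o, lyapunov A θ (X (k + 1) o) ∂P
      ≤ (1 - 2 * c) * ∫ o, lyapunov A θ (X k o) ∂P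
        + K * α ^ 2 * ∑ i, ∫ o, ‖estimates F (fun i => μ i k)
          (fun i o => (ξ i k o, ζ i k o)) (fun o => (X k o).x) o i‖ ^ 2 ∂P)
    (hT : 0 < T) (hα : 0 < α) (hαp1 : α * p ≤ 1) (hαℓ : α * p * (2 * ℓ) ≤ 1)
    (hαM : α * M ≤ κμ ^ 2 * (1 / T)) (hατ : α ^ 2 * p ≤ n * (1 / T))
    (hαp : α * p * (consensusCoeff ℓ η₁ / ℓ) ≤ 1)
    (hαc : α * p * (K * consensusCoeff ℓ η₁ * (2 / ρ₂) / c) ≤ 1)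
    (hαK : α * p * (2 * ℓ ^ 2 * (2 / ρ₂) / c * (ρ + 1)) ≤ 1)
    (hαn : α * n * (K * (2 * ℓ ^ 2 * (2 / ρ₂) / c)) ≤ 1)
    (hΔ : globalCost F D (average x0) - (⨅ x, globalCost F D x) ≤ Δ)
    (hx0 : (1 / (n : ℝ)) * ∑ i, ‖x0 i‖ ^ 2 ≤ R) :
    ∫ o, globalCost F D (average (X T o).x) ∂P - ⨅ x, globalCost F D x
      ≤ valueBound ℓ η₁ σ₁ κμ Δ H R ∧
    ∫ o, consensusError (X T o).x ∂P
      ≤ 2 / ρ₂ * (lyapunovBound ℓ η₁ σ₁ κμ Δ H R (ρ + 1) K / c) * (n / T) ∧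
    1 / T * ∑ k ∈ Finset.range T, ∫ o, ‖∇ (globalCost F D) (average (X k o).x)‖ ^ 2 ∂P
      ≤ gradientBound ℓ η₁ σ₁ κμ Δ H R * (1 / (α * T))
        + 2 * (2 * ℓ ^ 2 * (2 / ρ₂)) * (lyapunovBound ℓ η₁ σ₁ κμ Δ H R (ρ + 1) K / c)
          * (n / T) := by
  have hℓ := hR.smoothness_pos
  have hn : (1 : ℝ) ≤ n := by exact_mod_cast hR.agents
  have hp : (1 : ℝ) ≤ p := by exact_mod_cast hR.dimension
  have hn0 : (0 : ℝ) < n := by linarith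
  have hαle : α ≤ α * p := le_mul_of_one_le_right hα.le hp
  have hH0 : 0 ≤ H := (sub_nonneg.2 (le_ciInf (average_iInf_le_globalCost hb))).trans hH
  have hR0 : 0 ≤ R := le_trans (by positivity) hx0
  have hv0 : 0 ≤ valueCoeff ℓ η₁ := by unfold valueCoeff; positivity
  have hq0 : 0 ≤ consensusCoeff ℓ η₁ := by unfold consensusCoeff; positivity
  have hb0 : 0 ≤ noiseCoeff ℓ η₁ σ₁ κμ H := noiseCoeff_nonneg η₁ σ₁ κμ hℓ.le hH0
  have hd0 : 0 ≤ driftCoeff ℓ η₁ σ₁ κμ H := driftCoeff_nonneg η₁ σ₁ κμ hℓ.le hH0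
  have hsmall : ∀ {t : ℝ}, 0 ≤ t → α * p * t ≤ 1 → α * t ≤ 1 := fun ht h =>
    (mul_le_mul_of_nonneg_right hαle ht).trans h
  have hpt : ∀ k o, 0 ≤ lyapunov A θ (X k o) ∧
      consensusError (X k o).x ≤ 2 / ρ₂ * (1 / n * lyapunov A θ (X k o)) := fun k o =>
    lyapunov_nonneg_and_consensusError_le hR.graph hs hρ₂ hR.agents hθ hθ1 hθ2
      (hR.invariants k o).2
  have hcons : ∀ k, ∫ o, consensusError (X k o).x ∂P
      ≤ 2 / ρ₂ * (1 / n * ∫ o, lyapunov A θ (X k o) ∂P) := by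
    intro k
    rw [← integral_const_mul, ← integral_const_mul]
    exact integral_mono (integrable_consensusError fun i => (hR.memLp k i).1)
      (((hR.integrable_lyapunov θ k).const_mul _).const_mul _) fun o => (hpt k o).2
  have hrec := bounds_of_recursions
    (a := fun k => ∫ o, globalCost F D (average (X k o).x) ∂P - ⨅ x, globalCost F D x)
    (V := fun k => 1 / n * ∫ o, lyapunov A θ (X k o) ∂P)
    (N := fun k => ∫ o, ‖∇ (globalCost F D) (average (X k o).x)‖ ^ 2 ∂P)
    (α := α) (c := c) (B := 2 * ℓ ^ 2 * (2 / ρ₂)) (E := K) (A₁ := ℓ * valueCoeff ℓ η₁)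
    (A₂ := driftCoeff ℓ η₁ σ₁ κμ H) (g := valueCoeff ℓ η₁) (b := noiseCoeff ℓ η₁ σ₁ κμ H)
    (Δ := Δ) (R := R) (K₀ := ρ + 1) (n := n) hT hα hc hc1 (by positivity) hK (by positivity) hd0
    hv0 hb0 (by positivity) hn hR0 (hR.suboptimality_nonneg hb)
    (fun k => mul_nonneg (by positivity) (integral_nonneg fun o => (hpt k o).1)) ?_
    (fun k => integral_nonneg fun o => by positivity) ?_ ?_ ?_ hαn
    (hsmall (by positivity) hαK)
  · obtain ⟨h1, h2, h3⟩ := hrec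
    refine ⟨h1, ?_, ?_⟩
    · refine (hcons T).trans ?_
      rw [mul_assoc]
      exact mul_le_mul_of_nonneg_left h2 (by positivity)
    · refine h3.trans (le_of_eq ?_)
      unfold gradientBound lyapunovBound valueBound
      ring
  · intro k
    have h1 := hR.suboptimality_succ_le hb hH hM hpM (τ := 1 / T) hα
      (by linarith [hsmall (by positivity) hαℓ]) hαM hατ
      (by rwa [← mul_div_assoc, div_le_one hℓ] at hαp) hb0 k
    have h2 := mul_le_mul_of_nonneg_left (hcons k) (by positivity : 0 ≤ α * (2 * ℓ ^ 2))
    beta_reduce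
    linarith
  · intro k
    have h1 := hR.integral_average_sq_le hb hH hM hpM k
    have h2 : ∫ o, (1 / (n : ℝ)) * ∑ i, ‖estimates F (fun i => μ i k)
          (fun i o => (ξ i k o, ζ i k o)) (fun o => (X k o).x) o i‖ ^ 2 ∂P
        = (1 / (n : ℝ)) * ∑ i, ∫ o, ‖estimates F (fun i => μ i k)
          (fun i o => (ξ i k o, ζ i k o)) (fun o => (X k o).x) o i‖ ^ 2 ∂P := by
      rw [integral_const_mul, integral_finsetSum]
      exact fun i _ => ((hR.isFreshSample k).memLp_and_integral_sq_le hR.cost hR.dimension hℓ.le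
        (fun i => hR.smoothing_pos i k) (fun i => (hR.memLp k i).1) i).1.integrable_norm_pow
        (by norm_num)
    rw [h2] at h1
    have h3 := mul_le_mul_of_nonneg_left (hlyap k) (by positivity : 0 ≤ 1 / (n : ℝ))
    have ha := hR.suboptimality_nonneg hb k
    have hq := hcons k
    have hV : 0 ≤ 1 / n * ∫ o, lyapunov A θ (X k o) ∂P :=
      mul_nonneg (by positivity) (integral_nonneg fun o => (hpt k o).1)
    set G := ∑ i, ∫ o, ‖estimates F (fun i => μ i k)
      (fun i o => (ξ i k o, ζ i k o)) (fun o => (X k o).x) o i‖ ^ 2 ∂P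
    set q := ∫ o, consensusError (X k o).x ∂P
    set f₀ := ∫ o, globalCost F D (average (X k o).x) ∂P
    set fs := ⨅ x, globalCost F D x
    set V := ∫ o, lyapunov A θ (X k o) ∂P
    have h4 : K * α ^ 2 * (1 / n * G) ≤ K * α ^ 2 * (p * (valueCoeff ℓ η₁ * (f₀ - fs)
        + consensusCoeff ℓ η₁ * q + noiseCoeff ℓ η₁ σ₁ κμ H)) := by gcongr
    have h5 : K * (α ^ 2 * p) * (valueCoeff ℓ η₁ * (f₀ - fs) + noiseCoeff ℓ η₁ σ₁ κμ H)
        ≤ K * (n * (1 / T)) * (valueCoeff ℓ η₁ * (f₀ - fs) + noiseCoeff ℓ η₁ σ₁ κμ H) := by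
      gcongr
    have h6 : K * α ^ 2 * p * (consensusCoeff ℓ η₁ * q) ≤ c * (1 / n * V) := by
      have h7 : α * p * (K * consensusCoeff ℓ η₁ * (2 / ρ₂)) ≤ c := by
        rwa [← mul_div_assoc, div_le_one hc] at hαc
      calc _ ≤ K * α ^ 2 * p * (consensusCoeff ℓ η₁ * (2 / ρ₂ * (1 / n * V))) := by gcongr
        _ = α * (α * p * (K * consensusCoeff ℓ η₁ * (2 / ρ₂))) * (1 / n * V) := by ring
        _ ≤ 1 * c * (1 / n * V) := by
          gcongr
          exact hαle.trans hαp1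
        _ = _ := by ring
    linarith
  · simp only [hR.zero, integral_const, probReal_univ, one_smul]
    exact hΔ
  · have h1 := lyapunov_initial_le (θ := θ) hR.graph hs hρ₂ hρ x0
    simp only [hR.zero, integral_const, probReal_univ, one_smul]
    calc _ ≤ 1 / (n : ℝ) * ((ρ + 1) * ∑ i, ‖x0 i‖ ^ 2) := by gcongr
      _ = (ρ + 1) * (1 / n * ∑ i, ‖x0 i‖ ^ 2) := by ring
      _ ≤ _ := by gcongr

end IsRun

end Run

/-! ### The stepsize -/

/-- The consequences of the choice of the stepsize and of the lower bounds for the horizon. -/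
theorem stepsize_bounds {ℓ η₁ ε₂ ε₃ κ₀ κT α : ℝ} {n p T : ℕ} (hn : 1 ≤ n) (hp : 1 ≤ p)
    (hε₂ : 0 < ε₂) (hκT : 0 < κT) (hε₃ : ε₃ ∈ StepConstantRange ℓ η₁)
    (hT₁ : (n : ℝ) * ε₃ ^ 2 * (κ₀ * p) ^ 2 / (p * ε₂ ^ 2) ≤ T) (hT₂ : (n : ℝ) ^ 3 * κT / p ≤ T)
    (hα : α = ε₃ * (√(n : ℝ) / √((p : ℝ) * T))) :
    0 < T ∧ 0 < α ∧ α * p * κ₀ ≤ ε₂ ∧ α ^ 2 * p ≤ n * (1 / T) ∧ (α * n) ^ 2 * κT ≤ 1 ∧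
      1 / (α * T) ≤ 4 * (consensusCoeff ℓ η₁ + 1) * (√(p : ℝ) / √((n : ℝ) * T)) := by
  obtain ⟨h0, hlow, hupp⟩ := hε₃
  have hn0 : (0 : ℝ) < n := by exact_mod_cast hn
  have hp0 : (0 : ℝ) < p := by exact_mod_cast hp
  have hT0 : (0 : ℝ) < T := lt_of_lt_of_le (by positivity) hT₂
  have hα0 : 0 < α := by rw [hα]; positivity
  have hε1 : ε₃ ≤ 1 := by
    by_contra! h
    have h1 : 1 < ε₃ ^ 3 := one_lt_pow₀ h (by norm_num)
    have h2 : 0 ≤ 8 * (1 + η₁ ^ 2) * ℓ ^ 2 * ε₃ ^ 2 := by positivity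
    linarith
  have hsq : α ^ 2 = ε₃ ^ 2 * n / (p * T) := by
    rw [hα, mul_pow, div_pow, Real.sq_sqrt hn0.le, Real.sq_sqrt (by positivity)]
    ring
  refine ⟨by exact_mod_cast hT0, hα0, ?_, ?_, ?_, ?_⟩
  · refine le_of_sq_le_sq ?_ hε₂.le
    rw [div_le_iff₀ (by positivity)] at hT₁
    rw [mul_pow, mul_pow, hsq]
    calc ε₃ ^ 2 * (n : ℝ) / (p * T) * p ^ 2 * κ₀ ^ 2
        = (n : ℝ) * ε₃ ^ 2 * (κ₀ * p) ^ 2 / (p * T) := by ring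
      _ ≤ ε₂ ^ 2 := by rw [div_le_iff₀ (by positivity)]; linarith
  · rw [hsq]
    have h1 : ε₃ ^ 2 ≤ 1 := pow_le_one₀ h0.le hε1
    calc ε₃ ^ 2 * (n : ℝ) / (p * T) * p = ε₃ ^ 2 * ((n : ℝ) * (1 / T)) := by field_simp
      _ ≤ 1 * ((n : ℝ) * (1 / T)) := by gcongr
      _ = _ := one_mul _
  · rw [mul_pow, hsq]
    rw [div_le_iff₀ hp0] at hT₂
    have h1 : ε₃ ^ 2 ≤ 1 := pow_le_one₀ h0.le hε1
    calc ε₃ ^ 2 * (n : ℝ) / (p * T) * n ^ 2 * κT = ε₃ ^ 2 * ((n : ℝ) ^ 3 * κT / (p * T)) := by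
          ring
      _ ≤ 1 * 1 := by
        gcongr
        rw [div_le_one (by positivity)]; linarith
      _ = 1 := one_mul 1
  · have h1 : 1 / (α * T) = 1 / ε₃ * (√(p : ℝ) / √((n : ℝ) * T)) := by
      rw [hα, Real.sqrt_mul hp0.le, Real.sqrt_mul hn0.le]
      have h2 : (√(T : ℝ)) ^ 2 = T := Real.sq_sqrt hT0.le
      have hs : √(T : ℝ) ≠ 0 := by positivity
      have hsn : √(n : ℝ) ≠ 0 := by positivity
      have hsp : √(p : ℝ) ≠ 0 := by positivity
      nth_rewrite 2 [← h2]
      field_simp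
    rw [h1]
    gcongr
    -- as `ε₃ ≤ 1`, the lower bound for `ε₃` is at most `(consensusCoeff + 1) ε₃`
    rw [div_le_iff₀ h0]
    have h3 : consensusCoeff ℓ η₁ * ε₃ ^ 2 ≤ consensusCoeff ℓ η₁ * ε₃ := by
      have : 0 ≤ consensusCoeff ℓ η₁ := by unfold consensusCoeff; positivity
      gcongr
      exact pow_le_of_le_one h0.le hε1 (by norm_num)
    have h4 : ε₃ ^ 3 ≤ ε₃ := pow_le_of_le_one h0.le hε1 (by norm_num)
    unfold consensusCoeff at *
    linarith

end HEDZOC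

theorem theorem1 :
    -- `C₁` depends on neither `n`, `p`, the network, the compressor, `ω`, `ε₁`, `ε₂`, `ε₃` nor `T`
    ∃ C₁ : (ℓ η₁ σ₁ κμ Δ H R : ℝ) → ℝ,
    ∀ ρ₂ ρ : ℝ, 0 < ρ₂ → ρ₂ ≤ ρ →
    ∃ κ₁ : ℝ, 0 < κ₁ ∧ ∀ ε₁ : ℝ, κ₁ < ε₁ →
    ∀ δ r ω ℓ : ℝ, 0 < δ → δ ≤ 1 → 0 < r → 0 < ω → ω ≤ 1 / r → 0 < ℓ →
    ∃ κ₂ : ℝ, 0 < κ₂ ∧ ∀ ε₂ : ℝ, 0 < ε₂ → ε₂ < κ₂ →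
    ∀ η₁ : ℝ, 0 ≤ η₁ →
    ∃ κ₀ : ℝ, 0 < κ₀ ∧
    ∀ σ₁ κμ H : ℝ, 0 ≤ σ₁ → 0 < κμ →
    ∃ κT : ℝ, 0 < κT ∧
    ∀ Δ R : ℝ,
    ∃ C₂ : ℝ,
    ∀ (n p : ℕ), 1 ≤ n → 1 ≤ p →
    -- the network
    ∀ A : Matrix (Fin n) (Fin n) ℝ, HEDZOC.IsUndirectedConnected A →
      HEDZOC.SpectrumWithin (HEDZOC.laplacian A) ρ₂ ρ →
    -- the costs
    ∀ (Ξ : Fin n → Type u) [∀ i, MeasurableSpace (Ξ i)]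
      (D : (i : Fin n) → Measure (Ξ i)) [∀ i, IsProbabilityMeasure (D i)]
      (F : (i : Fin n) → HEDZOC.Vec p → Ξ i → ℝ),
      HEDZOC.WellDefinedCosts F D → HEDZOC.LocallyLowerBounded F D →
      HEDZOC.SmoothCosts F D ℓ → HEDZOC.BoundedVariance F D η₁ σ₁ →
    -- the compressor
    ∀ (S : Type v) [MeasurableSpace S] (ν : Measure S) [IsProbabilityMeasure ν]
      (C : S → HEDZOC.Vec p → HEDZOC.Vec p), HEDZOC.IsCompressor ν C δ r →
    -- the initial points; `Δ`, `H`, `R` only name the data on which the constants depend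
    ∀ x0 : Fin n → HEDZOC.Vec p,
      HEDZOC.globalCost F D (HEDZOC.average x0) - (⨅ x, HEDZOC.globalCost F D x) ≤ Δ →
      (⨅ x, HEDZOC.globalCost F D x)
        - (1 / (n : ℝ)) * ∑ i, (⨅ x, HEDZOC.localCost F D i x) ≤ H →
      (1 / (n : ℝ)) * ∑ i, ‖x0 i‖ ^ 2 ≤ R →
    -- the algorithm parameters
    ∀ ε₃ ∈ HEDZOC.StepConstantRange ℓ η₁,
    ∀ T : ℕ, (n : ℝ) * ε₃ ^ 2 * (κ₀ * p) ^ 2 / (p * ε₂ ^ 2) ≤ T → (n : ℝ) ^ 3 * κT / p ≤ T →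
    ∀ α β γ : ℝ, α = ε₃ * (√(n : ℝ) / √((p : ℝ) * T)) → γ = ε₂ / α → β = ε₁ * γ →
    ∀ μ : Fin n → ℕ → ℝ,
      (∀ i k, 0 < μ i k ∧ μ i k ≤ κμ * √((p : ℝ) * α) / √((n : ℝ) + p)) →
    -- the randomness
    ∀ (Ω : Type w) [MeasurableSpace Ω] (P : Measure Ω) [IsProbabilityMeasure P]
      (ξ : (i : Fin n) → ℕ → Ω → Ξ i) (ζ : Fin n → ℕ → Ω → HEDZOC.UnitSphere p)
      (s : Fin n → ℕ → Ω → S), HEDZOC.IsRandomInput P D ν ξ ζ s →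
    -- the iterates `x i k` and their average `xbar k`
    ∀ (x : ℕ → Ω → Fin n → HEDZOC.Vec p) (xbar : ℕ → Ω → HEDZOC.Vec p),
      (x = fun k o => (HEDZOC.iterates (HEDZOC.laplacian A) F C (fun _ => α) (fun _ => β)
        (fun _ => γ) ω μ x0 ξ ζ s k o).x) →
      (xbar = fun k o => HEDZOC.average (x k o)) →
    ((∀ k < T, Integrable (fun o => ‖gradient (HEDZOC.globalCost F D) (xbar k o)‖ ^ 2) P) ∧
      (1 / (T : ℝ)) * ∑ k ∈ Finset.range T,
          ∫ o, ‖gradient (HEDZOC.globalCost F D) (xbar k o)‖ ^ 2 ∂P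
        ≤ C₁ ℓ η₁ σ₁ κμ Δ H R * (√(p : ℝ) / √((n : ℝ) * T)) + C₂ * ((n : ℝ) / T)) ∧
    (Integrable (fun o => HEDZOC.globalCost F D (xbar T o)) P ∧
      (∫ o, HEDZOC.globalCost F D (xbar T o) ∂P) - (⨅ x, HEDZOC.globalCost F D x)
        ≤ C₁ ℓ η₁ σ₁ κμ Δ H R) ∧
    (Integrable (fun o => (1 / (n : ℝ)) * ∑ i, ‖x T o i - xbar T o‖ ^ 2) P ∧
      ∫ o, (1 / (n : ℝ)) * ∑ i, ‖x T o i - xbar T o‖ ^ 2 ∂P ≤ C₂ * ((n : ℝ) / T)) := by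
  refine ⟨fun ℓ η₁ σ₁ κμ Δ H R => HEDZOC.valueBound ℓ η₁ σ₁ κμ Δ H R
    + HEDZOC.gradientBound ℓ η₁ σ₁ κμ Δ H R * (4 * (HEDZOC.consensusCoeff ℓ η₁ + 1)), ?_⟩
  intro ρ₂ ρ hρ₂ hρρ
  have hρ : 0 < ρ := hρ₂.trans_le hρρ
  refine ⟨1, one_pos, fun ε₁ hε₁ δ r ω ℓ hδ hδ1 hr hω hωr hℓ => ?_⟩
  have hη : 0 < ω * r * δ := by positivity
  obtain ⟨θ, m, Cₑ, h₀, hθ, hθ1, hθ2, hm, hCₑ, hh₀, hdec⟩ :=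
    HEDZOC.exists_lyapunov_decrease hρ₂ hρ (one_pos.trans hε₁) hη
  -- `r₀` is the relative mean squared error of the compressed messages
  set r₀ := 2 * r ^ 2 * (1 - δ) + 2 * (1 - r) ^ 2 with hr₀
  have hr₀0 : 0 ≤ r₀ := by
    have : 0 ≤ 1 - δ := by linarith
    positivity
  refine ⟨min h₀ (ω * r * δ / 4 / (Cₑ * (r₀ + 1))), by positivity, fun ε₂ hε₂ hκ₂ => ?_⟩
  have hsmall : Cₑ * ε₂ * r₀ ≤ ω * r * δ / 4 := by
    have h1 := (hκ₂.trans_le (min_le_right _ _)).le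
    rw [le_div_iff₀ (by positivity)] at h1
    have h2 : 0 ≤ ε₂ * Cₑ := by positivity
    linarith
  obtain ⟨K, hK, hdec⟩ := hdec ε₂ hε₂ (hκ₂.trans_le (min_le_left _ _)).le
  -- `2 c` is the contraction rate of the Lyapunov function
  obtain ⟨c, hc, hc1, hcm, hcη⟩ : ∃ c : ℝ, 0 < c ∧ c ≤ 1 ∧
      2 * c * (3 / 2 * (1 / ρ₂ + 1)) ≤ ε₂ * m ∧ 2 * c ≤ ω * r * δ / 4 := by
    refine ⟨min 1 (min (ε₂ * m / (3 * (1 / ρ₂ + 1))) (ω * r * δ / 8)), by positivity,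
      min_le_left _ _, ?_, ?_⟩
    · have h1 := (min_le_right (1 : ℝ) _).trans
        (min_le_left (ε₂ * m / (3 * (1 / ρ₂ + 1))) (ω * r * δ / 8))
      rw [le_div_iff₀ (by positivity)] at h1
      linarith
    · have h1 := (min_le_right (1 : ℝ) _).trans
        (min_le_right (ε₂ * m / (3 * (1 / ρ₂ + 1))) (ω * r * δ / 8))
      linarith
  intro η₁ _
  have hq0 : 0 ≤ HEDZOC.consensusCoeff ℓ η₁ := by unfold HEDZOC.consensusCoeff; positivity
  -- the parenthesis dominates all upper bounds needed for `1 / (α p)`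
  refine ⟨ε₂ * (1 + 2 * ℓ + HEDZOC.consensusCoeff ℓ η₁ / ℓ
    + K * HEDZOC.consensusCoeff ℓ η₁ * (2 / ρ₂) / c
    + 2 * ℓ ^ 2 * (2 / ρ₂) / c * (ρ + 1)), by positivity, fun σ₁ κμ H _ _ => ?_⟩
  refine ⟨(K * (2 * ℓ ^ 2 * (2 / ρ₂) / c)) ^ 2, by positivity, fun Δ R => ?_⟩
  refine ⟨(2 / ρ₂ + 2 * (2 * ℓ ^ 2 * (2 / ρ₂)))
    * (HEDZOC.lyapunovBound ℓ η₁ σ₁ κμ Δ H R (ρ + 1) K / c), ?_⟩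
  intro n p hn hp A hA hs Ξ _ D _ F hF hb hsm hvar S _ ν _ C hC x0 hΔ hH hx0 ε₃ hε₃ T hT₁ hT₂
    α β γ hα hγ hβ μ hμ Ω _ P _ ξ ζ s hin x xbar hx hxbar
  obtain ⟨hT, hα0, hακ, hατ, hαn, hαT⟩ :=
    HEDZOC.stepsize_bounds hn hp hε₂ (by positivity) hε₃ hT₁ hT₂ hα
  have hn0 : (0 : ℝ) < n := by exact_mod_cast hn
  have hp0 : (0 : ℝ) < p := by exact_mod_cast hp
  have hT0 : (0 : ℝ) < T := by exact_mod_cast hT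
  set X := HEDZOC.iterates (HEDZOC.laplacian A) F C (fun _ => α) (fun _ => β) (fun _ => γ) ω μ x0
    ξ ζ s with hX
  have hR : HEDZOC.IsRun P D F ν C A α ε₁ γ ω ℓ η₁ σ₁ δ r μ x0 ξ ζ s X :=
    { cost := fun i => ⟨hF.measurable i, hF.integrable i,
        (hsm i).mono fun ξ h => ⟨h.1, h.2⟩, fun x => (hvar i x).1, fun x => (hvar i x).2⟩
      compressor := hC
      input := hin
      graph := hA
      agents := hn
      dimension := hp
      smoothness_pos := hℓ
      scale_pos := hr
      ω_pos := hω
      ω_le := hωr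
      smoothing_pos := fun i k => (hμ i k).1
      eq_iterates := by rw [hX, hβ] }
  have hh : ε₂ = α * γ := by rw [hγ]; field_simp
  have hlyap := hR.integral_lyapunov_succ_le (h := ε₂) (c := 2 * c) (K := K) hs hρ₂ hθ hθ1 hθ2 hh
    hε₂ hCₑ.le (hdec _ _ (HEDZOC.isGapOperator_stackOp hA hs hρ₂)) (by positivity) hcm hcη hδ.le
    hsmall
  -- the smoothing radii
  have hM : ∀ i k, μ i k ^ 2 ≤ κμ ^ 2 * (p * α / (n + p)) := by
    intro i k
    calc μ i k ^ 2 ≤ (κμ * √((p : ℝ) * α) / √((n : ℝ) + p)) ^ 2 :=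
          pow_le_pow_left₀ (hμ i k).1.le (hμ i k).2 2
      _ = _ := by
          rw [div_pow, mul_pow, Real.sq_sqrt (by positivity), Real.sq_sqrt (by positivity)]
          ring
  have hterm : ∀ {t u : ℝ}, α * p * (ε₂ * u) ≤ ε₂ → t ≤ u → α * p * t ≤ 1 := by
    intro t u h1 h2
    have h3 : α * p * u ≤ 1 := by
      refine le_of_mul_le_mul_left ?_ hε₂
      linarith
    exact (mul_le_mul_of_nonneg_left h2 (by positivity)).trans h3
  have hu1 : 0 ≤ HEDZOC.consensusCoeff ℓ η₁ / ℓ := by positivity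
  have hu2 : 0 ≤ K * HEDZOC.consensusCoeff ℓ η₁ * (2 / ρ₂) / c := by positivity
  have hu3 : 0 ≤ 2 * ℓ ^ 2 * (2 / ρ₂) / c * (ρ + 1) := by positivity
  have hαp1 : α * p ≤ 1 := by
    have := hterm (t := 1) hακ (by linarith)
    linarith
  have hpM : p * (κμ ^ 2 * (p * α / (n + p))) ≤ κμ ^ 2 := by
    have h1 : p * (p * α / (n + p)) ≤ (1 : ℝ) := by
      rw [← mul_div_assoc, div_le_one (by positivity)]
      have : p * (α * p) ≤ p * (1 : ℝ) := by gcongr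
      linarith
    calc _ = κμ ^ 2 * (p * (p * α / (n + p))) := by ring
      _ ≤ κμ ^ 2 * 1 := by gcongr
      _ = _ := mul_one _
  have hαM : α * (κμ ^ 2 * (p * α / (n + p))) ≤ κμ ^ 2 * (1 / T) := by
    have h1 : α * (p * α / (n + p)) ≤ 1 / T := by
      calc _ = α ^ 2 * p / (n + p) := by ring
        _ ≤ n * (1 / T) / (n + 0) := by gcongr
        _ = 1 / T := by field_simp; ring
    calc _ = κμ ^ 2 * (α * (p * α / (n + p))) := by ring
      _ ≤ _ := by gcongr
  obtain ⟨h1, h2, h3⟩ := hR.bounds (Δ := Δ) (R := R) hb hH hM hpM hs hρ₂ hρ hθ hθ1 hθ2 hc hc1 hK.le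
    hlyap hT hα0 hαp1 (hterm hακ (by linarith)) hαM hατ (hterm hακ (by linarith))
    (hterm hακ (by linarith)) (hterm hακ (by linarith))
    (by rw [← mul_pow] at hαn; exact (abs_le.1 ((sq_le_one_iff_abs_le_one _).1 hαn)).2) hΔ hx0
  have hxT : ∀ k o, x k o = (X k o).x := fun k o => by rw [hx]
  have hxbT : ∀ k o, xbar k o = HEDZOC.average (X k o).x := fun k o => by rw [hxbar, ← hxT]
  simp only [hxT, hxbT]
  have hΔ0 : 0 ≤ Δ :=
    (sub_nonneg.2 (ciInf_le (HEDZOC.bddBelow_globalCost hb) _)).trans hΔ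
  have hH0 : 0 ≤ H := (sub_nonneg.2 (le_ciInf (HEDZOC.average_iInf_le_globalCost hb))).trans hH
  have hR0 : 0 ≤ R := le_trans (by positivity) hx0
  have hY0 := HEDZOC.valueBound_nonneg η₁ σ₁ κμ hℓ.le hΔ0 hH0 hR0
  have hG0 := HEDZOC.gradientBound_nonneg η₁ σ₁ κμ hℓ.le hΔ0 hH0 hR0
  have hZ0 : 0 ≤ HEDZOC.lyapunovBound ℓ η₁ σ₁ κμ Δ H R (ρ + 1) K / c :=
    div_nonneg (HEDZOC.lyapunovBound_nonneg η₁ σ₁ κμ hℓ.le hΔ0 hH0 hR0 (by positivity) hK.le) hc.le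
  set Y := HEDZOC.valueBound ℓ η₁ σ₁ κμ Δ H R
  set G := HEDZOC.gradientBound ℓ η₁ σ₁ κμ Δ H R
  set Z := HEDZOC.lyapunovBound ℓ η₁ σ₁ κμ Δ H R (ρ + 1) K / c
  have hZ1 : 0 ≤ 2 / ρ₂ * Z * (n / T) := by positivity
  have hZ2 : 0 ≤ 2 * (2 * ℓ ^ 2 * (2 / ρ₂)) * Z * (n / T) := by positivity
  refine ⟨⟨fun k _ => hR.integrable_gradient_sq k, ?_⟩, ⟨hR.integrable_globalCost T, ?_⟩,
    HEDZOC.integrable_consensusError fun i => (hR.memLp T i).1, ?_⟩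
  · have h4 := mul_le_mul_of_nonneg_left hαT hG0
    have h5 : 0 ≤ Y * (√(p : ℝ) / √((n : ℝ) * T)) := by positivity
    linarith
  · have h4 : 0 ≤ G * (4 * (HEDZOC.consensusCoeff ℓ η₁ + 1)) := by positivity
    linarith
  · refine h2.trans ?_
    linarith
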